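/- Let $M$ be a smooth oriented $3$-manifold with a conformal class of smooth Riemannian metrics. Let $C\xrightarrow{\pi}M$ be the $5$-dimensional manifold whose points are pairs $(x,[p])$ with $x\in M$ and $p\in T_x^*M\setminus\{0\}$ taken up to positive scaling (equivalently, the bundle of oriented $2$-planes $P=\ker p\subset T_xM$), and let $q:T^*M\setminus 0\to C$ be the quotient map. Let $H\subset TC$ be the contact distribution, $H_{(x,[p])}=\{v\in T_{(x,[p])}C : p(d\pi(v))=0\}$. For a metric $g$ in the conformal class, its Levi-Civita connection $\nabla$ splits $T_p(T^*M)=T_xM\oplus T_x^*M$: a tangent vector $\xi$ has components $(X,\omega)$, where $X$ is its image in $T_xM$ and $\omega(Y)=\xi(q'\mapsto q'(Y))-p(\nabla_XY)$ for all vector fields $Y$ on $M$. Indices are raised and lowered with $g$, $\epsilon_{abc}$ is the volume form of $g$, and tangent vectors of $C$ at $[p]$ are written as images under $dq$ of pairs $(X,\omega)$. Then, for every $g$ in the conformal class, the formula $$J\begin{bmatrix}X^b\\ \omega^b\end{bmatrix}=\frac{1}{\sqrt{p^dp_d}}\begin{bmatrix}\epsilon^{abc}X_ap_c\\ \epsilon^{abc}\omega_ap_c\end{bmatrix}\qquad(X^ap_a=0)$$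 determines a unique well-defined endomorphism $J$ of $H$ (in particular it does not depend on the choice of the representative $p$ of $[p]$ or of the representative of $\omega$ modulo $p$), and $J$ is the same for all metrics $g$ in the conformal class. The distribution $H$ is a smooth subbundle of $TC$ of rank $4$, $J$ is smooth, and $J^2=-\mathrm{Id}$. The almost CR structure $(H,J)$ is integrable: for all smooth local sections $\xi,\eta$ of $H$, the vector field $[J\xi,\eta]+[\xi,J\eta]$ is a section of $H$ and $$N(\xi,\eta)=[\xi,\eta]-[J\xi,J\eta]+J\big([J\xi,\eta]+[\xi,J\eta]\big)=0 .$$ The CR structure $(H,J)$ is Levi-indefinite: at every point of $C$ the quotient $TC/H$ is one-dimensional, and the Levi form $L:H\times H\to TC/H$, $L(\xi,\eta)=[\xi,\eta]\bmod H$, is non-degenerate, satisfies $L(Jv,Jw)=L(v,w)$, and the quadratic form $v\mapsto L(v,Jv)$ takes values of both signs. -/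

import Mathlib

open scoped Manifold ContDiff Topology
open Bundle

noncomputable section

namespace Saucer

/-- The model space `ℝ³` of the base manifold. -/
abbrev E3 : Type := EuclideanSpace ℝ (Fin 3)

/-- The model space `ℝ³ × ℝ²` of the configuration space. -/
abbrev E5 : Type := E3 × (Fin 2 → ℝ)

section Base

variable {M : Type*} [TopologicalSpace M] [ChartedSpace E3 M]

instance (x : M) : FiniteDimensional ℝ (TangentSpace (𝓡 3) x) :=
  inferInstanceAs (FiniteDimensional ℝ E3)

instance (x : M) : T2Space (TangentSpace (𝓡 3) x) := inferInstanceAs (T2Space E3)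

/-- The cotangent space `T_x^*M`. -/
abbrev CotangentSpace (x : M) : Type := TangentSpace (𝓡 3) x →L[ℝ] ℝ

instance (x : M) : Nontrivial (CotangentSpace x) :=
  inferInstanceAs (Nontrivial (E3 →L[ℝ] ℝ))

theorem finrank_tangentSpace (x : M) : Module.finrank ℝ (TangentSpace (𝓡 3) x) = 3 :=
  finrank_euclideanSpace_fin (𝕜 := ℝ) (n := 3)

theorem finrank_cotangentSpace (x : M) : Module.finrank ℝ (CotangentSpace x) = 3 := by
  have e : CotangentSpace x ≃ₗ[ℝ] Module.Dual ℝ (TangentSpace (𝓡 3) x) :=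
    LinearMap.toContinuousLinearMap.symm
  rw [e.finrank_eq, Subspace.dual_finrank_eq, finrank_tangentSpace]

variable (M) in
/-- The total space of the cotangent bundle `T^*M`. -/
abbrev CotangentBundle : Type _ := TotalSpace (E3 →L[ℝ] ℝ) (fun x : M => CotangentSpace x)

/-- The model with corners of `T^*M`. -/
abbrev IT : ModelWithCorners ℝ (E3 × (E3 →L[ℝ] ℝ)) (ModelProd E3 (E3 →L[ℝ] ℝ)) :=
  (𝓡 3).prod 𝓘(ℝ, E3 →L[ℝ] ℝ)

variable (M) in
/-- The configuration space `C`: a point is a point `x ∈ M` together with a non-zero covector at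
`x` up to positive scaling, that is, an oriented `2`-plane in `T_xM`. -/
structure ConfigurationSpace : Type _ where
  /-- The projection `π : C → M`. -/
  proj : M
  /-- The class of non-zero covectors, up to positive scaling. -/
  ray : Module.Ray ℝ (CotangentSpace proj)

/-- Some covector representing the point `c ∈ C`; it is unique up to positive scaling. -/
def covector (c : ConfigurationSpace M) : CotangentSpace c.proj := c.ray.someVector

open Classical in
/-- The ray of a non-zero covector (with an arbitrary value at zero). -/
def toRay {x : M} (p : CotangentSpace x) : Module.Ray ℝ (CotangentSpace x) :=
  if h : p = 0 then Classical.arbitrary _ else rayOfNeZero ℝ p h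

/-- The quotient map `T^*M ∖ 0 → C` (with arbitrary values on the zero section). -/
def toConfig (p : CotangentBundle M) : ConfigurationSpace M := ⟨p.1, toRay p.2⟩

theorem toRay_of_ne {x : M} {p : CotangentSpace x} (h : p ≠ 0) : toRay p = rayOfNeZero ℝ p h :=
  dif_neg h

theorem covector_ne_zero (c : ConfigurationSpace M) : covector c ≠ 0 :=
  c.ray.someVector_ne_zero

theorem toConfig_covector (c : ConfigurationSpace M) :
    toConfig ⟨c.proj, covector c⟩ = c := by
  obtain ⟨x, r⟩ := c
  change (⟨x, toRay r.someVector⟩ : ConfigurationSpace M) = _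
  rw [toRay_of_ne r.someVector_ne_zero, r.someVector_ray]

theorem toConfig_eq_of_pos {x : M} {p q : CotangentSpace x} (hq : q ≠ 0) {t : ℝ} (ht : 0 < t)
    (h : p = t • q) : toConfig ⟨x, p⟩ = toConfig ⟨x, q⟩ := by
  have hp : p ≠ 0 := by rw [h]; exact smul_ne_zero ht.ne' hq
  change (⟨x, toRay p⟩ : ConfigurationSpace M) = ⟨x, toRay q⟩
  congr 1
  rw [toRay_of_ne hp, toRay_of_ne hq, ray_eq_iff, h]
  exact SameRay.sameRay_pos_smul_left _ ht

theorem covector_toConfig {x : M} {p : CotangentSpace x} (hp : p ≠ 0) :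
    ∃ t : ℝ, 0 < t ∧ covector (toConfig ⟨x, p⟩) = t • p := by
  have h1 : (rayOfNeZero ℝ p hp).someVector ≠ 0 := Module.Ray.someVector_ne_zero _
  have h2 : SameRay ℝ p (rayOfNeZero ℝ p hp).someVector := by
    rw [← ray_eq_iff hp h1, Module.Ray.someVector_ray]
  obtain ⟨r, hr, h⟩ := h2.exists_pos_left hp h1
  refine ⟨r, hr, ?_⟩
  rw [h]
  change (toRay p).someVector = _
  rw [toRay_of_ne hp]

end Base

section Charts

variable {M : Type*} [TopologicalSpace M] [ChartedSpace E3 M] [IsManifold (𝓡 3) ∞ M]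

/-- The frame of `T_xM` given by the coordinates at `x₀`. -/
def frame (x₀ x : M) : E3 →L[ℝ] TangentSpace (𝓡 3) x := tangentCoordChange (𝓡 3) x₀ x x

/-- The components of a tangent vector at `x` in the coordinates at `x₀`. -/
def coframe (x₀ x : M) : TangentSpace (𝓡 3) x →L[ℝ] E3 := tangentCoordChange (𝓡 3) x x₀ x

/-- The covector `ℓ` with `ℓ(b₀) = 1`, `ℓ(b₁) = y₀` and `ℓ(b₂) = y₁`. -/
def affineCovector (b : Module.Basis (Fin 3) ℝ E3) (y : Fin 2 → ℝ) : E3 →L[ℝ] ℝ :=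
  LinearMap.toContinuousLinearMap (b.coord 0 + ∑ j : Fin 2, y j • b.coord j.succ)

theorem affineCovector_zero (b : Module.Basis (Fin 3) ℝ E3) (y : Fin 2 → ℝ) :
    affineCovector b y (b 0) = 1 := by
  simp [affineCovector]

theorem affineCovector_succ (b : Module.Basis (Fin 3) ℝ E3) (y : Fin 2 → ℝ) (j : Fin 2) :
    affineCovector b y (b j.succ) = y j := by
  fin_cases j <;> simp [affineCovector]

theorem coframe_frame {x₀ x₁ x : M} (h₀ : x ∈ (chartAt E3 x₀).source)
    (h₁ : x ∈ (chartAt E3 x₁).source) (v : E3) :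
    coframe x₀ x (frame x₁ x v) = tangentCoordChange (𝓡 3) x₁ x₀ x v := by
  apply tangentCoordChange_comp
  simp [h₀, h₁]

theorem coframe_frame_self {x₀ x : M} (h₀ : x ∈ (chartAt E3 x₀).source) (v : E3) :
    coframe x₀ x (frame x₀ x v) = v := by
  rw [coframe_frame h₀ h₀]
  exact tangentCoordChange_self (by simpa using h₀)

theorem frame_coframe {x₀ x : M} (h₀ : x ∈ (chartAt E3 x₀).source)
    (v : TangentSpace (𝓡 3) x) : frame x₀ x (coframe x₀ x v) = v := by
  have h : tangentCoordChange (𝓡 3) x₀ x x (tangentCoordChange (𝓡 3) x x₀ x v)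
      = tangentCoordChange (𝓡 3) x x x v := by
    apply tangentCoordChange_comp
    simp [h₀]
  exact h.trans (tangentCoordChange_self (by simp))

theorem affineCovector_coframe_ne_zero {x₀ x : M} (h₀ : x ∈ (chartAt E3 x₀).source)
    (b : Module.Basis (Fin 3) ℝ E3) (y : Fin 2 → ℝ) :
    (affineCovector b y).comp (coframe x₀ x) ≠ 0 := by
  intro h
  have := congrArg (fun f : CotangentSpace x => f (frame x₀ x (b 0))) h
  simp [coframe_frame_self h₀, affineCovector_zero] at this

/-- The affine chart of `C` attached to the coordinates of `M` at `x₀` and to a basis `b` of `ℝ³`: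
it is defined at the `(x, [p])` with `p(b₀) > 0` and sends `(x, [p])` to the coordinates of `x`
together with `(p(b₁) / p(b₀), p(b₂) / p(b₀))`. -/
def configChart (x₀ : M) (b : Module.Basis (Fin 3) ℝ E3) :
    PartialEquiv (ConfigurationSpace M) E5 where
  toFun c := (chartAt E3 x₀ c.proj,
    fun j => covector c (frame x₀ c.proj (b j.succ)) / covector c (frame x₀ c.proj (b 0)))
  invFun z := toConfig ⟨(chartAt E3 x₀).symm z.1,
    (affineCovector b z.2).comp (coframe x₀ ((chartAt E3 x₀).symm z.1))⟩
  source := {c | c.proj ∈ (chartAt E3 x₀).source ∧ 0 < covector c (frame x₀ c.proj (b 0))}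
  target := (chartAt E3 x₀).target ×ˢ Set.univ
  map_source' c hc := ⟨(chartAt E3 x₀).map_source hc.1, trivial⟩
  map_target' z hz := by
    have hx := (chartAt E3 x₀).map_target hz.1
    obtain ⟨t, ht, h⟩ := covector_toConfig (affineCovector_coframe_ne_zero hx b z.2)
    refine ⟨hx, ?_⟩
    rw [h]
    change 0 < t * affineCovector b z.2 (coframe x₀ _ (frame x₀ _ (b 0)))
    erw [coframe_frame_self hx, affineCovector_zero, mul_one]
    exact ht
  left_inv' c hc := by
    obtain ⟨x, r⟩ := c
    obtain ⟨hx, hp⟩ := hc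
    set c : ConfigurationSpace M := ⟨x, r⟩ with hc
    change x ∈ _ at hx
    conv_rhs => rw [← toConfig_covector c]
    have hx' : (chartAt E3 x₀).symm (chartAt E3 x₀ x) = x := (chartAt E3 x₀).left_inv hx
    change toConfig ⟨(chartAt E3 x₀).symm (chartAt E3 x₀ x), _⟩ = _
    dsimp only
    change toConfig ⟨(chartAt E3 x₀).symm (chartAt E3 x₀ x),
      (affineCovector b fun j => covector c (frame x₀ x (b j.succ)) /
        covector c (frame x₀ x (b 0))).comp
        (coframe x₀ ((chartAt E3 x₀).symm (chartAt E3 x₀ x)))⟩ = toConfig ⟨x, covector c⟩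
    rw [hx']
    change 0 < covector c (frame x₀ x (b 0)) at hp
    refine toConfig_eq_of_pos (covector_ne_zero c) (inv_pos.2 hp) ?_
    have key : affineCovector b (fun j => covector c (frame x₀ x (b j.succ)) /
        covector c (frame x₀ x (b 0))) =
        ((covector c (frame x₀ x (b 0)))⁻¹ • covector c).comp (frame x₀ x) := by
      apply ContinuousLinearMap.coe_injective
      refine b.ext fun i => ?_
      refine Fin.cases ?_ (fun j => ?_) i
      · change affineCovector b _ (b 0) = _ * covector c (frame x₀ x (b 0))
        rw [affineCovector_zero, inv_mul_cancel₀ hp.ne']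
      · change affineCovector b _ (b j.succ) = _ * covector c (frame x₀ x (b j.succ))
        rw [affineCovector_succ, div_eq_inv_mul]
    rw [key]
    ext v
    change _ * covector c (frame x₀ x (coframe x₀ x v)) = _ * covector c v
    rw [frame_coframe hx]
  right_inv' z hz := by
    have hx := (chartAt E3 x₀).map_target hz.1
    obtain ⟨t, ht, h⟩ := covector_toConfig (affineCovector_coframe_ne_zero hx b z.2)
    refine Prod.ext ((chartAt E3 x₀).right_inv hz.1) (funext fun j => ?_)
    dsimp only
    rw [h]
    change t * affineCovector b z.2 (coframe x₀ _ (frame x₀ _ (b j.succ))) /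
      (t * affineCovector b z.2 (coframe x₀ _ (frame x₀ _ (b 0)))) = _
    erw [coframe_frame_self hx, coframe_frame_self hx, affineCovector_zero, affineCovector_succ,
      mul_one, mul_div_cancel_left₀ _ ht.ne']


/-- A non-zero covector is positive on the first vector of some basis. -/
theorem exists_basis_pos {ℓ : E3 →L[ℝ] ℝ} (h : ℓ ≠ 0) :
    ∃ b : Module.Basis (Fin 3) ℝ E3, 0 < ℓ (b 0) := by
  let e : Module.Basis (Fin 3) ℝ E3 := (EuclideanSpace.basisFun (Fin 3) ℝ).toBasis
  obtain ⟨k, hk⟩ : ∃ k, ℓ (e k) ≠ 0 := by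
    by_contra! hc
    exact h (ContinuousLinearMap.coe_injective (e.ext fun i => by simpa using hc i))
  let e' := e.reindex (Equiv.swap 0 k)
  have h0 : e' 0 = e k := by simp [e']
  rcases hk.lt_or_gt with hk | hk
  · refine ⟨e'.unitsSMul fun _ => -1, ?_⟩
    rw [Module.Basis.unitsSMul_apply, h0]
    simpa using hk
  · exact ⟨e', by rwa [h0]⟩


theorem exists_configChart (c : ConfigurationSpace M) :
    ∃ b : Module.Basis (Fin 3) ℝ E3, c ∈ (configChart c.proj b).source := by
  have h : (covector c).comp (frame c.proj c.proj) ≠ 0 := by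
    intro h
    refine covector_ne_zero c (ContinuousLinearMap.ext fun v => ?_)
    have := congrArg (fun f : E3 →L[ℝ] ℝ => f (coframe c.proj c.proj v)) h
    change covector c (frame _ _ (coframe _ _ v)) = 0 at this
    rwa [frame_coframe (mem_chart_source E3 c.proj)] at this
  obtain ⟨b, hb⟩ := exists_basis_pos h
  exact ⟨b, mem_chart_source E3 c.proj, hb⟩

/-- The pairing of the covector with affine coordinates `z.2` at the point with coordinates `z.1`
with the vector `v` of components given in the coordinates at `x₁`. -/
def pairing (x₀ x₁ : M) (b : Module.Basis (Fin 3) ℝ E3) (v : E3) (z : E5) : ℝ :=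
  affineCovector b z.2 (tangentCoordChange (𝓡 3) x₁ x₀ ((chartAt E3 x₀).symm z.1) v)

theorem covector_configChart_symm {x₀ x₁ : M} (b : Module.Basis (Fin 3) ℝ E3) {z : E5}
    (hz : z.1 ∈ (chartAt E3 x₀).target)
    (hz' : (chartAt E3 x₀).symm z.1 ∈ (chartAt E3 x₁).source) :
    ∃ t : ℝ, 0 < t ∧ ∀ v : E3, covector ((configChart x₀ b).symm z)
      (frame x₁ ((chartAt E3 x₀).symm z.1) v) = t * pairing x₀ x₁ b v z := by
  have hx := (chartAt E3 x₀).map_target hz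
  obtain ⟨t, ht, h⟩ := covector_toConfig (affineCovector_coframe_ne_zero hx b z.2)
  refine ⟨t, ht, fun v => ?_⟩
  change covector (toConfig _) _ = _
  rw [h]
  change t * affineCovector b z.2 (coframe x₀ _ (frame x₁ _ v)) = _
  rw [coframe_frame hx hz', pairing]

theorem configChart_trans_source (x₀ x₁ : M) (b b' : Module.Basis (Fin 3) ℝ E3) :
    ((configChart x₀ b).symm.trans (configChart x₁ b')).source =
      {z | z.1 ∈ ((chartAt E3 x₀).symm.trans (chartAt E3 x₁)).source ∧
        0 < pairing x₀ x₁ b (b' 0) z} := by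
  ext z
  rw [PartialEquiv.trans_source, OpenPartialHomeomorph.trans_source]
  change (z.1 ∈ (chartAt E3 x₀).target ∧ True) ∧ ((chartAt E3 x₀).symm z.1 ∈ (chartAt E3 x₁).source ∧
      0 < covector ((configChart x₀ b).symm z) (frame x₁ ((chartAt E3 x₀).symm z.1) (b' 0))) ↔
    (z.1 ∈ (chartAt E3 x₀).target ∧ (chartAt E3 x₀).symm z.1 ∈ (chartAt E3 x₁).source) ∧ _
  constructor
  · rintro ⟨⟨h1, -⟩, h2, h3⟩
    obtain ⟨t, ht, h⟩ := covector_configChart_symm b h1 h2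
    rw [h] at h3
    exact ⟨⟨h1, h2⟩, (mul_pos_iff_of_pos_left ht).1 h3⟩
  · rintro ⟨⟨h1, h2⟩, h3⟩
    obtain ⟨t, ht, h⟩ := covector_configChart_symm b h1 h2
    exact ⟨⟨h1, trivial⟩, h2, by rw [h]; exact mul_pos ht h3⟩

theorem configChart_trans_eqOn (x₀ x₁ : M) (b b' : Module.Basis (Fin 3) ℝ E3) :
    Set.EqOn ((configChart x₀ b).symm.trans (configChart x₁ b'))
      (fun z => ((chartAt E3 x₁) ((chartAt E3 x₀).symm z.1),
        fun j => pairing x₀ x₁ b (b' j.succ) z / pairing x₀ x₁ b (b' 0) z))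
      ((configChart x₀ b).symm.trans (configChart x₁ b')).source := by
  intro z hz
  rw [configChart_trans_source] at hz
  obtain ⟨⟨h1, h2⟩, h3⟩ := hz
  obtain ⟨t, ht, h⟩ := covector_configChart_symm b h1 h2
  refine Prod.ext rfl (funext fun j => ?_)
  change covector ((configChart x₀ b).symm z) (frame x₁ ((chartAt E3 x₀).symm z.1) (b' j.succ)) /
    covector ((configChart x₀ b).symm z) (frame x₁ ((chartAt E3 x₀).symm z.1) (b' 0)) = _
  rw [h, h, mul_div_mul_left _ _ ht.ne']

theorem contDiffOn_chart_trans (x₀ x₁ : M) :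
    ContDiffOn ℝ ∞ ((chartAt E3 x₀).symm.trans (chartAt E3 x₁))
      ((chartAt E3 x₀).symm.trans (chartAt E3 x₁)).source := by
  have h := (contDiffGroupoid ∞ (𝓡 3)).compatible (chart_mem_atlas E3 x₀) (chart_mem_atlas E3 x₁)
  have h' := (contDiffGroupoid ∞ (𝓡 3)).symm h
  rw [contDiffGroupoid, mem_groupoid_of_pregroupoid] at h
  simpa [contDiffPregroupoid] using h.1

theorem contDiffOn_coordChange (x₀ x₁ : M) :
    ContDiffOn ℝ ∞ (fun a : E3 => tangentCoordChange (𝓡 3) x₁ x₀ ((chartAt E3 x₀).symm a))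
      ((chartAt E3 x₀).symm.trans (chartAt E3 x₁)).source := by
  have : IsManifold (𝓡 3) (∞ + 1) M := ‹IsManifold (𝓡 3) ∞ M›
  have h := contDiffOn_fderiv_coord_change (n := ∞) (I := 𝓡 3) (achart E3 x₁) (achart E3 x₀)
  refine (h.comp (contDiffOn_chart_trans x₀ x₁) ?_).congr ?_
  · rintro a ⟨ha, ha'⟩
    change a ∈ (chartAt E3 x₀).target at ha
    change (chartAt E3 x₀).symm a ∈ (chartAt E3 x₁).source at ha'
    have h1 := (chartAt E3 x₁).map_source ha'
    have h2 := (chartAt E3 x₀).map_target ha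
    have h3 := (chartAt E3 x₁).left_inv ha'
    rw [← h3] at h2
    have h4 : (chartAt E3 x₁).symm ((chartAt E3 x₁) ((chartAt E3 x₀).symm a)) ∈
        (chartAt E3 x₀).source := h2
    simpa using And.intro h1 h4
  · intro a ha
    rfl

theorem contDiffOn_pairing (x₀ x₁ : M) (b : Module.Basis (Fin 3) ℝ E3) (v : E3) :
    ContDiffOn ℝ ∞ (pairing x₀ x₁ b v)
      {z | z.1 ∈ ((chartAt E3 x₀).symm.trans (chartAt E3 x₁)).source} := by
  have h1 : ContDiff ℝ ∞ (fun z : E5 => affineCovector b z.2) := by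
    have h0 : ∀ y : Fin 2 → ℝ, affineCovector b y = LinearMap.toContinuousLinearMap (b.coord 0) +
        ∑ j : Fin 2, y j • LinearMap.toContinuousLinearMap (b.coord j.succ) := fun y => by
      simp [affineCovector, map_add]
    simp only [h0]
    fun_prop
  have h2 := (contDiffOn_coordChange x₀ x₁).comp (contDiff_fst (F := Fin 2 → ℝ)).contDiffOn
    (s := {z : E5 | z.1 ∈ ((chartAt E3 x₀).symm.trans (chartAt E3 x₁)).source}) fun z hz => hz
  exact h1.contDiffOn.clm_apply (h2.clm_apply contDiffOn_const)

theorem isOpen_configChart_trans_source (x₀ x₁ : M) (b b' : Module.Basis (Fin 3) ℝ E3) :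
    IsOpen ((configChart x₀ b).symm.trans (configChart x₁ b')).source := by
  rw [configChart_trans_source]
  have ho : IsOpen {z : E5 | z.1 ∈ ((chartAt E3 x₀).symm.trans (chartAt E3 x₁)).source} :=
    ((chartAt E3 x₀).symm.trans (chartAt E3 x₁)).open_source.preimage continuous_fst
  exact (contDiffOn_pairing x₀ x₁ b (b' 0)).continuousOn.isOpen_inter_preimage ho isOpen_Ioi

theorem contDiffOn_configChart_trans (x₀ x₁ : M) (b b' : Module.Basis (Fin 3) ℝ E3) :
    ContDiffOn ℝ ∞ ((configChart x₀ b).symm.trans (configChart x₁ b'))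
      ((configChart x₀ b).symm.trans (configChart x₁ b')).source := by
  refine ContDiffOn.congr ?_ (configChart_trans_eqOn x₀ x₁ b b')
  rw [configChart_trans_source]
  have h := fun v => (contDiffOn_pairing x₀ x₁ b v).mono (t := {z | z.1 ∈ 
    ((chartAt E3 x₀).symm.trans (chartAt E3 x₁)).source ∧ 0 < pairing x₀ x₁ b (b' 0) z})
    fun z hz => hz.1
  refine ContDiffOn.prodMk ?_ (contDiffOn_pi.2 fun j => (h _).div (h _) fun z hz => hz.2.ne')
  exact (contDiffOn_chart_trans x₀ x₁).comp contDiff_fst.contDiffOn fun z hz => hz.1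

variable (M) in
/-- The atlas of affine charts of `C`. -/
def configCore : ChartedSpaceCore E5 (ConfigurationSpace M) where
  atlas := {e | ∃ x₀ b, e = configChart x₀ b}
  chartAt c := configChart c.proj (exists_configChart c).choose
  mem_chart_source c := (exists_configChart c).choose_spec
  chart_mem_atlas c := ⟨_, _, rfl⟩
  open_source := by
    rintro _ _ ⟨x₀, b, rfl⟩ ⟨x₁, b', rfl⟩
    exact isOpen_configChart_trans_source x₀ x₁ b b'
  continuousOn_toFun := by
    rintro _ _ ⟨x₀, b, rfl⟩ ⟨x₁, b', rfl⟩
    exact (contDiffOn_configChart_trans x₀ x₁ b b').continuousOn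

instance : TopologicalSpace (ConfigurationSpace M) := (configCore M).toTopologicalSpace

instance : ChartedSpace E5 (ConfigurationSpace M) := (configCore M).toChartedSpace

/-- The model with corners of `C`. -/
abbrev IC : ModelWithCorners ℝ E5 E5 := 𝓘(ℝ, E5)

instance : IsManifold IC ∞ (ConfigurationSpace M) := by
  apply isManifold_of_contDiffOn
  rintro e e' he he'
  obtain ⟨_, ⟨x₀, b, rfl⟩, rfl⟩ := Set.mem_iUnion₂.1 he
  obtain ⟨_, ⟨x₁, b', rfl⟩, rfl⟩ := Set.mem_iUnion₂.1 he'
  refine (contDiffOn_configChart_trans x₀ x₁ b b').congr_mono ?_ ?_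
  · intro z hz; rfl
  · intro z hz; exact hz.1

/-- The oriented plane `P ⊂ T_xM` tautologically attached to a point of `C` over `x`. -/
def plane (c : ConfigurationSpace M) : Submodule ℝ (TangentSpace (𝓡 3) c.proj) :=
  LinearMap.ker (covector c).toLinearMap

/-- The contact distribution `H ⊂ TC`, the inverse image of `P` under `dπ : TC → π^*TM`. -/
def contactDistribution (c : ConfigurationSpace M) : Submodule ℝ (TangentSpace IC c) :=
  (plane c).comap (mfderiv IC (𝓡 3) ConfigurationSpace.proj c).toLinearMap

end Charts

section Metrics

variable {M : Type*} [TopologicalSpace M] [ChartedSpace E3 M] [IsManifold (𝓡 3) ∞ M]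

variable (M) in
/-- Smooth Riemannian metrics on `M`. -/
abbrev Metric : Type _ :=
  ContMDiffRiemannianMetric (IB := 𝓡 3) (n := ∞) (F := E3)
    (E := fun x : M => TangentSpace (𝓡 3) x)

/-- The metric `g'` is `Ω² g` for a smooth positive function `Ω`. -/
def ConformallyRelated (g g' : Metric M) : Prop :=
  ∃ Ω : M → ℝ, ContMDiff (𝓡 3) 𝓘(ℝ, ℝ) ∞ Ω ∧ (∀ x, 0 < Ω x) ∧
    ∀ x v w, g'.inner x v w = Ω x ^ 2 * g.inner x v w

/-- A conformal structure on `M`: the set of all metrics conformally related to a given one. -/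
def IsConformalClass (𝒢 : Set (Metric M)) : Prop :=
  ∃ g₀ : Metric M, 𝒢 = {g | ConformallyRelated g₀ g}

variable (M) in
/-- An orientation of `M`: a choice of an orientation of every tangent space which is locally
constant in the trivialisations of the tangent bundle. -/
structure ManifoldOrientation where
  /-- The orientation of the tangent space at a point. -/
  at_ : ∀ x : M, Orientation ℝ (TangentSpace (𝓡 3) x) (Fin 3)
  locallyConstant : ∀ x₀ : M, ∃ o : Orientation ℝ E3 (Fin 3), ∀ᶠ x in 𝓝 x₀,
    ∀ hx : x ∈ (trivializationAt E3 (fun x : M => TangentSpace (𝓡 3) x) x₀).baseSet,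
      Orientation.map (Fin 3)
        ((trivializationAt E3 (fun x : M => TangentSpace (𝓡 3) x) x₀).continuousLinearEquivAt
          ℝ x hx).toLinearEquiv (at_ x) = o

/-- Lowering an index: `X^a ↦ X_a = g_{ab} X^b`. -/
def flat (g : Metric M) (x : M) : TangentSpace (𝓡 3) x ≃ₗ[ℝ] CotangentSpace x :=
  LinearMap.linearEquivOfInjective (g.inner x).toLinearMap
    (by
      refine (injective_iff_map_eq_zero _).2 fun v hv => ?_
      by_contra hne
      have h := g.pos x v hne
      have h0 : g.inner x v = 0 := hv
      rw [h0] at h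
      simp at h)
    (by rw [finrank_tangentSpace, finrank_cotangentSpace])

/-- Raising an index: `η_a ↦ η^a = g^{ab} η_b`. -/
def sharp (g : Metric M) (x : M) : CotangentSpace x ≃ₗ[ℝ] TangentSpace (𝓡 3) x :=
  (flat g x).symm

/-- A positively oriented basis of `T_xM`. -/
def orientedBasis (o : ManifoldOrientation M) (x : M) :
    Module.Basis (Fin 3) ℝ (TangentSpace (𝓡 3) x) :=
  (o.at_ x).someBasis (by rw [finrank_tangentSpace, Fintype.card_fin])

/-- The volume form `ε_{abc}` of `g`: in a positively oriented basis `b` it is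
`√(det g(b_i, b_j))` times the determinant. -/
def volumeForm (o : ManifoldOrientation M) (g : Metric M) (x : M) :
    (TangentSpace (𝓡 3) x) [⋀^Fin 3]→ₗ[ℝ] ℝ :=
  Real.sqrt (Matrix.det (Matrix.of fun i j =>
    g.inner x (orientedBasis o x i) (orientedBasis o x j))) • (orientedBasis o x).det

/-- The covector obtained from `(p^d p_d)^{-1/2} ε^{abc} η_a p_c` by lowering `b`: on a vector `Y` it
takes the value `(p^d p_d)^{-1/2} ε(η^♯, Y, p^♯)`. -/
def turn (o : ManifoldOrientation M) (g : Metric M) {x : M} (p η : CotangentSpace x) :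
    CotangentSpace x :=
  (Real.sqrt (p (sharp g x p)))⁻¹ • LinearMap.toContinuousLinearMap
    ((volumeForm o g x).toMultilinearMap.toLinearMap
      ![sharp g x η, 0, sharp g x p] 1)

/-- The tangent vector `(p^d p_d)^{-1/2} ε^{abc} X_a p_c`. -/
def turnVector (o : ManifoldOrientation M) (g : Metric M) {x : M} (p : CotangentSpace x)
    (X : TangentSpace (𝓡 3) x) : TangentSpace (𝓡 3) x :=
  sharp g x (turn o g p (flat g x X))

/-- Connections on the tangent bundle of `M`. -/
abbrev Connection (M : Type*) [TopologicalSpace M] [ChartedSpace E3 M]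
    [IsManifold (𝓡 3) ∞ M] : Type _ :=
  CovariantDerivative (𝓡 3) E3 (fun x : M => TangentSpace (𝓡 3) x)

/-- Differentiability of a vector field on `M` at a point. -/
def FieldDifferentiableAt (Y : ∀ x : M, TangentSpace (𝓡 3) x) (x : M) : Prop :=
  MDifferentiableAt (𝓡 3) (𝓡 3).tangent (fun y => (⟨y, Y y⟩ : TangentBundle (𝓡 3) M)) x

/-- The connection `D` is the Levi-Civita connection of `g`: it is torsion-free and `Dg = 0`.
Here `D Y x X` is the derivative of the vector field `Y` in the direction `X ∈ T_xM`. -/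
structure IsLeviCivita (g : Metric M) (D : Connection M) : Prop where
  torsion_eq_zero : ∀ x, D.torsion x = 0
  metric : ∀ (x : M) (X : TangentSpace (𝓡 3) x) (Y Z : ∀ y : M, TangentSpace (𝓡 3) y),
    FieldDifferentiableAt Y x → FieldDifferentiableAt Z x →
    mvfderiv (𝓡 3) (fun y => g.inner y (Y y) (Z y)) x X =
      g.inner x (D Y x X) (Z x) + g.inner x (Y x) (D Z x X)

/-- The splitting `T_p(T^*M) = T_xM ⊕ T_x^*M` given by a connection: the tangent vector `ξ` of
`T^*M` at `p` has components `X` and `η`. Here `X = dν(ξ)` and, for each vector field `Y` on `M`,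
viewed as the function `q ↦ q(Y)` on `T^*M`, one has `η(Y) = ξ(q ↦ q(Y)) - p(D_X Y)`; in other
words `η` is `D_X σ` when `ξ` is the derivative in the direction `X` of a `1`-form `σ`. -/
def HasComponents (D : Connection M) (p : CotangentBundle M) (ξ : TangentSpace IT p)
    (X : TangentSpace (𝓡 3) p.1) (η : CotangentSpace p.1) : Prop :=
  mfderiv IT (𝓡 3) (fun q : CotangentBundle M => q.1) p ξ = X ∧
  ∀ Y : ∀ y : M, TangentSpace (𝓡 3) y, FieldDifferentiableAt Y p.1 →
    η (Y p.1) = mvfderiv IT (fun q : CotangentBundle M => q.2 (Y q.1)) p ξ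
      - p.2 (D Y p.1 X)

/-- The endomorphism `J` of `H` is given, by means of the metric `g`, by
`(X, η) ↦ (p·p)^{-1/2} (ε^{abc} X_a p_c, ε^{abc} η_a p_c)`. A tangent vector of `C` at the class of
`p` is the image of a tangent vector of `T^*M` at `p`; the condition does not require that `η` be
normalised by `η^a p_a = 0`, as a multiple of `p` in `η` does not contribute. -/
def IsGivenBy (o : ManifoldOrientation M) (g : Metric M)
    (J : ∀ c : ConfigurationSpace M, contactDistribution c →ₗ[ℝ] contactDistribution c) : Prop :=
  ∀ D : Connection M, IsLeviCivita g D → ∀ p : CotangentBundle M, p.2 ≠ 0 →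
    ∀ (ξ ξ' : TangentSpace IT p) (X : TangentSpace (𝓡 3) p.1) (η : CotangentSpace p.1),
      HasComponents D p ξ X η →
      HasComponents D p ξ' (turnVector o g p.2 X) (turn o g p.2 η) →
      ∀ h : mfderiv IT IC toConfig p ξ ∈ contactDistribution (toConfig p),
        (J (toConfig p) ⟨mfderiv IT IC toConfig p ξ, h⟩ : TangentSpace IC (toConfig p)) =
          mfderiv IT IC toConfig p ξ'

end Metrics

section CR

variable {E : Type*} [NormedAddCommGroup E] [NormedSpace ℝ E] {B : Type*} [TopologicalSpace B]
  {I : ModelWithCorners ℝ E B} {N : Type*} [TopologicalSpace N] [ChartedSpace B N]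
  [IsManifold I 1 N]

/-- The vector field `ξ` is smooth on `U`. -/
def IsSmoothField (U : Set N) (ξ : ∀ y : N, TangentSpace I y) : Prop :=
  ContMDiffOn I I.tangent ∞ (fun y => (⟨y, ξ y⟩ : TangentBundle I N)) U

/-- The vector field `ξ` is a smooth section over `U` of the distribution `H`. -/
def IsSection (H : ∀ y : N, Submodule ℝ (TangentSpace I y)) (U : Set N)
    (ξ : ∀ y : N, TangentSpace I y) : Prop :=
  IsSmoothField U ξ ∧ ∀ y ∈ U, ξ y ∈ H y

/-- The distribution `H` is a smooth subbundle of rank `r` of the tangent bundle. -/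
def IsSmoothSubbundle (H : ∀ y : N, Submodule ℝ (TangentSpace I y)) (r : ℕ) : Prop :=
  ∀ y : N, ∃ U : Set N, IsOpen U ∧ y ∈ U ∧ ∃ s : Fin r → ∀ z : N, TangentSpace I z,
    (∀ i, IsSmoothField U (s i)) ∧ ∀ z ∈ U, LinearIndependent ℝ (fun i => s i z) ∧
      Submodule.span ℝ (Set.range fun i => s i z) = H z

open Classical in
/-- The field `Jξ`, for a section `ξ` of `H` (and zero where `ξ` is not in `H`). -/
def applyField {H : ∀ y : N, Submodule ℝ (TangentSpace I y)} (J : ∀ y : N, H y →ₗ[ℝ] H y)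
    (ξ : ∀ y : N, TangentSpace I y) (y : N) : TangentSpace I y :=
  if h : ξ y ∈ H y then J y ⟨ξ y, h⟩ else 0

/-- An almost CR structure of CR dimension `m`: a smooth subbundle `H` of rank `2m` with a smooth
endomorphism `J` such that `J² = -Id`. -/
structure IsAlmostCR (H : ∀ y : N, Submodule ℝ (TangentSpace I y)) (J : ∀ y : N, H y →ₗ[ℝ] H y)
    (m : ℕ) : Prop where
  subbundle : IsSmoothSubbundle H (2 * m)
  smooth : ∀ U : Set N, IsOpen U → ∀ ξ, IsSection H U ξ → IsSmoothField U (applyField J ξ)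
  sq : ∀ y v, J y (J y v) = -v

/-- Integrability of an almost CR structure: for sections `ξ` and `η` of `H` the field
`[Jξ, η] + [ξ, Jη]` is in `H` and the Nijenhuis tensor
`N(ξ, η) = [ξ, η] - [Jξ, Jη] + J([Jξ, η] + [ξ, Jη])` vanishes. -/
def IsIntegrable {H : ∀ y : N, Submodule ℝ (TangentSpace I y)} (J : ∀ y : N, H y →ₗ[ℝ] H y) :
    Prop :=
  ∀ U : Set N, IsOpen U → ∀ ξ η, IsSection H U ξ → IsSection H U η → ∀ y ∈ U,
    ∃ h : VectorField.mlieBracket I (applyField J ξ) η y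
        + VectorField.mlieBracket I ξ (applyField J η) y ∈ H y,
      VectorField.mlieBracket I ξ η y
        - VectorField.mlieBracket I (applyField J ξ) (applyField J η) y + J y ⟨_, h⟩ = 0

/-- The bilinear form `L` is the Levi form of `H` at `y`, with values in `T_yN / H_y`. -/
def IsLeviForm (H : ∀ y : N, Submodule ℝ (TangentSpace I y)) (y : N)
    (L : H y →ₗ[ℝ] H y →ₗ[ℝ] (TangentSpace I y ⧸ H y)) : Prop :=
  ∀ U : Set N, IsOpen U → y ∈ U → ∀ ξ η, IsSection H U ξ → IsSection H U η →
    ∀ (hξ : ξ y ∈ H y) (hη : η y ∈ H y),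
      L ⟨ξ y, hξ⟩ ⟨η y, hη⟩ = (H y).mkQ (VectorField.mlieBracket I ξ η y)

/-- Levi-indefiniteness of a CR structure of hypersurface type: the Levi form is non-degenerate
and the Hermitian form `v ↦ L(v, Jv)`, with values in the line `T_yN / H_y`, takes values of both
signs. -/
def IsLeviIndefinite {H : ∀ y : N, Submodule ℝ (TangentSpace I y)}
    (J : ∀ y : N, H y →ₗ[ℝ] H y) : Prop :=
  ∀ y : N, Module.finrank ℝ (TangentSpace I y ⧸ H y) = 1 ∧
    ∃ L : H y →ₗ[ℝ] H y →ₗ[ℝ] (TangentSpace I y ⧸ H y), IsLeviForm H y L ∧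
      (∀ v, (∀ w, L v w = 0) → v = 0) ∧ (∀ v w, L (J y v) (J y w) = L v w) ∧
      ∀ α : (TangentSpace I y ⧸ H y) →ₗ[ℝ] ℝ, α ≠ 0 →
        (∃ v, 0 < α (L v (J y v))) ∧ ∃ w, α (L w (J y w)) < 0

end CR

end Saucer

end

/-!
The configuration space is covered by affine charts `z = (a, y)`, where `a` are coordinates of `M`
and `y` are the coefficients of the covector `p = affineCovector b y`. All the claims are checked in
these charts. There a metric `g` is given by its Gram form `G`, its Christoffel symbols `Γ` and the
rotation `R` by a right angle of the plane `ker p`. A tangent vector `v = (X, Y)` has the covariant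
part `ω(v) = connForm v = Y - p(Γ(X, ·))`, with `Y` read as a covector vanishing on `b₀`, and only
the restriction of `ω(v)` to `ker p` matters. The contact distribution is `p(X) = 0`, and `w = Jv`
means that `w` has first component `R X` and that `ω(w) = -ω(v) ∘ R` on `ker p` (`JRel`); the second
condition is the rule for `η`, since the rotation of covectors is minus the transpose of the
rotation of vectors (`turn_eq_neg_comp`).

* The formula on `T^*M` becomes `JRel` in every affine chart
  (`chartDeriv_toConfig_of_hasComponents`), because the components `(X, η)` of a tangent vector of
  `T^*M` at `p` are, in coordinates, `X` and a positive multiple of `ω` on `ker p`. As every pair of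
  components occurs (`exists_hasComponents`) and the Levi-Civita connection exists
  (`isLeviCivita_leviCivita`), the formula determines `J`.
* For the metric `Ω²g` the rotation is the same, and for `X` and `U` in `ker p` the number
  `p(Γ(X, U))` changes by a multiple of `G(X, U)`. As `R` is skew, `JRel` does not change
  (`JRel.congr_christoffel`).
* The contact form `θ(v) = p(X)` has `dθ(v, w) = ω(v)(X_w) - ω(w)(X_v)`, since `Γ` is symmetric. On
  the contact distribution it is `J`-invariant, as `R² = -1` on `ker p`, and non-degenerate, and
  `dθ(v, Jv) = 2 ω(v)(R X)` takes both signs since `ω` can be prescribed independently of `X`. The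
  Levi form is `-dθ`.
* For integrability let `A = [ξ, η] - [Jξ, Jη]` and `B = [Jξ, η] + [ξ, Jη]`; the claim is
  `J(B) = -A`. It is tested with the one-forms `v ↦ G(Z, X)` and `v ↦ ω(v)(Z)`. For `Z₁ = Rc` and
  `Z₂ = R²c` with `c` constant, the forms `τ₁` and `τ₂` of either kind satisfy `τ₁ = τ₂ ∘ J` and
  `τ₂ = -τ₁ ∘ J` on the contact distribution, so that
  `dτ₁(ξ, η) - dτ₁(Jξ, Jη) - dτ₂(Jξ, η) - dτ₂(ξ, Jη)` has to vanish. The covariant derivatives of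
  `Z₁` and `Z₂` cancel since `Z₁ + iZ₂` is a null vector field in the planes, and the curvature
  terms, which occur for the second kind, cancel since the curvature is alternating and the plane is
  a complex line (`IsLocalModel.nijenhuis`).
-/

noncomputable section

namespace Saucer

/-! ### Rotations of an oriented plane in a Euclidean three-space -/

/-- The determinant of three vectors of `ℝ³` in the standard basis. -/
def det3 (u v w : E3) : ℝ := Matrix.det (Matrix.of ![u.ofLp, v.ofLp, w.ofLp])

theorem det3_eq (u v w : E3) : det3 u v w = u 0 * v 1 * w 2 - u 0 * v 2 * w 1
    - u 1 * v 0 * w 2 + u 1 * v 2 * w 0 + u 2 * v 0 * w 1 - u 2 * v 1 * w 0 := by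
  rw [det3, Matrix.det_fin_three]
  simp

/-- The Gram matrix of a bilinear form on `ℝ³` in the standard basis. -/
def stdGram (G : E3 →L[ℝ] E3 →L[ℝ] ℝ) : Matrix (Fin 3) (Fin 3) ℝ :=
  Matrix.of fun i j => G (EuclideanSpace.single i 1) (EuclideanSpace.single j 1)

theorem bilin_eq_sum (G : E3 →L[ℝ] E3 →L[ℝ] ℝ) (u v : E3) :
    G u v = ∑ i, ∑ j, u i * v j * stdGram G i j := by
  have h : ∀ u : E3, u = ∑ i, u i • EuclideanSpace.single i (1 : ℝ) := fun u => by
    simpa using ((EuclideanSpace.basisFun (Fin 3) ℝ).sum_repr u).symm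
  conv_lhs => rw [h u, h v]
  simp only [map_sum, map_smul, _root_.sum_apply, _root_.smul_apply,
    smul_eq_mul, stdGram, Matrix.of_apply]
  simp only [Finset.mul_sum]
  rw [Finset.sum_comm]
  refine Finset.sum_congr rfl fun i _ => Finset.sum_congr rfl fun j _ => by ring

theorem gram_det (G : E3 →L[ℝ] E3 →L[ℝ] ℝ) (u u' : Fin 3 → E3) :
    Matrix.det (Matrix.of fun i j => G (u i) (u' j)) =
      (stdGram G).det * det3 (u 0) (u 1) (u 2) * det3 (u' 0) (u' 1) (u' 2) := by
  have h : (Matrix.of fun i j => G (u i) (u' j)) =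
      Matrix.of ![(u 0).ofLp, (u 1).ofLp, (u 2).ofLp] * stdGram G *
        (Matrix.of ![(u' 0).ofLp, (u' 1).ofLp, (u' 2).ofLp]).transpose := by
    ext i j
    rw [Matrix.of_apply, bilin_eq_sum, Matrix.mul_apply]
    simp only [Matrix.mul_apply, Matrix.transpose_apply, Finset.sum_mul]
    rw [Finset.sum_comm]
    refine Finset.sum_congr rfl fun k _ => Finset.sum_congr rfl fun l _ => ?_
    have e1 : (Matrix.of ![(u 0).ofLp, (u 1).ofLp, (u 2).ofLp]) i l = u i l := by
      fin_cases i <;> rfl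
    have e2 : (Matrix.of ![(u' 0).ofLp, (u' 1).ofLp, (u' 2).ofLp]) j k = u' j k := by
      fin_cases j <;> rfl
    rw [e1, e2]
    ring
  rw [h, Matrix.det_mul, Matrix.det_mul, Matrix.det_transpose, det3, det3]
  ring

/-- `R` is the rotation by a right angle of the plane `ker p`, with respect to the metric `G`,
extended by zero to the orthogonal complement. -/
structure IsRotation (G : E3 →L[ℝ] E3 →L[ℝ] ℝ) (p : E3 →L[ℝ] ℝ) (R : E3 →L[ℝ] E3) : Prop where
  symm : ∀ X Y, G X Y = G Y X
  pos : ∀ X, X ≠ 0 → 0 < G X X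
  skew : ∀ X Y, G (R X) Y = -G X (R Y)
  comp : ∀ X, p (R X) = 0
  sq : ∀ X, p X = 0 → R (R X) = -X
  eq_zero : ∀ Z W, p Z = 0 → p W = 0 → Z ≠ 0 → G Z W = 0 → G (R Z) W = 0 → W = 0

/-- The cross product with the unit normal of a plane is the rotation of this plane. Everything
follows from the Gram identity for the volume form. -/
theorem isRotation_of_cross {G : E3 →L[ℝ] E3 →L[ℝ] ℝ} {p : E3 →L[ℝ] ℝ} {R : E3 →L[ℝ] E3} {N : E3}
    {c : ℝ} (symm : ∀ X Y, G X Y = G Y X) (pos : ∀ X, X ≠ 0 → 0 < G X X) (hN0 : N ≠ 0)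
    (hN : ∀ U, G N U = p U) (hc : c ^ 2 * p N = (stdGram G).det)
    (hR : ∀ X U, G (R X) U = c * det3 X U N) : IsRotation G p R := by
  have hp : 0 < p N := by rw [← hN]; exact pos N hN0
  have gram : ∀ X A : E3, G (R X) A ^ 2 * p N =
      Matrix.det (Matrix.of fun i j => G (![X, A, N] i) (![X, A, N] j)) := fun X A => by
    rw [gram_det, ← hc, hR]
    simp
    ring
  have zero_of : ∀ X, G X X = 0 → X = 0 := fun X h => by
    by_contra h0
    exact (pos X h0).ne' h
  have gram' : ∀ X A : E3, p X = 0 → p A = 0 → G X A = 0 →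
      G (R X) A ^ 2 = G X X * G A A := fun X A h1 h2 h3 => by
    have h := gram X A
    have e2 : ![X, A, N] 2 = N := rfl
    rw [Matrix.det_fin_three] at h
    simp only [Matrix.of_apply, Matrix.cons_val_zero, Matrix.cons_val_one, e2, hN, symm A X,
      symm X N, symm A N, h1, h2, h3] at h
    have := mul_right_cancel₀ hp.ne' (h.trans (by ring : _ = G X X * G A A * p N))
    exact this
  have skew : ∀ X Y, G (R X) Y = -G X (R Y) := fun X Y => by
    rw [symm X, hR, hR, det3_eq, det3_eq]; ring
  have comp : ∀ X, p (R X) = 0 := fun X => by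
    rw [← hN, symm, hR, det3_eq]; ring
  have orth : ∀ X, G X (R X) = 0 := fun X => by
    have := skew X X
    rw [symm (R X)] at this
    linarith
  have norm : ∀ X, p X = 0 → G (R X) (R X) = G X X := fun X hX => by
    have h := gram' X (R X) hX (comp X) (orth X)
    by_cases h0 : R X = 0
    · -- a vector orthogonal to both `X` and `N` shows that `X = 0`
      let f : E3 →ₗ[ℝ] (Fin 2 → ℝ) := LinearMap.pi ![(G X).toLinearMap, p.toLinearMap]
      have hf : LinearMap.ker f ≠ ⊥ := LinearMap.ker_ne_bot_of_finrank_lt (by simp)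
      obtain ⟨A, hA, hA0⟩ := Submodule.exists_mem_ne_zero_of_ne_bot hf
      have hA1 : G X A = 0 := congrFun (LinearMap.mem_ker.1 hA) 0
      have hA2 : p A = 0 := congrFun (LinearMap.mem_ker.1 hA) 1
      have h2 := gram' X A hX hA2 hA1
      rw [h0] at h2
      have h3 : G X X = 0 := by
        rcases mul_eq_zero.1 (h2.symm.trans (by simp)) with h | h
        · exact h
        · exact absurd h (pos A hA0).ne'
      simp [h0, h3]
    · have := pos _ h0
      rw [pow_two] at h
      exact mul_right_cancel₀ this.ne' h
  refine ⟨symm, pos, skew, comp, fun X hX => ?_, fun Z W hZ hW hZ0 h1 h2 => ?_⟩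
  · have hsum : ∀ U, p U = 0 → G (R X) (R U) = G X U := fun U hU => by
      have h := norm (X + U) (by simp [hX, hU])
      simp only [map_add, _root_.add_apply, norm X hX, norm U hU, symm U X,
        symm (R U) (R X)] at h
      linarith
    have hW : p (R (R X) + X) = 0 := by simp [comp, hX]
    have : R (R X) + X = 0 := by
      apply zero_of
      have e : G (R (R X) + X) (R (R X) + X) =
          G (R (R X)) (R (R X) + X) + G X (R (R X) + X) := by simp
      rw [e, skew (R X), hsum _ hW]
      simp
    exact eq_neg_of_add_eq_zero_left this
  · have h := gram' Z W hZ hW h1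
    rw [h2] at h
    apply zero_of
    rcases mul_eq_zero.1 (h.symm.trans (by simp)) with h | h
    · exact absurd h (pos Z hZ0).ne'
    · exact h

namespace IsRotation

variable {G : E3 →L[ℝ] E3 →L[ℝ] ℝ} {p : E3 →L[ℝ] ℝ} {R : E3 →L[ℝ] E3}

theorem eq_zero_of_self (h : IsRotation G p R) {X : E3} (hX : G X X = 0) : X = 0 := by
  by_contra h0
  exact (h.pos X h0).ne' hX

theorem apply_self (h : IsRotation G p R) (X : E3) : G X (R X) = 0 := by
  have := h.skew X X
  rw [h.symm (R X)] at this
  linarith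

theorem isometry (h : IsRotation G p R) {X : E3} (hX : p X = 0) (U : E3) :
    G (R X) (R U) = G X U := by
  have := h.skew (R X) U
  rw [h.sq X hX] at this
  simp only [map_neg, _root_.neg_apply] at this
  linarith

theorem isometry' (h : IsRotation G p R) (X : E3) {U : E3} (hU : p U = 0) :
    G (R X) (R U) = G X U := by
  rw [h.symm, h.isometry hU, h.symm]

/-- The plane is spanned by a non-zero vector `Z` and its rotation `RZ`. -/
theorem exists_eq (h : IsRotation G p R) {Z X : E3} (hZ : p Z = 0) (hZ0 : Z ≠ 0) (hX : p X = 0) :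
    ∃ k l : ℝ, X = k • Z + l • R Z := by
  have hZZ := h.pos Z hZ0
  refine ⟨G Z X / G Z Z, G (R Z) X / G Z Z, ?_⟩
  rw [← sub_eq_zero]
  refine h.eq_zero Z _ hZ ?_ hZ0 ?_ ?_
  · simp [hX, hZ, h.comp]
  · simp [h.apply_self Z]
    field_simp
    ring
  · simp [h.isometry hZ, h.symm (R Z) Z, h.apply_self Z]
    field_simp
    ring

theorem range_eq (h : IsRotation G p R) {X : E3} (hX : p X = 0) : R (-R X) = X := by
  simp [h.sq X hX]

/-- An alternating bilinear form on the plane is invariant under the rotation. -/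
theorem alternating (h : IsRotation G p R) {S : E3 → E3 → ℝ}
    (hadd : ∀ X Y Z, S X (Y + Z) = S X Y + S X Z) (hsmul : ∀ (c : ℝ) X Y, S X (c • Y) = c * S X Y)
    (hS : ∀ X Y, S X Y = -S Y X) {X Y : E3} (hX : p X = 0) (hY : p Y = 0) :
    S (R X) (R Y) = S X Y := by
  have h0 : ∀ X, S X X = 0 := fun X => by linarith [hS X X]
  by_cases hX0 : X = 0
  · have hz : ∀ Y, S 0 Y = 0 := fun Y => by
      rw [hS, ← zero_smul ℝ (0 : E3), hsmul]; ring
    simp [hX0, hz]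
  · obtain ⟨k, l, rfl⟩ := h.exists_eq hX hX0 hY
    simp only [map_add, map_smul, h.sq X hX]
    rw [hadd, hadd, hsmul, hsmul, hsmul, hsmul, ← neg_one_smul ℝ X, hsmul, h0, h0, hS (R X) X]
    ring

end IsRotation

/-! ### The local model: connection form, horizontal plane and complex structure -/

/-- The linear part of `affineCovector`: the covector `ℓ` with `ℓ(b₀) = 0`, `ℓ(b₁) = Y₀` and
`ℓ(b₂) = Y₁`. -/
def fiberCovector (b : Module.Basis (Fin 3) ℝ E3) : (Fin 2 → ℝ) →L[ℝ] E3 →L[ℝ] ℝ :=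
  LinearMap.toContinuousLinearMap
    { toFun := fun Y => LinearMap.toContinuousLinearMap (∑ j : Fin 2, Y j • b.coord j.succ)
      map_add' := fun Y Y' => by simp [add_smul]; abel
      map_smul' := fun c Y => by simp [mul_smul] }

theorem fiberCovector_apply (b : Module.Basis (Fin 3) ℝ E3) (Y : Fin 2 → ℝ) (X : E3) :
    fiberCovector b Y X = ∑ j : Fin 2, Y j * b.coord j.succ X := by
  simp [fiberCovector]

theorem fiberCovector_zero (b : Module.Basis (Fin 3) ℝ E3) (Y : Fin 2 → ℝ) :
    fiberCovector b Y (b 0) = 0 := by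
  simp [fiberCovector_apply]

theorem fiberCovector_succ (b : Module.Basis (Fin 3) ℝ E3) (Y : Fin 2 → ℝ) (j : Fin 2) :
    fiberCovector b Y (b j.succ) = Y j := by
  fin_cases j <;> simp [fiberCovector_apply]

theorem affineCovector_eq (b : Module.Basis (Fin 3) ℝ E3) (y : Fin 2 → ℝ) :
    affineCovector b y = affineCovector b 0 + fiberCovector b y := by
  ext X
  simp [affineCovector, fiberCovector_apply]

theorem hasFDerivAt_affineCovector (b : Module.Basis (Fin 3) ℝ E3) (z : E5) :
    HasFDerivAt (fun z : E5 => affineCovector b z.2)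
      ((fiberCovector b).comp (ContinuousLinearMap.snd ℝ E3 (Fin 2 → ℝ))) z := by
  have h : (fun z : E5 => affineCovector b z.2) =
      fun z : E5 => affineCovector b 0 + fiberCovector b z.2 :=
    funext fun z => affineCovector_eq b z.2
  rw [h]
  exact (((fiberCovector b).hasFDerivAt).comp z hasFDerivAt_snd).const_add _

/-- A spanning set of vectors of the kernel of the affine covector. -/
def kernelVector (b : Module.Basis (Fin 3) ℝ E3) (y : Fin 2 → ℝ) (j : Fin 2) : E3 :=
  b j.succ - y j • b 0

theorem affineCovector_kernelVector (b : Module.Basis (Fin 3) ℝ E3) (y : Fin 2 → ℝ) (j : Fin 2) :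
    affineCovector b y (kernelVector b y j) = 0 := by
  simp [kernelVector, affineCovector_zero, affineCovector_succ]

theorem fiberCovector_kernelVector (b : Module.Basis (Fin 3) ℝ E3) (y Y : Fin 2 → ℝ) (j : Fin 2) :
    fiberCovector b Y (kernelVector b y j) = Y j := by
  simp [kernelVector, fiberCovector_zero, fiberCovector_succ]

/-- The covariant part of a tangent vector `v = (X, Y)` of the chart domain at `z`: the covariant
derivative `B(Y) - p(Γ(X, ·))` of the affine covector `p` along `v`. -/
def connForm (b : Module.Basis (Fin 3) ℝ E3) (Γ : E3 → E3 →L[ℝ] E3 →L[ℝ] E3) (z v : E5) :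
    E3 →L[ℝ] ℝ :=
  fiberCovector b v.2 - (affineCovector b z.2).comp (Γ z.1 v.1)

theorem connForm_apply (b : Module.Basis (Fin 3) ℝ E3) (Γ : E3 → E3 →L[ℝ] E3 →L[ℝ] E3) (z v : E5)
    (X : E3) : connForm b Γ z v X = fiberCovector b v.2 X - affineCovector b z.2 (Γ z.1 v.1 X) :=
  rfl

/-- The relation `w = Jv` between tangent vectors of the chart domain at `z`. The covariant part
matters only modulo the covector `p`, so it is tested on the plane `ker p`. -/
def JRel (b : Module.Basis (Fin 3) ℝ E3) (Γ : E3 → E3 →L[ℝ] E3 →L[ℝ] E3) (R : E5 → E3 →L[ℝ] E3)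
    (z v w : E5) : Prop :=
  w.1 = R z v.1 ∧
    ∀ U, affineCovector b z.2 U = 0 → connForm b Γ z w U = -connForm b Γ z v (R z U)

/-- The map `J` in an affine chart. -/
def localJ (b : Module.Basis (Fin 3) ℝ E3) (Γ : E3 → E3 →L[ℝ] E3 →L[ℝ] E3) (R : E5 → E3 →L[ℝ] E3)
    (z v : E5) : E5 :=
  (R z v.1, fun j => -connForm b Γ z v (R z (kernelVector b z.2 j)) +
    affineCovector b z.2 (Γ z.1 (R z v.1) (kernelVector b z.2 j)))

section

variable {b : Module.Basis (Fin 3) ℝ E3} {Γ : E3 → E3 →L[ℝ] E3 →L[ℝ] E3} {R : E5 → E3 →L[ℝ] E3}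

theorem eq_sum_kernelVector {y : Fin 2 → ℝ} {U : E3} (hU : affineCovector b y U = 0) :
    U = ∑ j : Fin 2, b.coord j.succ U • kernelVector b y j := by
  have h1 := b.sum_repr U
  have h2 : affineCovector b y U = b.repr U 0 + ∑ j : Fin 2, y j * b.repr U j.succ := by
    simp [affineCovector]
  rw [hU] at h2
  rw [Fin.sum_univ_succ] at h1
  simp only [kernelVector, smul_sub, Finset.sum_sub_distrib, Module.Basis.coord_apply]
  have h3 : ∑ j : Fin 2, b.repr U j.succ • y j • b 0 = -(b.repr U 0) • b 0 := by
    rw [eq_neg_of_add_eq_zero_left h2.symm, neg_neg, Finset.sum_smul]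
    exact Finset.sum_congr rfl fun j _ => by rw [smul_smul, mul_comm]
  rw [h3, neg_smul, sub_neg_eq_add, add_comm]
  exact h1.symm

theorem eq_of_eqOn_kernel {z : E5} {f f' : E3 →L[ℝ] ℝ}
    (h : ∀ j, f (kernelVector b z.2 j) = f' (kernelVector b z.2 j)) {U : E3}
    (hU : affineCovector b z.2 U = 0) : f U = f' U := by
  rw [eq_sum_kernelVector hU]
  simp only [map_sum, map_smul, h]

theorem jRel_unique {z v w w' : E5} (h : JRel b Γ R z v w) (h' : JRel b Γ R z v w') : w = w' := by
  have h1 : w.1 = w'.1 := h.1.trans h'.1.symm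
  refine Prod.ext h1 (funext fun j => ?_)
  have hk := affineCovector_kernelVector b z.2 j
  have h2 := (h.2 _ hk).trans (h'.2 _ hk).symm
  rw [connForm_apply, connForm_apply, fiberCovector_kernelVector, fiberCovector_kernelVector,
    h1] at h2
  exact sub_left_injective h2

theorem jRel_localJ (z v : E5) : JRel b Γ R z v (localJ b Γ R z v) := by
  refine ⟨rfl, fun U hU => ?_⟩
  refine eq_of_eqOn_kernel (z := z) (f := connForm b Γ z (localJ b Γ R z v))
    (f' := -(connForm b Γ z v).comp (R z)) (fun j => ?_) hU
  rw [connForm_apply, fiberCovector_kernelVector]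
  simp [localJ]

theorem jRel_iff {z v w : E5} : JRel b Γ R z v w ↔ w = localJ b Γ R z v :=
  ⟨fun h => jRel_unique h (jRel_localJ z v), fun h => h ▸ jRel_localJ z v⟩

theorem connForm_neg (z v : E5) : connForm b Γ z (-v) = -connForm b Γ z v := by
  ext U
  simp [connForm_apply]
  ring

theorem connForm_add (z v w : E5) :
    connForm b Γ z (v + w) = connForm b Γ z v + connForm b Γ z w := by
  ext U
  simp [connForm_apply]
  ring

theorem connForm_smul (z : E5) (c : ℝ) (v : E5) :
    connForm b Γ z (c • v) = c • connForm b Γ z v := by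
  ext U
  simp [connForm_apply]
  ring

theorem JRel.add {z v v' w w' : E5} (h : JRel b Γ R z v w) (h' : JRel b Γ R z v' w') :
    JRel b Γ R z (v + v') (w + w') := by
  refine ⟨by simp [h.1, h'.1], fun U hU => ?_⟩
  rw [connForm_add, connForm_add, _root_.add_apply, h.2 U hU, h'.2 U hU, _root_.add_apply, neg_add]

theorem JRel.smul {z v w : E5} (h : JRel b Γ R z v w) (c : ℝ) :
    JRel b Γ R z (c • v) (c • w) := by
  refine ⟨by simp [h.1], fun U hU => ?_⟩
  rw [connForm_smul, connForm_smul, _root_.smul_apply, h.2 U hU, _root_.smul_apply, smul_neg]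

theorem JRel.sq {G : E3 →L[ℝ] E3 →L[ℝ] ℝ} {z v w : E5}
    (hR : IsRotation G (affineCovector b z.2) (R z)) (hv : affineCovector b z.2 v.1 = 0)
    (h : JRel b Γ R z v w) : JRel b Γ R z w (-v) := by
  refine ⟨?_, fun U hU => ?_⟩
  · rw [h.1, hR.sq _ hv]; rfl
  · rw [h.2 _ (hR.comp U), hR.sq U hU, connForm_neg]
    simp

/-- The exterior derivative of the contact form at `(v, w)`. -/
def dContact (b : Module.Basis (Fin 3) ℝ E3) (v w : E5) : ℝ :=
  fiberCovector b v.2 w.1 - fiberCovector b w.2 v.1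

theorem dContact_eq {z v w : E5} (hΓ : ∀ X Y, Γ z.1 X Y = Γ z.1 Y X) :
    dContact b v w = connForm b Γ z v w.1 - connForm b Γ z w v.1 := by
  rw [connForm_apply, connForm_apply, hΓ v.1, dContact]
  ring

theorem dContact_jRel {G : E3 →L[ℝ] E3 →L[ℝ] ℝ} {z v w v' w' : E5}
    (hΓ : ∀ X Y, Γ z.1 X Y = Γ z.1 Y X) (hR : IsRotation G (affineCovector b z.2) (R z))
    (hv : affineCovector b z.2 v.1 = 0) (hw : affineCovector b z.2 w.1 = 0)
    (h : JRel b Γ R z v v') (h' : JRel b Γ R z w w') :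
    dContact b v' w' = dContact b v w := by
  rw [dContact_eq hΓ, dContact_eq hΓ, h.1, h'.1, h.2 _ (hR.comp _), h'.2 _ (hR.comp _),
    hR.sq _ hv, hR.sq _ hw]
  simp

theorem dContact_jRel_right {z v v' : E5} (hΓ : ∀ X Y, Γ z.1 X Y = Γ z.1 Y X)
    (hv : affineCovector b z.2 v.1 = 0) (h : JRel b Γ R z v v') :
    dContact b v v' = 2 * connForm b Γ z v (R z v.1) := by
  rw [dContact_eq hΓ, h.1, h.2 _ hv]
  ring

/-- The exterior derivative of the contact form is non-degenerate on the contact hyperplane. -/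
theorem dContact_nondegenerate {z v : E5} (hv : affineCovector b z.2 v.1 = 0)
    (h : ∀ w : E5, affineCovector b z.2 w.1 = 0 → dContact b v w = 0) : v = 0 := by
  have h1 : ∀ j : Fin 2, b.coord j.succ v.1 = 0 := fun j => by
    have := h (0, Pi.single j 1) (by simp)
    simpa [dContact, fiberCovector_apply, Pi.single_apply] using this
  have h2 : v.1 = 0 := by
    refine b.ext_elem fun i => ?_
    refine Fin.cases ?_ (fun j => ?_) i
    · have h3 : b.coord 0 v.1 + ∑ j : Fin 2, z.2 j * b.coord j.succ v.1 = 0 := by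
        simpa [affineCovector] using hv
      simpa [h1] using h3
    · simpa using h1 j
  refine Prod.ext h2 (funext fun j => ?_)
  have := h (kernelVector b z.2 j, 0) (affineCovector_kernelVector b z.2 j)
  simpa [dContact, fiberCovector_kernelVector] using this

/-- The form `v ↦ dθ(v, Jv)` takes values of both signs: replacing the covariant part of `v` by its
opposite changes the sign. -/
theorem exists_dContact_jRel_pos_neg {G : E3 →L[ℝ] E3 →L[ℝ] ℝ} {z : E5}
    (hΓ : ∀ X Y, Γ z.1 X Y = Γ z.1 Y X) (hR : IsRotation G (affineCovector b z.2) (R z)) (t : ℝ) :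
    ∃ v : E5, affineCovector b z.2 v.1 = 0 ∧ dContact b v (localJ b Γ R z v) = t := by
  set X := R z (kernelVector b z.2 0) with hX
  have hk := affineCovector_kernelVector b z.2 0
  have hpX : affineCovector b z.2 X = 0 := hR.comp _
  have hRX : R z X = -kernelVector b z.2 0 := hR.sq _ hk
  -- the vector `v = (X, Y)` satisfies `dθ(v, Jv) = 2 (p(Γ(X, k₀)) - Y₀)` as `RX = -k₀`
  let Y : Fin 2 → ℝ := fun _ => affineCovector b z.2 (Γ z.1 X (kernelVector b z.2 0)) - t / 2
  refine ⟨(X, Y), hpX, ?_⟩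
  rw [dContact_jRel_right hΓ hpX (jRel_localJ z _)]
  simp only [hRX, connForm_apply, map_neg, fiberCovector_kernelVector, Y]
  ring

end

/-! ### Lie brackets and exterior derivatives of one-forms -/

section ExtDeriv

variable {E : Type*} [NormedAddCommGroup E] [NormedSpace ℝ E]

/-- The exterior derivative of a one-form on a normed space. -/
def extD (τ : E → E →L[ℝ] ℝ) (z v w : E) : ℝ := fderiv ℝ τ z v w - fderiv ℝ τ z w v

theorem apply_lieBracket {τ : E → E →L[ℝ] ℝ} {ξ η : E → E} {z : E}
    (hτ : DifferentiableAt ℝ τ z) (hξ : DifferentiableAt ℝ ξ z) (hη : DifferentiableAt ℝ η z) :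
    τ z (VectorField.lieBracket ℝ ξ η z) = fderiv ℝ (fun x => τ x (η x)) z (ξ z)
      - fderiv ℝ (fun x => τ x (ξ x)) z (η z) - extD τ z (ξ z) (η z) := by
  rw [fderiv_clm_apply hτ hη, fderiv_clm_apply hτ hξ, VectorField.lieBracket, extD]
  simp only [map_sub, _root_.add_apply, ContinuousLinearMap.comp_apply,
    ContinuousLinearMap.flip_apply]
  ring

/-- The combination of brackets by which the Nijenhuis tensor is computed, for a complex one-form
`τ₁ + iτ₂` which vanishes on the vectors `v + iJv`. -/
theorem apply_nijenhuis {τ₁ τ₂ : E → E →L[ℝ] ℝ} {ξ ξ' η η' : E → E} {z : E}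
    (h₁ : DifferentiableAt ℝ τ₁ z) (h₂ : DifferentiableAt ℝ τ₂ z)
    (hξ : DifferentiableAt ℝ ξ z) (hξ' : DifferentiableAt ℝ ξ' z)
    (hη : DifferentiableAt ℝ η z) (hη' : DifferentiableAt ℝ η' z)
    (e₁ : ∀ᶠ x in 𝓝 z, τ₁ x (ξ x) = τ₂ x (ξ' x)) (e₂ : ∀ᶠ x in 𝓝 z, τ₂ x (ξ x) = -τ₁ x (ξ' x))
    (e₃ : ∀ᶠ x in 𝓝 z, τ₁ x (η x) = τ₂ x (η' x)) (e₄ : ∀ᶠ x in 𝓝 z, τ₂ x (η x) = -τ₁ x (η' x)) :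
    τ₁ z (VectorField.lieBracket ℝ ξ η z - VectorField.lieBracket ℝ ξ' η' z) -
      τ₂ z (VectorField.lieBracket ℝ ξ' η z + VectorField.lieBracket ℝ ξ η' z) =
    -(extD τ₁ z (ξ z) (η z) - extD τ₁ z (ξ' z) (η' z) - extD τ₂ z (ξ' z) (η z)
      - extD τ₂ z (ξ z) (η' z)) := by
  have d₁ := Filter.EventuallyEq.fderiv_eq (𝕜 := ℝ) (f₁ := fun x => τ₁ x (ξ x)) e₁
  have d₂ := Filter.EventuallyEq.fderiv_eq (𝕜 := ℝ) (f₁ := fun x => τ₂ x (ξ x)) e₂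
  have d₃ := Filter.EventuallyEq.fderiv_eq (𝕜 := ℝ) (f₁ := fun x => τ₁ x (η x)) e₃
  have d₄ := Filter.EventuallyEq.fderiv_eq (𝕜 := ℝ) (f₁ := fun x => τ₂ x (η x)) e₄
  rw [fderiv_fun_neg] at d₂ d₄
  rw [map_sub, map_add, apply_lieBracket h₁ hξ hη, apply_lieBracket h₁ hξ' hη',
    apply_lieBracket h₂ hξ' hη, apply_lieBracket h₂ hξ hη', d₁, d₂, d₃, d₄]
  simp only [_root_.neg_apply]
  ring

end ExtDeriv

/-! ### Integrability in an affine chart -/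

/-- The operator norm on bilinear forms on `ℝ³`, registered to shorten instance searches. -/
instance : NormedAddCommGroup (E3 →L[ℝ] E3 →L[ℝ] ℝ) := ContinuousLinearMap.toNormedAddCommGroup

/-- The operator norm on bilinear maps `ℝ³ × ℝ³ → ℝ³`, registered to shorten instance searches. -/
instance : NormedAddCommGroup (E3 →L[ℝ] E3 →L[ℝ] E3) := ContinuousLinearMap.toNormedAddCommGroup

instance : NormedSpace ℝ (E3 →L[ℝ] E3 →L[ℝ] ℝ) := ContinuousLinearMap.toNormedSpace

instance : NormedSpace ℝ (E3 →L[ℝ] E3 →L[ℝ] E3) := ContinuousLinearMap.toNormedSpace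

/-- The data of a conformal structure in an affine chart of the configuration space, on an open set
`U`: the metric `G`, its Christoffel symbols `Γ` and the rotation `R` of the planes. -/
structure IsLocalModel (b : Module.Basis (Fin 3) ℝ E3) (G : E3 → E3 →L[ℝ] E3 →L[ℝ] ℝ)
    (Γ : E3 → E3 →L[ℝ] E3 →L[ℝ] E3) (R : E5 → E3 →L[ℝ] E3) (U : Set E5) : Prop where
  isOpen : IsOpen U
  metric : ∀ z ∈ U, ContDiffAt ℝ ∞ G z.1
  christoffel : ∀ z ∈ U, ContDiffAt ℝ ∞ Γ z.1
  rotation : ContDiffOn ℝ ∞ R U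
  symm : ∀ z ∈ U, ∀ X Y, Γ z.1 X Y = Γ z.1 Y X
  compat : ∀ z ∈ U, ∀ X Y Z, fderiv ℝ G z.1 X Y Z = G z.1 (Γ z.1 X Y) Z + G z.1 Y (Γ z.1 X Z)
  isRotation : ∀ z ∈ U, IsRotation (G z.1) (affineCovector b z.2) (R z)

/-- The covariant derivative, along a vector `v` of the chart domain, of a vector field of `M`
depending on the point of the chart domain. -/
def covDeriv (Γ : E3 → E3 →L[ℝ] E3 →L[ℝ] E3) (Z : E5 → E3) (z v : E5) : E3 :=
  fderiv ℝ Z z v + Γ z.1 v.1 (Z z)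

namespace IsLocalModel

variable {b : Module.Basis (Fin 3) ℝ E3} {G : E3 → E3 →L[ℝ] E3 →L[ℝ] ℝ}
  {Γ : E3 → E3 →L[ℝ] E3 →L[ℝ] E3} {R : E5 → E3 →L[ℝ] E3} {U : Set E5}

theorem differentiableAt_metric (h : IsLocalModel b G Γ R U) {z : E5} (hz : z ∈ U) :
    DifferentiableAt ℝ (fun z : E5 => G z.1) z :=
  ((h.metric z hz).differentiableAt (by simp)).comp z differentiableAt_fst

theorem differentiableAt_christoffel (h : IsLocalModel b G Γ R U) {z : E5} (hz : z ∈ U) :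
    DifferentiableAt ℝ (fun z : E5 => Γ z.1) z :=
  ((h.christoffel z hz).differentiableAt (by simp)).comp z differentiableAt_fst

theorem differentiableAt_rotation (h : IsLocalModel b G Γ R U) {z : E5} (hz : z ∈ U) :
    DifferentiableAt ℝ R z :=
  (h.rotation.contDiffAt (h.isOpen.mem_nhds hz)).differentiableAt (by simp)

/-- Metric compatibility of the covariant derivative. -/
theorem fderiv_metric (h : IsLocalModel b G Γ R U) {z : E5} (hz : z ∈ U) {Z W : E5 → E3}
    (hZ : DifferentiableAt ℝ Z z) (hW : DifferentiableAt ℝ W z) (v : E5) :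
    fderiv ℝ (fun z : E5 => G z.1 (Z z) (W z)) z v =
      G z.1 (covDeriv Γ Z z v) (W z) + G z.1 (Z z) (covDeriv Γ W z v) := by
  have hG := (((h.metric z hz).differentiableAt (by simp)).hasFDerivAt).comp z
    (hasFDerivAt_fst (𝕜 := ℝ) (E := E3) (F := Fin 2 → ℝ) (p := z))
  have := ((hG.clm_apply hZ.hasFDerivAt).clm_apply hW.hasFDerivAt).fderiv
  change fderiv ℝ (fun z : E5 => G z.1 (Z z) (W z)) z = _ at this
  rw [this]
  simp only [covDeriv, map_add, _root_.add_apply, ContinuousLinearMap.comp_apply,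
    ContinuousLinearMap.flip_apply, Function.comp_apply, ContinuousLinearMap.coe_fst',
    h.compat z hz]
  ring

/-- The Leibniz rule for the pairing with the affine covector. -/
theorem fderiv_pairing {z : E5} {Z : E5 → E3} (hZ : DifferentiableAt ℝ Z z) (v : E5) :
    fderiv ℝ (fun z : E5 => affineCovector b z.2 (Z z)) z v =
      connForm b Γ z v (Z z) + affineCovector b z.2 (covDeriv Γ Z z v) := by
  rw [((hasFDerivAt_affineCovector b z).clm_apply hZ.hasFDerivAt).fderiv]
  simp [covDeriv, connForm_apply]
  ring

/-- The one-form `G(Z, ·)`. -/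
def metricForm (G : E3 → E3 →L[ℝ] E3 →L[ℝ] ℝ) (Z : E5 → E3) (z : E5) : E5 →L[ℝ] ℝ :=
  (G z.1 (Z z)).comp (ContinuousLinearMap.fst ℝ E3 (Fin 2 → ℝ))

/-- The one-form `v ↦ (∇_v p)(Z)`. -/
def connOneForm (b : Module.Basis (Fin 3) ℝ E3) (Γ : E3 → E3 →L[ℝ] E3 →L[ℝ] E3) (Z : E5 → E3)
    (z : E5) : E5 →L[ℝ] ℝ :=
  ((fiberCovector b).flip (Z z)).comp (ContinuousLinearMap.snd ℝ E3 (Fin 2 → ℝ)) -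
    ((affineCovector b z.2).comp ((Γ z.1).flip (Z z))).comp
      (ContinuousLinearMap.fst ℝ E3 (Fin 2 → ℝ))

theorem connOneForm_apply (Z : E5 → E3) (z v : E5) :
    connOneForm b Γ Z z v = connForm b Γ z v (Z z) := rfl

theorem differentiableAt_metricForm (h : IsLocalModel b G Γ R U) {z : E5} (hz : z ∈ U)
    {Z : E5 → E3} (hZ : DifferentiableAt ℝ Z z) : DifferentiableAt ℝ (metricForm G Z) z :=
  ((h.differentiableAt_metric hz).clm_apply hZ).clm_comp (differentiableAt_const _)

theorem differentiableAt_connOneForm (h : IsLocalModel b G Γ R U) {z : E5} (hz : z ∈ U)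
    {Z : E5 → E3} (hZ : DifferentiableAt ℝ Z z) : DifferentiableAt ℝ (connOneForm b Γ Z) z := by
  have h1 := (hasFDerivAt_affineCovector b z).differentiableAt
  have h2 : DifferentiableAt ℝ (fun z : E5 => (Γ z.1).flip (Z z)) z :=
    (((ContinuousLinearMap.flipₗᵢ ℝ E3 E3 E3).toContinuousLinearEquiv.differentiableAt).comp z
      (h.differentiableAt_christoffel hz)).clm_apply hZ
  have h3 : DifferentiableAt ℝ (fun z : E5 => (fiberCovector b).flip (Z z)) z :=
    ((fiberCovector b).flip.differentiableAt).comp z hZ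
  exact (h3.clm_comp (differentiableAt_const _)).sub
    ((h1.clm_comp h2).clm_comp (differentiableAt_const _))

theorem extD_metricForm (h : IsLocalModel b G Γ R U) {z : E5} (hz : z ∈ U)
    {Z : E5 → E3} (hZ : DifferentiableAt ℝ Z z) (v w : E5) :
    extD (metricForm G Z) z v w =
      G z.1 (covDeriv Γ Z z v) w.1 - G z.1 (covDeriv Γ Z z w) v.1 := by
  have key : ∀ v w : E5, fderiv ℝ (metricForm G Z) z v w =
      G z.1 (covDeriv Γ Z z v) w.1 + G z.1 (Z z) (Γ z.1 v.1 w.1) := fun v w => by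
    have h1 := fderiv_clm_apply (h.differentiableAt_metricForm hz hZ)
      (differentiableAt_const (𝕜 := ℝ) (x := z) w)
    have h2 := h.fderiv_metric hz hZ (differentiableAt_const (𝕜 := ℝ) (x := z) w.1) v
    have h3 := DFunLike.congr_fun h1 v
    simp only [covDeriv, fderiv_fun_const, Pi.zero_apply, _root_.zero_apply, zero_add,
      ContinuousLinearMap.comp_zero, ContinuousLinearMap.flip_apply] at h2 h3
    rw [← h3]
    exact h2
  rw [extD, key, key, h.symm z hz v.1]
  ring

/-- The curvature of the Christoffel symbols. -/
def curvature (Γ : E3 → E3 →L[ℝ] E3 →L[ℝ] E3) (a X Y Z : E3) : E3 :=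
  fderiv ℝ Γ a X Y Z + Γ a X (Γ a Y Z) - (fderiv ℝ Γ a Y X Z + Γ a Y (Γ a X Z))

theorem extD_connOneForm (h : IsLocalModel b G Γ R U) {z : E5} (hz : z ∈ U)
    {Z : E5 → E3} (hZ : DifferentiableAt ℝ Z z) (v w : E5) :
    extD (connOneForm b Γ Z) z v w =
      connForm b Γ z w (covDeriv Γ Z z v) - connForm b Γ z v (covDeriv Γ Z z w)
        - affineCovector b z.2 (curvature Γ z.1 v.1 w.1 (Z z)) := by
  have key : ∀ v w : E5, fderiv ℝ (connOneForm b Γ Z) z v w =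
      connForm b Γ z w (covDeriv Γ Z z v) - connForm b Γ z w (Γ z.1 v.1 (Z z))
        - connForm b Γ z v (Γ z.1 w.1 (Z z))
        - affineCovector b z.2 (fderiv ℝ Γ z.1 v.1 w.1 (Z z) + Γ z.1 v.1 (Γ z.1 w.1 (Z z))) :=
    fun v w => by
    have h1 := fderiv_clm_apply (h.differentiableAt_connOneForm hz hZ)
      (differentiableAt_const (𝕜 := ℝ) (x := z) w)
    have hΓ := (((h.christoffel z hz).differentiableAt (by simp)).hasFDerivAt).comp z
      (hasFDerivAt_fst (𝕜 := ℝ) (E := E3) (F := Fin 2 → ℝ) (p := z))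
    have hW := (hΓ.clm_apply (hasFDerivAt_const w.1 z)).clm_apply hZ.hasFDerivAt
    change HasFDerivAt (fun z : E5 => Γ z.1 w.1 (Z z)) _ z at hW
    have h2 := fderiv_pairing (b := b) (Γ := Γ) hW.differentiableAt v
    have h3 := DFunLike.congr_fun h1 v
    simp only [fderiv_fun_const, Pi.zero_apply, zero_add,
      ContinuousLinearMap.comp_zero, ContinuousLinearMap.flip_apply] at h3
    rw [← h3]
    have h4 : HasFDerivAt (fun z : E5 => fiberCovector b w.2 (Z z))
        ((fiberCovector b w.2).comp (fderiv ℝ Z z)) z :=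
      (fiberCovector b w.2).hasFDerivAt.comp z hZ.hasFDerivAt
    have h5 := (hasFDerivAt_affineCovector b z).differentiableAt.clm_apply hW.differentiableAt
    have h6 : (fun z : E5 => connOneForm b Γ Z z w) = fun z : E5 => fiberCovector b w.2 (Z z) -
        affineCovector b z.2 (Γ z.1 w.1 (Z z)) := rfl
    rw [h6, fderiv_fun_sub h4.differentiableAt h5, _root_.sub_apply, h2, h4.fderiv]
    simp only [covDeriv, hW.fderiv, connForm_apply, map_add, _root_.add_apply,
      ContinuousLinearMap.comp_apply, ContinuousLinearMap.flip_apply, Function.comp_apply,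
      ContinuousLinearMap.coe_fst', ContinuousLinearMap.comp_zero, zero_add]
    ring
  rw [extD, key, key]
  simp only [curvature, map_sub, map_add]
  ring

theorem differentiableAt_rot (h : IsLocalModel b G Γ R U) {z : E5} (hz : z ∈ U) (c : E3) :
    DifferentiableAt ℝ (fun z => R z c) z :=
  (h.differentiableAt_rotation hz).clm_apply (differentiableAt_const c)

theorem differentiableAt_rot_rot (h : IsLocalModel b G Γ R U) {z : E5} (hz : z ∈ U) (c : E3) :
    DifferentiableAt ℝ (fun z => R z (R z c)) z :=
  (h.differentiableAt_rotation hz).clm_apply (h.differentiableAt_rot hz c)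

/-- The vectors `Rc` and `R²c` have the same length, so that their derivatives have the same
components along them. -/
theorem covDeriv_null (h : IsLocalModel b G Γ R U) {z : E5} (hz : z ∈ U) (c : E3) (v : E5) :
    G z.1 (R z c) (covDeriv Γ (fun z => R z c) z v) =
      G z.1 (R z (R z c)) (covDeriv Γ (fun z => R z (R z c)) z v) := by
  have h1 := h.fderiv_metric hz (h.differentiableAt_rot hz c) (h.differentiableAt_rot hz c) v
  have h2 := h.fderiv_metric hz (h.differentiableAt_rot_rot hz c)
    (h.differentiableAt_rot_rot hz c) v
  have h3 : (fun z : E5 => G z.1 (R z (R z c)) (R z (R z c))) =ᶠ[𝓝 z]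
      fun z => G z.1 (R z c) (R z c) := by
    filter_upwards [h.isOpen.mem_nhds hz] with x hx
    have hx := h.isRotation x hx
    exact hx.isometry (hx.comp c) _
  rw [h3.fderiv_eq, h1] at h2
  have hs := (h.isRotation z hz).symm
  rw [hs (covDeriv _ _ _ _), hs (covDeriv _ _ _ _)] at h2
  linarith

/-- The derivative of the orthogonality of `Rc` and `R²c`. -/
theorem covDeriv_orthogonal (h : IsLocalModel b G Γ R U) {z : E5} (hz : z ∈ U) (c : E3) (v : E5) :
    G z.1 (R z c) (covDeriv Γ (fun z => R z (R z c)) z v) =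
      -G z.1 (R z (R z c)) (covDeriv Γ (fun z => R z c) z v) := by
  have h1 := h.fderiv_metric hz (h.differentiableAt_rot hz c) (h.differentiableAt_rot_rot hz c) v
  have h3 : (fun z : E5 => G z.1 (R z c) (R z (R z c))) =ᶠ[𝓝 z] fun _ => 0 := by
    filter_upwards [h.isOpen.mem_nhds hz] with x hx
    exact (h.isRotation x hx).apply_self _
  rw [h3.fderiv_eq] at h1
  simp only [fderiv_fun_const, Pi.zero_apply, _root_.zero_apply] at h1
  rw [(h.isRotation z hz).symm (covDeriv _ _ _ _)] at h1
  linarith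

/-- The derivative of the pairing `p(Z) = 0` for a field `Z` with values in the planes. -/
theorem pairing_covDeriv (h : IsLocalModel b G Γ R U) {z : E5} (hz : z ∈ U) {Z : E5 → E3}
    (hZ : DifferentiableAt ℝ Z z) (hZ' : ∀ x ∈ U, affineCovector b x.2 (Z x) = 0) (v : E5) :
    affineCovector b z.2 (covDeriv Γ Z z v) = -connForm b Γ z v (Z z) := by
  have h1 := fderiv_pairing (b := b) (Γ := Γ) hZ v
  have h3 : (fun z : E5 => affineCovector b z.2 (Z z)) =ᶠ[𝓝 z] fun _ => 0 := by
    filter_upwards [h.isOpen.mem_nhds hz] with x hx using hZ' x hx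
  rw [h3.fderiv_eq] at h1
  simp only [fderiv_fun_const, Pi.zero_apply, _root_.zero_apply] at h1
  linarith

/-- The complex one-form `G(Z, ·)`, with `Z = R c + i R² c`, satisfies the integrability
condition: `∇_v Z` is orthogonal to `Z`, as `Z` is null. -/
theorem extD_metricForm_nijenhuis (h : IsLocalModel b G Γ R U) {z : E5} (hz : z ∈ U) (c : E3)
    {v v' w w' : E5} (hv : affineCovector b z.2 v.1 = 0) (hw : affineCovector b z.2 w.1 = 0)
    (hvv : JRel b Γ R z v v') (hww : JRel b Γ R z w w') (hc : R z c ≠ 0) :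
    extD (metricForm G fun z => R z c) z v w - extD (metricForm G fun z => R z c) z v' w'
      - extD (metricForm G fun z => R z (R z c)) z v' w
      - extD (metricForm G fun z => R z (R z c)) z v w' = 0 := by
  have hR := h.isRotation z hz
  have key : ∀ (u w : E5), affineCovector b z.2 w.1 = 0 →
      G z.1 (covDeriv Γ (fun z => R z c) z u) w.1 =
        G z.1 (covDeriv Γ (fun z => R z (R z c)) z u) (R z w.1) := fun u w hw => by
    obtain ⟨k, l, hkl⟩ := hR.exists_eq (hR.comp c) hc hw
    have n1 := h.covDeriv_null hz c u
    have n2 := h.covDeriv_orthogonal hz c u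
    rw [hkl]
    simp only [map_add, map_smul, hR.sq _ (hR.comp c), smul_eq_mul, map_neg]
    rw [hR.symm _ (R z c), hR.symm _ (R z (R z c)), hR.symm _ (R z c), hR.symm _ (R z (R z c)),
      n1, n2]
    ring
  have key' : ∀ (u w : E5), affineCovector b z.2 w.1 = 0 →
      G z.1 (covDeriv Γ (fun z => R z c) z u) (R z w.1) =
        -G z.1 (covDeriv Γ (fun z => R z (R z c)) z u) w.1 := fun u w hw => by
    have := key u (R z w.1, 0) (hR.comp _)
    simpa [hR.sq _ hw] using this
  rw [h.extD_metricForm hz (h.differentiableAt_rot hz c),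
    h.extD_metricForm hz (h.differentiableAt_rot hz c),
    h.extD_metricForm hz (h.differentiableAt_rot_rot hz c),
    h.extD_metricForm hz (h.differentiableAt_rot_rot hz c), hvv.1, hww.1, key' _ _ hv, key' _ _ hw,
    ← key _ _ hv, ← key _ _ hw]
  ring

/-- The complex one-form `v ↦ (∇_v p)(Z)`, with `Z = R c + i R² c`, satisfies the integrability
condition: `∇_{v + iJv} Z` is a multiple of `Z`, and the curvature does not contribute as it is
alternating and the plane is a complex line. -/
theorem extD_connOneForm_nijenhuis (h : IsLocalModel b G Γ R U) {z : E5} (hz : z ∈ U) (c : E3)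
    {v v' w w' : E5} (hv : affineCovector b z.2 v.1 = 0) (hw : affineCovector b z.2 w.1 = 0)
    (hvv : JRel b Γ R z v v') (hww : JRel b Γ R z w w') (hc : R z c ≠ 0) :
    extD (connOneForm b Γ fun z => R z c) z v w - extD (connOneForm b Γ fun z => R z c) z v' w'
      - extD (connOneForm b Γ fun z => R z (R z c)) z v' w
      - extD (connOneForm b Γ fun z => R z (R z c)) z v w' = 0 := by
  have hR := h.isRotation z hz
  have key : ∀ (v v' w w' : E5), JRel b Γ R z v v' → JRel b Γ R z w w' →
      connForm b Γ z w (covDeriv Γ (fun z => R z c) z v)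
        - connForm b Γ z w' (covDeriv Γ (fun z => R z c) z v')
        - connForm b Γ z w (covDeriv Γ (fun z => R z (R z c)) z v')
        - connForm b Γ z w' (covDeriv Γ (fun z => R z (R z c)) z v) = 0 :=
    fun v v' w w' hvv hww => by
    set W₁ := covDeriv Γ (fun z => R z c) z v - covDeriv Γ (fun z => R z (R z c)) z v' with hW₁
    set W₂ := covDeriv Γ (fun z => R z c) z v' + covDeriv Γ (fun z => R z (R z c)) z v with hW₂
    have pr₁ := h.pairing_covDeriv hz (h.differentiableAt_rot hz c)
      fun x hx => (h.isRotation x hx).comp _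
    have pr₂ := h.pairing_covDeriv hz (h.differentiableAt_rot_rot hz c)
      fun x hx => (h.isRotation x hx).comp _
    have e₁ := hvv.2 _ (hR.comp c)
    have e₂ := hvv.2 _ (hR.comp (R z c))
    rw [hR.sq _ (hR.comp c), map_neg, neg_neg] at e₂
    have p₁ : affineCovector b z.2 W₁ = 0 := by
      rw [hW₁, map_sub, pr₁, pr₂, e₂]; ring
    have p₂ : affineCovector b z.2 W₂ = 0 := by
      rw [hW₂, map_add, pr₁, pr₂, e₁]; ring
    have hW : W₁ + R z W₂ = 0 := by
      refine hR.eq_zero (R z c) _ (hR.comp c) (by simp [p₁, hR.comp]) hc ?_ ?_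
      · rw [map_add, ← neg_neg (G z.1 (R z c) (R z W₂)), ← hR.skew, hW₁, hW₂, map_sub, map_add,
          h.covDeriv_null hz c, h.covDeriv_orthogonal hz c]
        ring
      · rw [map_add, hR.isometry (hR.comp c), hW₁, hW₂, map_sub, map_add,
          h.covDeriv_null hz c, h.covDeriv_orthogonal hz c]
        ring
    have h1 := hww.2 W₂ p₂
    have h2 : connForm b Γ z w W₁ = -connForm b Γ z w (R z W₂) := by
      rw [eq_neg_of_add_eq_zero_left hW, map_neg]
    have h3 : connForm b Γ z w W₁ = connForm b Γ z w' W₂ := h2.trans h1.symm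
    rw [hW₁, hW₂, map_sub, map_add] at h3
    linarith
  have curv : ∀ (Z : E3), affineCovector b z.2 (curvature Γ z.1 (R z v.1) (R z w.1) Z) =
      affineCovector b z.2 (curvature Γ z.1 v.1 w.1 Z) := fun Z =>
    hR.alternating (S := fun X Y => affineCovector b z.2 (curvature Γ z.1 X Y Z))
      (fun X Y Y' => by simp [curvature]; ring) (fun k X Y => by simp [curvature]; ring)
      (fun X Y => by simp [curvature]) hv hw
  have curv' : ∀ (Z : E3), affineCovector b z.2 (curvature Γ z.1 (R z v.1) w.1 Z) =
      -affineCovector b z.2 (curvature Γ z.1 v.1 (R z w.1) Z) := fun Z => by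
    have := hR.alternating (S := fun X Y => affineCovector b z.2 (curvature Γ z.1 X Y Z))
      (fun X Y Y' => by simp [curvature]; ring) (fun k X Y => by simp [curvature]; ring)
      (fun X Y => by simp [curvature]) hv (hR.comp w.1)
    rw [hR.sq _ hw] at this
    rw [← this]
    simp [curvature]
    ring
  have k₁ := key v v' w w' hvv hww
  have k₂ := key w w' v v' hww hvv
  rw [h.extD_connOneForm hz (h.differentiableAt_rot hz c),
    h.extD_connOneForm hz (h.differentiableAt_rot hz c),
    h.extD_connOneForm hz (h.differentiableAt_rot_rot hz c),
    h.extD_connOneForm hz (h.differentiableAt_rot_rot hz c), hvv.1, hww.1, curv, curv']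
  linarith

/-- The contact form in an affine chart. -/
def contactForm (b : Module.Basis (Fin 3) ℝ E3) (z : E5) : E5 →L[ℝ] ℝ :=
  (affineCovector b z.2).comp (ContinuousLinearMap.fst ℝ E3 (Fin 2 → ℝ))

theorem hasFDerivAt_contactForm (z : E5) : HasFDerivAt (contactForm b)
    ((((ContinuousLinearMap.compL ℝ E5 E3 ℝ).flip
      (ContinuousLinearMap.fst ℝ E3 (Fin 2 → ℝ))).comp (fiberCovector b)).comp
        (ContinuousLinearMap.snd ℝ E3 (Fin 2 → ℝ))) z :=
  (((ContinuousLinearMap.compL ℝ E5 E3 ℝ).flip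
    (ContinuousLinearMap.fst ℝ E3 (Fin 2 → ℝ))).hasFDerivAt).comp z
      (hasFDerivAt_affineCovector b z)

theorem extD_contactForm (z v w : E5) : extD (contactForm b) z v w = dContact b v w := by
  rw [extD, (hasFDerivAt_contactForm z).fderiv]
  rfl

/-- The contact form evaluated on the bracket of two sections of the contact distribution. -/
theorem contactForm_lieBracket {ξ η : E5 → E5} {z : E5}
    (hξ : DifferentiableAt ℝ ξ z) (hη : DifferentiableAt ℝ η z)
    (eξ : ∀ᶠ x in 𝓝 z, affineCovector b x.2 (ξ x).1 = 0)
    (eη : ∀ᶠ x in 𝓝 z, affineCovector b x.2 (η x).1 = 0) :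
    affineCovector b z.2 (VectorField.lieBracket ℝ ξ η z).1 = -dContact b (ξ z) (η z) := by
  have h := apply_lieBracket (hasFDerivAt_contactForm (b := b) z).differentiableAt hξ hη
  have e₁ : (fun x => contactForm b x (ξ x)) =ᶠ[𝓝 z] fun _ => 0 := eξ
  have e₂ : (fun x => contactForm b x (η x)) =ᶠ[𝓝 z] fun _ => 0 := eη
  rw [e₁.fderiv_eq, e₂.fderiv_eq, extD_contactForm] at h
  simpa [contactForm] using h

/-- Integrability in an affine chart: if `ξ' = Jξ` and `η' = Jη` are sections of the contact
distribution, then `[ξ', η] + [ξ, η']` is in the contact distribution and its image under `J` is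
`-([ξ, η] - [ξ', η'])`. -/
theorem nijenhuis (h : IsLocalModel b G Γ R U) {z : E5} (hz : z ∈ U) {ξ ξ' η η' : E5 → E5}
    (hξ : DifferentiableAt ℝ ξ z) (hξ' : DifferentiableAt ℝ ξ' z)
    (hη : DifferentiableAt ℝ η z) (hη' : DifferentiableAt ℝ η' z)
    (eξ : ∀ᶠ x in 𝓝 z, affineCovector b x.2 (ξ x).1 = 0 ∧ JRel b Γ R x (ξ x) (ξ' x))
    (eη : ∀ᶠ x in 𝓝 z, affineCovector b x.2 (η x).1 = 0 ∧ JRel b Γ R x (η x) (η' x)) :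
    affineCovector b z.2 (VectorField.lieBracket ℝ ξ' η z + VectorField.lieBracket ℝ ξ η' z).1 = 0 ∧
    JRel b Γ R z (VectorField.lieBracket ℝ ξ' η z + VectorField.lieBracket ℝ ξ η' z)
      (-(VectorField.lieBracket ℝ ξ η z - VectorField.lieBracket ℝ ξ' η' z)) := by
  have hR := h.isRotation z hz
  have hU := h.isOpen.mem_nhds hz
  have pξ' : ∀ᶠ x in 𝓝 z, affineCovector b x.2 (ξ' x).1 = 0 := by
    filter_upwards [eξ, hU] with x hx hx'
    rw [hx.2.1]; exact (h.isRotation x hx').comp _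
  have pη' : ∀ᶠ x in 𝓝 z, affineCovector b x.2 (η' x).1 = 0 := by
    filter_upwards [eη, hU] with x hx hx'
    rw [hx.2.1]; exact (h.isRotation x hx').comp _
  have pξ := eξ.mono fun x hx => hx.1
  have pη := eη.mono fun x hx => hx.1
  obtain ⟨vξ, jξ⟩ := eξ.self_of_nhds
  obtain ⟨vη, jη⟩ := eη.self_of_nhds
  have d₁ := dContact_jRel (h.symm z hz) hR vξ vη jξ jη
  have d₂ := dContact_jRel (h.symm z hz) hR vξ pη'.self_of_nhds jξ (jη.sq hR vη)
  have d₃ : dContact b (ξ' z) (-η z) = -dContact b (ξ' z) (η z) := by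
    simp [dContact]; ring
  set A := VectorField.lieBracket ℝ ξ η z - VectorField.lieBracket ℝ ξ' η' z with hA
  set B := VectorField.lieBracket ℝ ξ' η z + VectorField.lieBracket ℝ ξ η' z with hB
  have pA : affineCovector b z.2 A.1 = 0 := by
    rw [hA, Prod.fst_sub, map_sub, contactForm_lieBracket hξ hη pξ pη,
      contactForm_lieBracket hξ' hη' pξ' pη', d₁]
    ring
  have pB : affineCovector b z.2 B.1 = 0 := by
    rw [hB, Prod.fst_add, map_add, contactForm_lieBracket hξ' hη pξ' pη,
      contactForm_lieBracket hξ hη' pξ pη', ← d₂, d₃]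
    ring
  have key₁ : ∀ c, G z.1 (R z c) A.1 = G z.1 (R z (R z c)) B.1 := fun c => by
    by_cases hc : R z c = 0
    · simp [hc]
    have e : ∀ {ξ ξ' : E5 → E5}, (∀ᶠ x in 𝓝 z, affineCovector b x.2 (ξ x).1 = 0 ∧
        JRel b Γ R x (ξ x) (ξ' x)) →
        (∀ᶠ x in 𝓝 z, metricForm G (fun z => R z c) x (ξ x) =
          metricForm G (fun z => R z (R z c)) x (ξ' x)) ∧
        ∀ᶠ x in 𝓝 z, metricForm G (fun z => R z (R z c)) x (ξ x) =
          -metricForm G (fun z => R z c) x (ξ' x) := by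
      intro ξ ξ' eξ
      constructor
      · filter_upwards [eξ, hU] with x hx hx'
        have hR := h.isRotation x hx'
        change G x.1 (R x c) (ξ x).1 = G x.1 (R x (R x c)) (ξ' x).1
        rw [hx.2.1, hR.isometry' _ hx.1]
      · filter_upwards [eξ, hU] with x hx hx'
        have hR := h.isRotation x hx'
        change G x.1 (R x (R x c)) (ξ x).1 = -G x.1 (R x c) (ξ' x).1
        rw [hx.2.1, hR.skew]
    have := apply_nijenhuis (h.differentiableAt_metricForm hz (h.differentiableAt_rot hz c))
      (h.differentiableAt_metricForm hz (h.differentiableAt_rot_rot hz c)) hξ hξ' hη hη'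
      (e eξ).1 (e eξ).2 (e eη).1 (e eη).2
    rw [h.extD_metricForm_nijenhuis hz c vξ vη jξ jη hc, neg_zero] at this
    exact sub_eq_zero.1 this
  have key₂ : ∀ c, connForm b Γ z A (R z c) = connForm b Γ z B (R z (R z c)) := fun c => by
    by_cases hc : R z c = 0
    · simp [hc]
    have e : ∀ {ξ ξ' : E5 → E5}, (∀ᶠ x in 𝓝 z, affineCovector b x.2 (ξ x).1 = 0 ∧
        JRel b Γ R x (ξ x) (ξ' x)) →
        (∀ᶠ x in 𝓝 z, connOneForm b Γ (fun z => R z c) x (ξ x) =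
          connOneForm b Γ (fun z => R z (R z c)) x (ξ' x)) ∧
        ∀ᶠ x in 𝓝 z, connOneForm b Γ (fun z => R z (R z c)) x (ξ x) =
          -connOneForm b Γ (fun z => R z c) x (ξ' x) := by
      intro ξ ξ' eξ
      constructor
      · filter_upwards [eξ, hU] with x hx hx'
        have hR := h.isRotation x hx'
        simp only [connOneForm_apply]
        rw [hx.2.2 _ (hR.comp _), hR.sq _ (hR.comp c)]
        simp
      · filter_upwards [eξ, hU] with x hx hx'
        have hR := h.isRotation x hx'
        simp only [connOneForm_apply]
        rw [hx.2.2 _ (hR.comp _), neg_neg]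
    have := apply_nijenhuis (h.differentiableAt_connOneForm hz (h.differentiableAt_rot hz c))
      (h.differentiableAt_connOneForm hz (h.differentiableAt_rot_rot hz c)) hξ hξ' hη hη'
      (e eξ).1 (e eξ).2 (e eη).1 (e eη).2
    rw [h.extD_connOneForm_nijenhuis hz c vξ vη jξ jη hc, neg_zero] at this
    exact sub_eq_zero.1 this
  refine ⟨pB, ?_, fun V hV => ?_⟩
  · have hAB : A.1 + R z B.1 = 0 := by
      refine hR.eq_zero_of_self ?_
      -- `A + RB` is of the form `Rc` as it is in the plane
      set X := A.1 + R z B.1 with hX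
      have hpX : affineCovector b z.2 X = 0 := by simp [hX, pA, hR.comp]
      have h1 := key₁ (-R z X)
      rw [hR.range_eq hpX] at h1
      conv_lhs => rw [hX, map_add, ← hX, h1, hR.skew]
      ring
    rw [Prod.fst_neg]
    exact neg_eq_of_add_eq_zero_right hAB
  · have h1 := key₂ (-R z V)
    rw [hR.range_eq hV] at h1
    rw [connForm_neg, _root_.neg_apply, h1]

end IsLocalModel

/-! ### Vector fields in the charts of a manifold -/

section

variable {E : Type*} [NormedAddCommGroup E] [NormedSpace ℝ E] {N : Type*} [TopologicalSpace N]
  [ChartedSpace E N] [IsManifold 𝓘(ℝ, E) ∞ N]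

/-- The derivative at `y` of the chart at `y₀`. -/
def chartDeriv (y₀ y : N) : TangentSpace 𝓘(ℝ, E) y →L[ℝ] E :=
  (tangentCoordChange 𝓘(ℝ, E) y y₀ y : E →L[ℝ] E)

/-- The inverse of `chartDeriv`. -/
def chartDerivInv (y₀ y : N) : E →L[ℝ] TangentSpace 𝓘(ℝ, E) y :=
  (tangentCoordChange 𝓘(ℝ, E) y₀ y y : E →L[ℝ] E)

theorem chartDeriv_chartDerivInv {y₀ y : N} (h : y ∈ (chartAt E y₀).source) (v : E) :
    chartDeriv y₀ y (chartDerivInv y₀ y v) = v := by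
  have h' : tangentCoordChange 𝓘(ℝ, E) y y₀ y (tangentCoordChange 𝓘(ℝ, E) y₀ y y v)
      = tangentCoordChange 𝓘(ℝ, E) y₀ y₀ y v := by
    apply tangentCoordChange_comp
    simp [h]
  exact h'.trans (tangentCoordChange_self (by simp [h]))

theorem chartDerivInv_chartDeriv {y₀ y : N} (h : y ∈ (chartAt E y₀).source)
    (v : TangentSpace 𝓘(ℝ, E) y) : chartDerivInv y₀ y (chartDeriv y₀ y v) = v := by
  have h' : tangentCoordChange 𝓘(ℝ, E) y₀ y y (tangentCoordChange 𝓘(ℝ, E) y y₀ y v)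
      = tangentCoordChange 𝓘(ℝ, E) y y y v := by
    apply tangentCoordChange_comp
    simp [h]
  exact h'.trans (tangentCoordChange_self (by simp))

theorem mfderiv_chartAt {y₀ y : N} (h : y ∈ (chartAt E y₀).source) :
    mfderiv 𝓘(ℝ, E) 𝓘(ℝ, E) (chartAt E y₀) y = chartDeriv y₀ y :=
  mfderiv_chartAt_eq_tangentCoordChange h

/-- The components of a vector field in the chart at `y₀`, as a map of the model space. -/
def fieldCoord (y₀ : N) (V : ∀ y : N, TangentSpace 𝓘(ℝ, E) y) (z : E) : E :=
  chartDeriv y₀ ((chartAt E y₀).symm z) (V ((chartAt E y₀).symm z))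

theorem mdifferentiableAt_field_iff {y₀ y : N} (h : y ∈ (chartAt E y₀).source)
    (V : ∀ y : N, TangentSpace 𝓘(ℝ, E) y) :
    MDifferentiableAt 𝓘(ℝ, E) (𝓘(ℝ, E)).tangent (fun y => (⟨y, V y⟩ : TangentBundle 𝓘(ℝ, E) N)) y ↔
      DifferentiableAt ℝ (fieldCoord y₀ V) (chartAt E y₀ y) := by
  have h1 := Bundle.Trivialization.mdifferentiableAt_section_iff (IB := 𝓘(ℝ, E))
    (e := trivializationAt E (TangentSpace 𝓘(ℝ, E)) y₀) (s := V) (b₀ := y) (by simpa using h)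
  refine h1.trans ?_
  rw [mdifferentiableAt_iff_source_of_mem_source (x := y₀) h]
  simp only [mfld_simps, mdifferentiableWithinAt_iff_differentiableWithinAt,
    differentiableWithinAt_univ]
  rfl

theorem contMDiffAt_field_iff {y₀ y : N} (h : y ∈ (chartAt E y₀).source)
    (V : ∀ y : N, TangentSpace 𝓘(ℝ, E) y) :
    ContMDiffAt 𝓘(ℝ, E) (𝓘(ℝ, E)).tangent ∞ (fun y => (⟨y, V y⟩ : TangentBundle 𝓘(ℝ, E) N)) y ↔
      ContDiffAt ℝ ∞ (fieldCoord y₀ V) (chartAt E y₀ y) := by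
  have h1 := Bundle.Trivialization.contMDiffAt_section_iff (n := ∞) (IB := 𝓘(ℝ, E))
    (e := trivializationAt E (TangentSpace 𝓘(ℝ, E)) y₀) (s := V) (x₀ := y) (by simpa using h)
  refine h1.trans ?_
  rw [contMDiffAt_iff_source_of_mem_source (x := y₀) h]
  simp only [mfld_simps, contMDiffWithinAt_iff_contDiffWithinAt, contDiffWithinAt_univ]
  rfl

theorem mfderiv_chartAt_symm_apply {y₀ : N} {z : E} (h : z ∈ (chartAt E y₀).target) (v : E) :
    mfderiv 𝓘(ℝ, E) 𝓘(ℝ, E) (chartAt E y₀).symm z v =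
      chartDerivInv (E := E) y₀ ((chartAt E y₀).symm z) v := by
  have h1 := mfderiv_extChartAt_comp_mfderivWithin_extChartAt_symm (I := 𝓘(ℝ, E)) (x := y₀)
    (y := z) (by simpa using h)
  simp only [mfld_simps, mfderivWithin_univ] at h1
  have hs := (chartAt E y₀).map_target h
  rw [mfderiv_chartAt hs] at h1
  have h2 : chartDeriv (E := E) y₀ ((chartAt E y₀).symm z)
      (mfderiv 𝓘(ℝ, E) 𝓘(ℝ, E) (chartAt E y₀).symm z v) = v :=
    congrArg (fun f : E →L[ℝ] E => f v) h1
  exact (chartDerivInv_chartDeriv (E := E) hs _).symm.trans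
    (congrArg (chartDerivInv (E := E) y₀ ((chartAt E y₀).symm z)) h2)

theorem mpullback_chartAt_symm {y₀ : N} {z : E} (h : z ∈ (chartAt E y₀).target)
    (V : ∀ y : N, TangentSpace 𝓘(ℝ, E) y) :
    VectorField.mpullback 𝓘(ℝ, E) 𝓘(ℝ, E) (chartAt E y₀).symm V z = fieldCoord (E := E) y₀ V z := by
  have hs := (chartAt E y₀).map_target h
  rw [VectorField.mpullback_apply]
  have : (mfderiv 𝓘(ℝ, E) 𝓘(ℝ, E) (chartAt E y₀).symm z).inverse =
      chartDeriv (E := E) y₀ ((chartAt E y₀).symm z) :=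
    ContinuousLinearMap.inverse_eq
      (ContinuousLinearMap.ext fun v =>
        (mfderiv_chartAt_symm_apply h _).trans (chartDerivInv_chartDeriv hs v))
      (ContinuousLinearMap.ext fun v =>
        (congrArg (chartDeriv (E := E) y₀ ((chartAt E y₀).symm z))
          (mfderiv_chartAt_symm_apply h v)).trans (chartDeriv_chartDerivInv hs v))
  rw [this]
  rfl

theorem chartDeriv_mlieBracket [CompleteSpace E] {y₀ y : N} (h : y ∈ (chartAt E y₀).source)
    {V W : ∀ y : N, TangentSpace 𝓘(ℝ, E) y}
    (hV : MDifferentiableAt 𝓘(ℝ, E) (𝓘(ℝ, E)).tangent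
      (fun y => (⟨y, V y⟩ : TangentBundle 𝓘(ℝ, E) N)) y)
    (hW : MDifferentiableAt 𝓘(ℝ, E) (𝓘(ℝ, E)).tangent
      (fun y => (⟨y, W y⟩ : TangentBundle 𝓘(ℝ, E) N)) y) :
    chartDeriv y₀ y (VectorField.mlieBracket 𝓘(ℝ, E) V W y) =
      VectorField.lieBracket ℝ (fieldCoord y₀ V) (fieldCoord y₀ W) (chartAt E y₀ y) := by
  have hz := (chartAt E y₀).map_source h
  have hy := (chartAt E y₀).left_inv h
  have : IsManifold 𝓘(ℝ, E) (minSmoothness ℝ 2) N := by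
    rw [minSmoothness_of_isRCLikeNormedField]; infer_instance
  have h0 : ∀ V W : E → E, VectorField.lieBracket ℝ V W =
      VectorField.mlieBracket 𝓘(ℝ, E) V W := fun V W => by
    rw [← VectorField.lieBracketWithin_univ]
    exact VectorField.mlieBracketWithin_eq_lieBracketWithin.symm
  rw [h0]
  have h1 := VectorField.mpullback_mlieBracket (I := 𝓘(ℝ, E)) (I' := 𝓘(ℝ, E)) (n := ∞)
    (f := (chartAt E y₀).symm) (x₀ := chartAt E y₀ y) (V := V) (W := W) (by rwa [hy]) (by rwa [hy])
    ((contMDiffOn_chart_symm (I := 𝓘(ℝ, E)) (x := y₀) _ hz).contMDiffAt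
      ((chartAt E y₀).open_target.mem_nhds hz)) (by simpa using ENat.LEInfty.out)
  rw [mpullback_chartAt_symm hz] at h1
  have h2 : ∀ V : ∀ y : N, TangentSpace 𝓘(ℝ, E) y,
      VectorField.mpullback 𝓘(ℝ, E) 𝓘(ℝ, E) (chartAt E y₀).symm V =ᶠ[𝓝 (chartAt E y₀ y)]
        fieldCoord y₀ V := fun V =>
    Filter.eventuallyEq_of_mem ((chartAt E y₀).open_target.mem_nhds hz)
      fun z hz => mpullback_chartAt_symm hz V
  rw [(h2 V).mlieBracket_vectorField_eq (h2 W)] at h1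
  rw [← h1, fieldCoord, hy]

theorem fieldCoord_chartAt {y₀ y : N} (h : y ∈ (chartAt E y₀).source)
    (V : ∀ y : N, TangentSpace 𝓘(ℝ, E) y) :
    fieldCoord y₀ V (chartAt E y₀ y) = chartDeriv y₀ y (V y) := by
  rw [fieldCoord, (chartAt E y₀).left_inv h]

/-- The field with given components, as a map of the model space, in the chart at `y₀`. -/
def coordField (y₀ : N) (f : E → E) (y : N) : TangentSpace 𝓘(ℝ, E) y :=
  chartDerivInv y₀ y (f (chartAt E y₀ y))

theorem fieldCoord_coordField {y₀ : N} (f : E → E) {z : E} (h : z ∈ (chartAt E y₀).target) :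
    fieldCoord y₀ (coordField y₀ f) z = f z := by
  rw [fieldCoord, coordField, chartDeriv_chartDerivInv ((chartAt E y₀).map_target h),
    (chartAt E y₀).right_inv h]

theorem fieldCoord_coordField_eventuallyEq {y₀ y : N} (h : y ∈ (chartAt E y₀).source)
    (f : E → E) : fieldCoord y₀ (coordField y₀ f) =ᶠ[𝓝 (chartAt E y₀ y)] f :=
  Filter.eventuallyEq_of_mem ((chartAt E y₀).open_target.mem_nhds ((chartAt E y₀).map_source h))
    fun _ hz => fieldCoord_coordField f hz

theorem mvfderiv_apply_eq_fderiv {F : Type*} [NormedAddCommGroup F] [NormedSpace ℝ F] {y₀ y : N}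
    (h : y ∈ (chartAt E y₀).source) {f : N → F} (hf : MDifferentiableAt 𝓘(ℝ, E) 𝓘(ℝ, F) f y)
    (v : TangentSpace 𝓘(ℝ, E) y) :
    mvfderiv 𝓘(ℝ, E) f y v =
      fderiv ℝ (f ∘ (chartAt E y₀).symm) (chartAt E y₀ y) (chartDeriv y₀ y v) := by
  have hz := (chartAt E y₀).map_source h
  have hy := (chartAt E y₀).left_inv h
  have h1 : MDifferentiableAt 𝓘(ℝ, E) 𝓘(ℝ, F) (f ∘ (chartAt E y₀).symm) (chartAt E y₀ y) := by
    refine MDifferentiableAt.comp (I' := 𝓘(ℝ, E)) _ (by rwa [hy]) ?_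
    exact mdifferentiableAt_atlas_symm (chart_mem_atlas E y₀) hz
  have h2 : f =ᶠ[𝓝 y] (f ∘ (chartAt E y₀).symm) ∘ chartAt E y₀ :=
    Filter.eventuallyEq_of_mem ((chartAt E y₀).open_source.mem_nhds h) fun x hx => by
      simp [(chartAt E y₀).left_inv hx]
  have h3 := mfderiv_comp_apply y h1 (mdifferentiableAt_atlas (chart_mem_atlas E y₀) h) v
  rw [← h2.mfderiv_eq, mfderiv_chartAt h, mfderiv_eq_fderiv] at h3
  exact h3

end

/-! ### The metric in coordinates -/


section

variable {M : Type*} [TopologicalSpace M] [ChartedSpace E3 M] [IsManifold (𝓡 3) ∞ M]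

/-- The metric `g` in the coordinates at `x₀`. -/
def metricCoord (g : Metric M) (x₀ : M) (a : E3) : E3 →L[ℝ] E3 →L[ℝ] ℝ :=
  ContinuousLinearMap.bilinearComp (E := E3) (F := E3)
    (g.inner ((chartAt E3 x₀).symm a) : E3 →L[ℝ] E3 →L[ℝ] ℝ)
    (frame x₀ ((chartAt E3 x₀).symm a) : E3 →L[ℝ] E3)
    (frame x₀ ((chartAt E3 x₀).symm a) : E3 →L[ℝ] E3)

theorem metricCoord_apply (g : Metric M) (x₀ : M) (a v w : E3) :
    metricCoord g x₀ a v w = g.inner ((chartAt E3 x₀).symm a)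
      (frame x₀ ((chartAt E3 x₀).symm a) v) (frame x₀ ((chartAt E3 x₀).symm a) w) := rfl

theorem metricCoord_chartAt (g : Metric M) {x₀ x : M} (h : x ∈ (chartAt E3 x₀).source) (v w : E3) :
    metricCoord g x₀ (chartAt E3 x₀ x) v w = g.inner x (frame x₀ x v) (frame x₀ x w) := by
  rw [metricCoord_apply, (chartAt E3 x₀).left_inv h]

theorem metricCoord_coframe (g : Metric M) {x₀ x : M} (h : x ∈ (chartAt E3 x₀).source)
    (v w : TangentSpace (𝓡 3) x) :
    metricCoord g x₀ (chartAt E3 x₀ x) (coframe x₀ x v) (coframe x₀ x w) = g.inner x v w := by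
  rw [metricCoord_chartAt g h, frame_coframe h, frame_coframe h]

theorem metricCoord_fieldCoord (g : Metric M) {x₀ : M} {a : E3} (h : a ∈ (chartAt E3 x₀).target)
    (Y Z : ∀ y : M, TangentSpace (𝓡 3) y) :
    metricCoord g x₀ a (fieldCoord (E := E3) x₀ Y a) (fieldCoord (E := E3) x₀ Z a) =
      g.inner ((chartAt E3 x₀).symm a) (Y ((chartAt E3 x₀).symm a))
        (Z ((chartAt E3 x₀).symm a)) := by
  have h' := (chartAt E3 x₀).map_target h
  have := metricCoord_coframe g h' (Y ((chartAt E3 x₀).symm a)) (Z ((chartAt E3 x₀).symm a))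
  rwa [(chartAt E3 x₀).right_inv h] at this

theorem metricCoord_symm (g : Metric M) (x₀ : M) (a v w : E3) :
    metricCoord g x₀ a v w = metricCoord g x₀ a w v := g.symm _ _ _

theorem frame_ne_zero {x₀ x : M} (h : x ∈ (chartAt E3 x₀).source) {v : E3} (hv : v ≠ 0) :
    frame x₀ x v ≠ 0 := fun h0 => hv (by
  rw [← coframe_frame_self h v, h0, map_zero])

theorem metricCoord_pos (g : Metric M) {x₀ : M} {a : E3} (h : a ∈ (chartAt E3 x₀).target) {v : E3}
    (hv : v ≠ 0) : 0 < metricCoord g x₀ a v v :=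
  g.pos _ _ (frame_ne_zero ((chartAt E3 x₀).map_target h) hv)

theorem mdifferentiableAt_inner (g : Metric M) {x : M} {Y Z : ∀ y : M, TangentSpace (𝓡 3) y}
    (hY : FieldDifferentiableAt Y x) (hZ : FieldDifferentiableAt Z x) :
    MDifferentiableAt (𝓡 3) 𝓘(ℝ, ℝ) (fun y => g.inner y (Y y) (Z y)) x := by
  have h := MDifferentiableAt.clm_bundle_apply₂ (IM := 𝓡 3) (IB := 𝓡 3)
    (E₃ := fun _ : M => ℝ) (F₃ := ℝ) (b := id) (ψ := fun y => g.inner y) (v := Y) (w := Z)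
    ((g.contMDiff x).mdifferentiableAt (by simp)) hY hZ
  simp only [mdifferentiableAt_totalSpace] at h
  exact h.2

theorem contMDiffAt_inner (g : Metric M) {x : M} {Y Z : ∀ y : M, TangentSpace (𝓡 3) y}
    (hY : ContMDiffAt (𝓡 3) (𝓡 3).tangent ∞ (fun y => (⟨y, Y y⟩ : TangentBundle (𝓡 3) M)) x)
    (hZ : ContMDiffAt (𝓡 3) (𝓡 3).tangent ∞ (fun y => (⟨y, Z y⟩ : TangentBundle (𝓡 3) M)) x) :
    ContMDiffAt (𝓡 3) 𝓘(ℝ, ℝ) ∞ (fun y => g.inner y (Y y) (Z y)) x := by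
  have h := ContMDiffAt.clm_bundle_apply₂ (IM := 𝓡 3) (IB := 𝓡 3)
    (E₃ := fun _ : M => ℝ) (F₃ := ℝ) (b := id) (ψ := fun y => g.inner y) (v := Y) (w := Z)
    (g.contMDiff x) hY hZ
  simp only [contMDiffAt_totalSpace] at h
  exact h.2

theorem contMDiffAt_coordField {x₀ x : M} (h : x ∈ (chartAt E3 x₀).source) {f : E3 → E3}
    (hf : ContDiffAt ℝ ∞ f (chartAt E3 x₀ x)) :
    ContMDiffAt (𝓡 3) (𝓡 3).tangent ∞
      (fun y => (⟨y, coordField (E := E3) x₀ f y⟩ : TangentBundle (𝓡 3) M)) x :=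
  (contMDiffAt_field_iff h _).2 (hf.congr_of_eventuallyEq (fieldCoord_coordField_eventuallyEq h f))

theorem fieldDifferentiableAt_coordField {x₀ x : M} (h : x ∈ (chartAt E3 x₀).source) {f : E3 → E3}
    (hf : DifferentiableAt ℝ f (chartAt E3 x₀ x)) :
    FieldDifferentiableAt (coordField (E := E3) x₀ f) x :=
  (mdifferentiableAt_field_iff h _).2
    (hf.congr_of_eventuallyEq (fieldCoord_coordField_eventuallyEq h f))

theorem contDiffAt_metricCoord (g : Metric M) {x₀ : M} {a : E3} (h : a ∈ (chartAt E3 x₀).target) :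
    ContDiffAt ℝ ∞ (metricCoord g x₀) a := by
  have key : ContDiffOn ℝ ∞ (metricCoord g x₀) (chartAt E3 x₀).target := by
    refine contDiffOn_clm_apply.2 fun v => contDiffOn_clm_apply.2 fun w => fun a ha => ?_
    have hx := (chartAt E3 x₀).map_target ha
    have h1 := contMDiffAt_inner g (contMDiffAt_coordField hx (f := fun _ => v) contDiffAt_const)
      (contMDiffAt_coordField hx (f := fun _ => w) contDiffAt_const)
    rw [contMDiffAt_iff_source_of_mem_source (x' := (chartAt E3 x₀).symm a) (x := x₀) hx] at h1
    simp only [mfld_simps, contMDiffWithinAt_iff_contDiffWithinAt, contDiffWithinAt_univ,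
      (chartAt E3 x₀).right_inv ha] at h1
    exact h1.contDiffWithinAt
  exact key.contDiffAt ((chartAt E3 x₀).open_target.mem_nhds h)

end

/-! ### Christoffel symbols -/

/-- The operator norm on trilinear forms on `ℝ³`, registered to shorten instance searches. -/
instance : NormedAddCommGroup (E3 →L[ℝ] E3 →L[ℝ] E3 →L[ℝ] ℝ) :=
  ContinuousLinearMap.toNormedAddCommGroup

instance : NormedSpace ℝ (E3 →L[ℝ] E3 →L[ℝ] E3 →L[ℝ] ℝ) := ContinuousLinearMap.toNormedSpace

/-- The operator norm on maps from covectors to vectors, registered to shorten instance searches. -/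
instance : NormedAddCommGroup ((E3 →L[ℝ] ℝ) →L[ℝ] E3) := ContinuousLinearMap.toNormedAddCommGroup

instance : NormedSpace ℝ ((E3 →L[ℝ] ℝ) →L[ℝ] E3) := ContinuousLinearMap.toNormedSpace

set_option synthInstance.maxHeartbeats 200000 in
/-- The combination `½ (D_X G(Y, Z) + D_Y G(X, Z) - D_Z G(X, Y))` of derivatives of a metric. -/
def koszul (G : E3 → E3 →L[ℝ] E3 →L[ℝ] ℝ) (a : E3) : E3 →L[ℝ] E3 →L[ℝ] E3 →L[ℝ] ℝ :=
  (2⁻¹ : ℝ) • (fderiv ℝ G a + (fderiv ℝ G a).flip -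
    (ContinuousLinearMap.flipₗᵢ ℝ E3 E3 ℝ).toContinuousLinearEquiv.toContinuousLinearMap.comp
      (fderiv ℝ G a).flip)

theorem koszul_apply (G : E3 → E3 →L[ℝ] E3 →L[ℝ] ℝ) (a X Y Z : E3) :
    koszul G a X Y Z =
      2⁻¹ * (fderiv ℝ G a X Y Z + fderiv ℝ G a Y X Z - fderiv ℝ G a Z X Y) := rfl

/-- The Christoffel symbols of a metric. -/
def christoffel (G : E3 → E3 →L[ℝ] E3 →L[ℝ] ℝ) (a : E3) : E3 →L[ℝ] E3 →L[ℝ] E3 :=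
  (ContinuousLinearMap.compL ℝ E3 (E3 →L[ℝ] ℝ) E3 (G a).inverse).comp (koszul G a)

section

variable {G : E3 → E3 →L[ℝ] E3 →L[ℝ] ℝ} {a : E3}

theorem isInvertible_of_pos {B : E3 →L[ℝ] E3 →L[ℝ] ℝ} (h : ∀ v, v ≠ 0 → 0 < B v v) :
    B.IsInvertible := by
  have hB : Function.Injective B.toLinearMap := by
    refine (injective_iff_map_eq_zero _).2 fun v hv => ?_
    by_contra hne
    have h0 : B v = 0 := hv
    have := h v hne
    simp [h0] at this
  have hd : Module.finrank ℝ E3 = Module.finrank ℝ (E3 →L[ℝ] ℝ) := by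
    have e : (E3 →L[ℝ] ℝ) ≃ₗ[ℝ] Module.Dual ℝ E3 := LinearMap.toContinuousLinearMap.symm
    rw [e.finrank_eq, Subspace.dual_finrank_eq]
  exact ⟨(LinearMap.linearEquivOfInjective B.toLinearMap hB hd).toContinuousLinearEquiv,
    ContinuousLinearMap.ext fun v => rfl⟩

theorem apply_christoffel (h : (G a).IsInvertible) (X Y Z : E3) :
    G a (christoffel G a X Y) Z = koszul G a X Y Z := by
  obtain ⟨e, he⟩ := h
  change G a ((G a).inverse (koszul G a X Y)) Z = _
  rw [← he, ContinuousLinearMap.inverse_equiv]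
  change e (e.symm _) Z = _
  rw [e.apply_symm_apply]

theorem fderiv_symm_apply (hG : DifferentiableAt ℝ G a) (hs : ∀ᶠ x in 𝓝 a, ∀ Y Z, G x Y Z = G x Z Y)
    (X Y Z : E3) : fderiv ℝ G a X Y Z = fderiv ℝ G a X Z Y := by
  have h1 : ∀ Y Z : E3, HasFDerivAt (fun x => G x Y Z)
      (((fderiv ℝ G a).flip Y).flip Z) a := fun Y Z => by
    have := (hG.hasFDerivAt.clm_apply (hasFDerivAt_const Y a)).clm_apply (hasFDerivAt_const Z a)
    simpa using this
  have h2 := (h1 Y Z).congr_of_eventuallyEq (f₁ := fun x => G x Z Y)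
    (hs.mono fun x hx => hx Z Y)
  exact DFunLike.congr_fun (h2.unique (h1 Z Y)).symm X |>.symm

theorem christoffel_symm (hG : DifferentiableAt ℝ G a) (h : (G a).IsInvertible)
    (hs : ∀ᶠ x in 𝓝 a, ∀ Y Z, G x Y Z = G x Z Y) (X Y : E3) :
    christoffel G a X Y = christoffel G a Y X := by
  obtain ⟨e, he⟩ := id h
  refine e.injective (ContinuousLinearMap.ext fun Z => ?_)
  have h1 := apply_christoffel h X Y Z
  have h2 := apply_christoffel h Y X Z
  rw [koszul_apply, ← he] at h1 h2
  refine h1.trans (Eq.trans ?_ h2.symm)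
  rw [fderiv_symm_apply hG hs Z X Y]
  ring

/-- The Christoffel symbols are compatible with the metric. -/
theorem christoffel_compat (hG : DifferentiableAt ℝ G a) (h : (G a).IsInvertible)
    (hs : ∀ᶠ x in 𝓝 a, ∀ Y Z, G x Y Z = G x Z Y) (X Y Z : E3) :
    fderiv ℝ G a X Y Z = G a (christoffel G a X Y) Z + G a Y (christoffel G a X Z) := by
  rw [hs.self_of_nhds Y, apply_christoffel h, apply_christoffel h, koszul_apply, koszul_apply,
    fderiv_symm_apply hG hs X Z Y, fderiv_symm_apply hG hs Z X Y, fderiv_symm_apply hG hs Y X Z]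
  ring

/-- Koszul's formula: a symmetric expression compatible with the metric is given by the
Christoffel symbols. -/
theorem eq_christoffel (h : (G a).IsInvertible) (hs : ∀ Y Z, G a Y Z = G a Z Y) {X Y e : E3}
    (f : E3 → E3) (k : E3 → E3)
    (h₁ : ∀ Z, fderiv ℝ G a X Y Z = G a e Z + G a Y (f Z))
    (h₂ : ∀ Z, fderiv ℝ G a Y X Z = G a e Z + G a X (k Z))
    (h₃ : ∀ Z, fderiv ℝ G a Z X Y = G a (f Z) Y + G a X (k Z)) : e = christoffel G a X Y := by
  obtain ⟨e', he⟩ := id h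
  refine e'.injective (ContinuousLinearMap.ext fun Z => ?_)
  have h4 := apply_christoffel h X Y Z
  rw [koszul_apply, h₁, h₂, h₃, hs (f Z) Y] at h4
  rw [← he] at h4
  refine Eq.trans ?_ h4.symm
  change e' e Z = 2⁻¹ * ((e' e Z + _) + (e' e Z + _) - _)
  ring

set_option synthInstance.maxHeartbeats 200000 in
theorem contDiffAt_koszul (hG : ContDiffAt ℝ ∞ G a) : ContDiffAt ℝ ∞ (koszul G) a := by
  have hD : ContDiffAt ℝ ∞ (fderiv ℝ G) a := hG.fderiv_right (by simp)
  have hF : ContDiffAt ℝ ∞ (fun x => (fderiv ℝ G x).flip) a :=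
    (ContinuousLinearMap.flipₗᵢ ℝ E3 E3
      (E3 →L[ℝ] ℝ)).toContinuousLinearEquiv.contDiff.contDiffAt.comp a hD
  exact ContDiffAt.const_smul _ ((hD.add hF).sub (contDiffAt_const.clm_comp hF))

theorem contDiffAt_inverse (hG : ContDiffAt ℝ ∞ G a) (h : (G a).IsInvertible) :
    ContDiffAt ℝ ∞ (fun x => (G x).inverse) a :=
  h.contDiffAt_map_inverse.comp a hG

set_option synthInstance.maxHeartbeats 400000 in
set_option maxHeartbeats 1000000 in
theorem contDiffAt_christoffel (hG : ContDiffAt ℝ ∞ G a) (h : (G a).IsInvertible) :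
    ContDiffAt ℝ ∞ (christoffel G) a := by
  have hC : ContDiff ℝ ∞ (fun f : (E3 →L[ℝ] ℝ) →L[ℝ] E3 =>
    ContinuousLinearMap.compL ℝ E3 (E3 →L[ℝ] ℝ) E3 f) := ContinuousLinearMap.contDiff _
  exact (hC.contDiffAt.comp a (contDiffAt_inverse hG h)).clm_comp (contDiffAt_koszul hG)

end

section

variable {M : Type*} [TopologicalSpace M] [ChartedSpace E3 M] [IsManifold (𝓡 3) ∞ M]

theorem isInvertible_metricCoord (g : Metric M) {x₀ : M} {a : E3}
    (h : a ∈ (chartAt E3 x₀).target) : (metricCoord g x₀ a).IsInvertible :=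
  isInvertible_of_pos fun _ hv => metricCoord_pos g h hv

/-- The Christoffel symbols of `g` in the coordinates at `x₀`. -/
def christoffelCoord (g : Metric M) (x₀ : M) : E3 → E3 →L[ℝ] E3 →L[ℝ] E3 :=
  christoffel (metricCoord g x₀)

theorem eventually_metricCoord_symm (g : Metric M) (x₀ : M) (a : E3) :
    ∀ᶠ x in 𝓝 a, ∀ Y Z, metricCoord g x₀ x Y Z = metricCoord g x₀ x Z Y :=
  Filter.Eventually.of_forall fun _ _ _ => metricCoord_symm g x₀ _ _ _

theorem christoffelCoord_symm (g : Metric M) {x₀ : M} {a : E3} (h : a ∈ (chartAt E3 x₀).target)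
    (X Y : E3) : christoffelCoord g x₀ a X Y = christoffelCoord g x₀ a Y X :=
  christoffel_symm ((contDiffAt_metricCoord g h).differentiableAt (by simp))
    (isInvertible_metricCoord g h) (eventually_metricCoord_symm g x₀ a) X Y

theorem christoffelCoord_compat (g : Metric M) {x₀ : M} {a : E3} (h : a ∈ (chartAt E3 x₀).target)
    (X Y Z : E3) : fderiv ℝ (metricCoord g x₀) a X Y Z =
      metricCoord g x₀ a (christoffelCoord g x₀ a X Y) Z +
        metricCoord g x₀ a Y (christoffelCoord g x₀ a X Z) :=
  christoffel_compat ((contDiffAt_metricCoord g h).differentiableAt (by simp))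
    (isInvertible_metricCoord g h) (eventually_metricCoord_symm g x₀ a) X Y Z

theorem contDiffAt_christoffelCoord (g : Metric M) {x₀ : M} {a : E3}
    (h : a ∈ (chartAt E3 x₀).target) : ContDiffAt ℝ ∞ (christoffelCoord g x₀) a :=
  contDiffAt_christoffel (contDiffAt_metricCoord g h) (isInvertible_metricCoord g h)

/-! ### The Levi-Civita connection -/

/-- The derivative of an inner product of vector fields, in coordinates. -/
theorem mvfderiv_inner (g : Metric M) {x₀ x : M} (h : x ∈ (chartAt E3 x₀).source)
    {Y Z : ∀ y : M, TangentSpace (𝓡 3) y} (hY : FieldDifferentiableAt Y x)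
    (hZ : FieldDifferentiableAt Z x) (X : TangentSpace (𝓡 3) x) :
    mvfderiv (𝓡 3) (fun y => g.inner y (Y y) (Z y)) x X =
      fderiv ℝ (metricCoord g x₀) (chartAt E3 x₀ x) (coframe x₀ x X) (coframe x₀ x (Y x))
        (coframe x₀ x (Z x)) +
      metricCoord g x₀ (chartAt E3 x₀ x)
        (fderiv ℝ (fieldCoord (E := E3) x₀ Y) (chartAt E3 x₀ x) (coframe x₀ x X))
        (coframe x₀ x (Z x)) +
      metricCoord g x₀ (chartAt E3 x₀ x) (coframe x₀ x (Y x))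
        (fderiv ℝ (fieldCoord (E := E3) x₀ Z) (chartAt E3 x₀ x) (coframe x₀ x X)) := by
  have hz := (chartAt E3 x₀).map_source h
  rw [mvfderiv_apply_eq_fderiv h (mdifferentiableAt_inner g hY hZ)]
  have h1 : ((fun y => g.inner y (Y y) (Z y)) ∘ (chartAt E3 x₀).symm) =ᶠ[𝓝 (chartAt E3 x₀ x)]
      fun a => metricCoord g x₀ a (fieldCoord (E := E3) x₀ Y a) (fieldCoord (E := E3) x₀ Z a) :=
    Filter.eventuallyEq_of_mem ((chartAt E3 x₀).open_target.mem_nhds hz)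
      fun a ha => (metricCoord_fieldCoord g ha Y Z).symm
  have hG := ((contDiffAt_metricCoord g hz).differentiableAt (by simp)).hasFDerivAt
  have hY' := ((mdifferentiableAt_field_iff h Y).1 hY).hasFDerivAt
  have hZ' := ((mdifferentiableAt_field_iff h Z).1 hZ).hasFDerivAt
  rw [h1.fderiv_eq, ((hG.clm_apply hY').clm_apply hZ').fderiv]
  have e1 := fieldCoord_chartAt h Y
  have e2 := fieldCoord_chartAt h Z
  simp only [_root_.add_apply, ContinuousLinearMap.comp_apply, ContinuousLinearMap.flip_apply,
    e1, e2]
  exact (add_comm _ _).trans (congrArg (· + _) (add_comm _ _))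

/-- The covariant derivative given at each point by the Christoffel symbols of `g` in the preferred
coordinates at that point. -/
def leviCivitaFun (g : Metric M) (Y : ∀ y : M, TangentSpace (𝓡 3) y) (x : M) :
    TangentSpace (𝓡 3) x →L[ℝ] TangentSpace (𝓡 3) x :=
  (frame x x).comp ((fderiv ℝ (fieldCoord (E := E3) x Y) (chartAt E3 x x) +
    (christoffelCoord g x (chartAt E3 x x)).flip (coframe x x (Y x))).comp (coframe x x))

theorem coframe_leviCivitaFun (g : Metric M) (Y : ∀ y : M, TangentSpace (𝓡 3) y) (x : M)
    (X : TangentSpace (𝓡 3) x) :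
    coframe x x (leviCivitaFun g Y x X) =
      fderiv ℝ (fieldCoord (E := E3) x Y) (chartAt E3 x x) (coframe x x X) +
        christoffelCoord g x (chartAt E3 x x) (coframe x x X) (coframe x x (Y x)) :=
  coframe_frame_self (mem_chart_source E3 x) _

theorem coframe_injective {x₀ x : M} (h : x ∈ (chartAt E3 x₀).source) :
    Function.Injective (coframe x₀ x) := fun v w hvw => by
  rw [← frame_coframe h v, hvw, frame_coframe h]

/-- The Levi-Civita connection of `g`. -/
def leviCivita (g : Metric M) : Connection M where
  toFun := leviCivitaFun g
  isCovariantDerivativeOnUniv := by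
    constructor
    · intro Y Z x hY hZ _
      have hx := mem_chart_source E3 x
      refine ContinuousLinearMap.ext fun X => coframe_injective hx ?_
      have e : fieldCoord (E := E3) x (Y + Z) = fieldCoord x Y + fieldCoord x Z :=
        funext fun a => map_add (chartDeriv (E := E3) x ((chartAt E3 x).symm a)) _ _
      rw [coframe_leviCivitaFun, e, fderiv_add ((mdifferentiableAt_field_iff hx Y).1 hY)
        ((mdifferentiableAt_field_iff hx Z).1 hZ)]
      have e2 : coframe x x ((Y + Z) x) = coframe x x (Y x) + coframe x x (Z x) :=
        map_add (coframe x x) _ _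
      have e3 : coframe x x ((leviCivitaFun g Y x + leviCivitaFun g Z x) X) =
          coframe x x (leviCivitaFun g Y x X) + coframe x x (leviCivitaFun g Z x X) :=
        map_add (coframe x x) _ _
      rw [e2, e3, map_add, coframe_leviCivitaFun, coframe_leviCivitaFun, _root_.add_apply]
      abel
    · intro Y f x hY hf _
      have hx := mem_chart_source E3 x
      refine ContinuousLinearMap.ext fun X => coframe_injective hx ?_
      have e : fieldCoord (E := E3) x (f • Y) =
          (f ∘ (chartAt E3 x).symm) • fieldCoord (E := E3) x Y :=
        funext fun a => map_smul (chartDeriv (E := E3) x ((chartAt E3 x).symm a)) _ _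
      have hf' : DifferentiableAt ℝ (f ∘ (chartAt E3 x).symm) (chartAt E3 x x) := by
        have h1 := hf
        rw [mdifferentiableAt_iff_source_of_mem_source (x := x) hx] at h1
        simpa only [mfld_simps, mdifferentiableWithinAt_iff_differentiableWithinAt,
          differentiableWithinAt_univ] using h1
      have e2 : coframe x x ((f • Y) x) = f x • coframe x x (Y x) := map_smul (coframe x x) _ _
      have e3 : coframe x x ((f x • leviCivitaFun g Y x +
          (mvfderiv (𝓡 3) f x).smulRight (Y x)) X) =
          f x • coframe x x (leviCivitaFun g Y x X) + mvfderiv (𝓡 3) f x X • coframe x x (Y x) :=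
        (map_add (coframe x x) _ _).trans (congrArg₂ (· + ·) (map_smul (coframe x x) _ _)
          (map_smul (coframe x x) _ _))
      have e4 : (f ∘ (chartAt E3 x).symm) (chartAt E3 x x) = f x := by
        simp
      have e5 : fieldCoord (E := E3) x Y (chartAt E3 x x) = coframe x x (Y x) :=
        fieldCoord_chartAt hx Y
      rw [coframe_leviCivitaFun, e, fderiv_smul hf' ((mdifferentiableAt_field_iff hx Y).1 hY), e2,
        e3, map_smul, coframe_leviCivitaFun, mvfderiv_apply_eq_fderiv hx hf, e4, e5]
      simp only [_root_.add_apply, _root_.smul_apply, ContinuousLinearMap.smulRight_apply,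
        smul_add]
      change _ + fderiv ℝ _ _ (coframe x x X) • _ + _ = _ + fderiv ℝ _ _ (coframe x x X) • _
      abel

theorem leviCivita_apply (g : Metric M) (Y : ∀ y : M, TangentSpace (𝓡 3) y) (x : M) :
    leviCivita g Y x = leviCivitaFun g Y x := rfl

theorem isLeviCivita_leviCivita (g : Metric M) : IsLeviCivita g (leviCivita g) where
  torsion_eq_zero x := by
    have hx := mem_chart_source E3 x
    refine ContinuousLinearMap.ext fun X => ContinuousLinearMap.ext fun Y => ?_
    have h1 := fieldDifferentiableAt_coordField hx (f := fun _ => coframe x x X)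
      (differentiableAt_const _)
    have h2 := fieldDifferentiableAt_coordField hx (f := fun _ => coframe x x Y)
      (differentiableAt_const _)
    have e1 : coordField (E := E3) x (fun _ => coframe x x X) x = X := frame_coframe hx X
    have e2 : coordField (E := E3) x (fun _ => coframe x x Y) x = Y := frame_coframe hx Y
    have h3 := (leviCivita g).torsion_apply h1 h2
    rw [e1, e2] at h3
    rw [h3]
    refine coframe_injective hx ?_
    have h4 := chartDeriv_mlieBracket hx h1 h2
    have h5 : ∀ v : E3, fderiv ℝ (fieldCoord (E := E3) x (coordField (E := E3) x fun _ => v))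
        (chartAt E3 x x) = 0 := fun v => by
      rw [(fieldCoord_coordField_eventuallyEq hx _).fderiv_eq, fderiv_fun_const]; rfl
    have h6 : coframe x x (VectorField.mlieBracket (𝓡 3)
        (coordField (E := E3) x fun _ => coframe x x X)
        (coordField (E := E3) x fun _ => coframe x x Y) x) = 0 := by
      refine h4.trans ?_
      rw [VectorField.lieBracket, h5, h5]
      simp
    have h7 : ∀ u v w : TangentSpace (𝓡 3) x, coframe x x (u - v - w) =
      coframe x x u - coframe x x v - coframe x x w := fun u v w => by simp
    refine (h7 _ _ _).trans ?_
    rw [h6, leviCivita_apply, leviCivita_apply, coframe_leviCivitaFun, coframe_leviCivitaFun, e1,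
      e2, h5, h5, christoffelCoord_symm g ((chartAt E3 x).map_source hx) (coframe x x X)]
    simp
  metric x X Y Z hY hZ := by
    have hx := mem_chart_source E3 x
    rw [mvfderiv_inner g hx hY hZ, ← metricCoord_coframe g hx, ← metricCoord_coframe g hx,
      christoffelCoord_compat g ((chartAt E3 x).map_source hx), leviCivita_apply, leviCivita_apply,
      coframe_leviCivitaFun, coframe_leviCivitaFun, map_add, map_add, _root_.add_apply]
    ring

/-- The Levi-Civita connection in coordinates. The difference with the derivative of the components
is symmetric, as the torsion vanishes, and compatible with the metric, so that Koszul's formula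
applies. -/
theorem IsLeviCivita.coframe_apply {g : Metric M} {D : Connection M} (hD : IsLeviCivita g D)
    {x₀ x : M} (h : x ∈ (chartAt E3 x₀).source) {Y : ∀ y : M, TangentSpace (𝓡 3) y}
    (hY : FieldDifferentiableAt Y x) (X : TangentSpace (𝓡 3) x) :
    coframe x₀ x (D Y x X) =
      fderiv ℝ (fieldCoord (E := E3) x₀ Y) (chartAt E3 x₀ x) (coframe x₀ x X) +
        christoffelCoord g x₀ (chartAt E3 x₀ x) (coframe x₀ x X) (coframe x₀ x (Y x)) := by
  have hz := (chartAt E3 x₀).map_source h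
  -- The difference with the derivative in coordinates, for differentiable fields.
  set T : (∀ y : M, TangentSpace (𝓡 3) y) → (∀ y : M, TangentSpace (𝓡 3) y) → E3 := fun V W =>
    coframe x₀ x (D W x (V x)) -
      fderiv ℝ (fieldCoord (E := E3) x₀ W) (chartAt E3 x₀ x) (coframe x₀ x (V x)) with hT
  have hsymm : ∀ V W, FieldDifferentiableAt V x → FieldDifferentiableAt W x → T V W = T W V := by
    intro V W hV hW
    have h1 := D.torsion_apply hV hW
    rw [hD.torsion_eq_zero] at h1
    have h2 := chartDeriv_mlieBracket h hV hW
    have h3 : coframe x₀ x (D W x (V x)) - coframe x₀ x (D V x (W x)) -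
        coframe x₀ x (VectorField.mlieBracket (𝓡 3) V W x) = 0 := by
      have h4 : ∀ u v w : TangentSpace (𝓡 3) x, coframe x₀ x (u - v - w) =
        coframe x₀ x u - coframe x₀ x v - coframe x₀ x w := fun u v w => by simp
      refine (h4 _ _ _).symm.trans ?_
      refine (congrArg (coframe x₀ x) h1.symm).trans (map_zero _)
    have h5 : coframe x₀ x (VectorField.mlieBracket (𝓡 3) V W x) = _ := h2
    rw [h5, VectorField.lieBracket, fieldCoord_chartAt h, fieldCoord_chartAt h] at h3
    have h6 : ∀ p q r s : E3, p - q - (r - s) = 0 → p - r = q - s := fun p q r s hp => by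
      rw [← sub_eq_zero, ← hp]; abel
    exact h6 _ _ _ _ h3
  have hmet : ∀ V W Z, FieldDifferentiableAt W x → FieldDifferentiableAt Z x →
      fderiv ℝ (metricCoord g x₀) (chartAt E3 x₀ x) (coframe x₀ x (V x)) (coframe x₀ x (W x))
        (coframe x₀ x (Z x)) = metricCoord g x₀ (chartAt E3 x₀ x) (T V W) (coframe x₀ x (Z x)) +
          metricCoord g x₀ (chartAt E3 x₀ x) (coframe x₀ x (W x)) (T V Z) := by
    intro V W Z hW hZ
    have h1 := hD.metric x (V x) W Z hW hZ
    rw [mvfderiv_inner g h hW hZ, ← metricCoord_coframe g h, ← metricCoord_coframe g h] at h1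
    rw [hT]
    simp only [map_sub, _root_.sub_apply]
    linear_combination h1
  have hc : ∀ v : E3, FieldDifferentiableAt (coordField (E := E3) x₀ fun _ => v) x := fun v =>
    fieldDifferentiableAt_coordField h (differentiableAt_const v)
  have ec : ∀ v : E3, coframe x₀ x (coordField (E := E3) x₀ (fun _ => v) x) = v := fun v =>
    coframe_frame_self h v
  set X' := coordField (E := E3) x₀ fun _ => coframe x₀ x X with hX'
  have eX : X' x = X := frame_coframe h X
  have key := eq_christoffel (isInvertible_metricCoord g hz) (metricCoord_symm g x₀ _)
    (X := coframe x₀ x X) (Y := coframe x₀ x (Y x)) (e := T X' Y)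
    (fun v => T X' (coordField (E := E3) x₀ fun _ => v))
    (fun v => T Y (coordField (E := E3) x₀ fun _ => v)) ?_ ?_ ?_
  · change _ = christoffelCoord g x₀ _ _ _ at key
    rw [← key, hT]
    simp only [eX]
    abel
  · intro v
    have := hmet X' Y (coordField (E := E3) x₀ fun _ => v) hY (hc v)
    rwa [ec v, eX] at this
  · intro v
    have := hmet Y X' (coordField (E := E3) x₀ fun _ => v) (hc _) (hc v)
    rwa [ec v, eX, hsymm Y X' hY (hc _)] at this
  · intro v
    have := hmet (coordField (E := E3) x₀ fun _ => v) X' Y (hc _) hY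
    rwa [ec v, eX, hsymm _ X' (hc _) (hc _), hsymm _ Y (hc _) hY] at this

end

/-! ### The volume form and the rotation of a plane in coordinates -/

section

variable {M : Type*} [TopologicalSpace M] [ChartedSpace E3 M] [IsManifold (𝓡 3) ∞ M]

theorem flat_apply (g : Metric M) {x : M} (X U : TangentSpace (𝓡 3) x) :
    flat g x X U = g.inner x X U := rfl

theorem inner_sharp (g : Metric M) {x : M} (p : CotangentSpace x) (U : TangentSpace (𝓡 3) x) :
    g.inner x (sharp g x p) U = p U := by
  rw [← flat_apply, sharp, LinearEquiv.apply_symm_apply]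

theorem eq_of_inner_eq (g : Metric M) {x : M} {X Y : TangentSpace (𝓡 3) x}
    (h : ∀ U, g.inner x X U = g.inner x Y U) : X = Y :=
  (flat g x).injective (ContinuousLinearMap.ext h)

theorem turn_apply (o : ManifoldOrientation M) (g : Metric M) {x : M} (p η : CotangentSpace x)
    (U : TangentSpace (𝓡 3) x) :
    turn o g p η U = (Real.sqrt (p (sharp g x p)))⁻¹ *
      volumeForm o g x ![sharp g x η, U, sharp g x p] := by
  change _ * volumeForm o g x (Function.update _ 1 U) = _
  congr 3
  ext i : 1
  fin_cases i <;> rfl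

theorem inner_turnVector (o : ManifoldOrientation M) (g : Metric M) {x : M} (p : CotangentSpace x)
    (X U : TangentSpace (𝓡 3) x) :
    g.inner x (turnVector o g p X) U = (Real.sqrt (p (sharp g x p)))⁻¹ *
      volumeForm o g x ![X, U, sharp g x p] := by
  rw [turnVector, inner_sharp, turn_apply, sharp, LinearEquiv.symm_apply_apply]

/-- The rotation of covectors is minus the transpose of the rotation of vectors. -/
theorem turn_eq_neg_comp (o : ManifoldOrientation M) (g : Metric M) {x : M} (p η : CotangentSpace x)
    (U : TangentSpace (𝓡 3) x) : turn o g p η U = -η (turnVector o g p U) := by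
  rw [← inner_sharp g η, g.symm, inner_turnVector, turn_apply, ← mul_neg]
  congr 1
  have h := (volumeForm o g x).map_swap ![U, sharp g x η, sharp g x p] (i := 0) (j := 1) (by decide)
  rw [← h]
  congr 1
  ext i : 1
  fin_cases i <;> rfl

/-- The rotation depends only on the ray of `p`. -/
theorem turnVector_smul (o : ManifoldOrientation M) (g : Metric M) {x : M} {p : CotangentSpace x}
    {t : ℝ} (ht : 0 < t) (X : TangentSpace (𝓡 3) x) :
    turnVector o g (t • p) X = turnVector o g p X := by
  refine eq_of_inner_eq g fun U => ?_
  have h1 : volumeForm o g x ![X, U, t • sharp g x p] =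
      t * volumeForm o g x ![X, U, sharp g x p] := by
    have := (volumeForm o g x).map_update_smul ![X, U, sharp g x p] 2 t (sharp g x p)
    have e1 : Function.update ![X, U, sharp g x p] 2 (t • sharp g x p) =
        ![X, U, t • sharp g x p] := by ext i : 1; fin_cases i <;> rfl
    have e2 : Function.update ![X, U, sharp g x p] 2 (sharp g x p) = ![X, U, sharp g x p] := by
      ext i : 1; fin_cases i <;> rfl
    rwa [e1, e2] at this
  have h2 : (t • p) (t • sharp g x p) = t ^ 2 * p (sharp g x p) := by
    rw [map_smul, _root_.smul_apply, smul_eq_mul, smul_eq_mul]; ring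
  rw [inner_turnVector, inner_turnVector, map_smul, h1, h2, Real.sqrt_mul (sq_nonneg t),
    Real.sqrt_sq ht.le, mul_inv]
  field_simp

/-- The rotation is the same for `Ω²g`: the volume form is multiplied by `Ω³`, the vector `p^♯` by
`Ω⁻²` and the inverse of the norm of `p` by `Ω`. -/
theorem turnVector_conformal (o : ManifoldOrientation M) {g g' : Metric M} {x : M} {Ω : ℝ}
    (hΩ : 0 < Ω) (h : ∀ v w, g'.inner x v w = Ω ^ 2 * g.inner x v w) (p : CotangentSpace x)
    (X : TangentSpace (𝓡 3) x) : turnVector o g' p X = turnVector o g p X := by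
  have hs : sharp g' x p = (Ω ^ 2)⁻¹ • sharp g x p := by
    refine eq_of_inner_eq g' fun U => ?_
    rw [inner_sharp, h, map_smul, _root_.smul_apply, smul_eq_mul, inner_sharp]
    field_simp
  have hv : volumeForm o g' x = Ω ^ 3 • volumeForm o g x := by
    have h1 : (Matrix.of fun i j =>
        g'.inner x (orientedBasis o x i) (orientedBasis o x j)) =
        Ω ^ 2 • Matrix.of fun i j => g.inner x (orientedBasis o x i) (orientedBasis o x j) := by
      ext i j; simp [h]
    have h2 : Real.sqrt ((Ω ^ 2) ^ 3) = Ω ^ 3 := by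
      rw [← pow_mul, mul_comm, pow_mul, Real.sqrt_sq (by positivity)]
    rw [volumeForm, h1, Matrix.det_smul, Fintype.card_fin, Real.sqrt_mul (by positivity), h2,
      mul_smul]
    rfl
  refine eq_of_inner_eq g fun U => mul_left_cancel₀ (pow_pos hΩ 2).ne' ?_
  have h1 : volumeForm o g x ![X, U, (Ω ^ 2)⁻¹ • sharp g x p] =
      (Ω ^ 2)⁻¹ * volumeForm o g x ![X, U, sharp g x p] := by
    have := (volumeForm o g x).map_update_smul ![X, U, sharp g x p] 2 (Ω ^ 2)⁻¹ (sharp g x p)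
    have e1 : Function.update ![X, U, sharp g x p] 2 ((Ω ^ 2)⁻¹ • sharp g x p) =
        ![X, U, (Ω ^ 2)⁻¹ • sharp g x p] := by ext i : 1; fin_cases i <;> rfl
    have e2 : Function.update ![X, U, sharp g x p] 2 (sharp g x p) = ![X, U, sharp g x p] := by
      ext i : 1; fin_cases i <;> rfl
    rwa [e1, e2] at this
  rw [← h, inner_turnVector, inner_turnVector, hs, hv, map_smul, smul_eq_mul,
    Real.sqrt_mul (by positivity), Real.sqrt_inv, Real.sqrt_sq hΩ.le, AlternatingMap.smul_apply, h1,
    smul_eq_mul, mul_inv, inv_inv]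
  field_simp

/-- The standard basis of `ℝ³`. -/
def stdBasis : Module.Basis (Fin 3) ℝ E3 := (EuclideanSpace.basisFun (Fin 3) ℝ).toBasis

theorem stdBasis_det (u : Fin 3 → E3) : stdBasis.det u = det3 (u 0) (u 1) (u 2) := by
  rw [Module.Basis.det_apply, det3, ← Matrix.det_transpose]
  congr 1
  ext i j
  fin_cases i <;> simp [Module.Basis.toMatrix_apply, stdBasis]

theorem stdGram_det_pos {G : E3 →L[ℝ] E3 →L[ℝ] ℝ} (symm : ∀ X Y, G X Y = G Y X)
    (pos : ∀ X, X ≠ 0 → 0 < G X X) : 0 < (stdGram G).det := by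
  refine Matrix.PosDef.det_pos (Matrix.PosDef.of_dotProduct_mulVec_pos ?_ fun u hu => ?_)
  · ext i j
    exact symm _ _
  · have h := pos (WithLp.toLp 2 u) (by simpa using hu)
    rw [bilin_eq_sum] at h
    refine h.trans_eq ?_
    simp only [dotProduct, Matrix.mulVec, star_trivial, Finset.mul_sum]
    refine Finset.sum_congr rfl fun i _ => Finset.sum_congr rfl fun j _ => by ring

/-- The coordinates at `x₀` as an isomorphism of the tangent space with `ℝ³`. -/
def coframeEquiv {x₀ x : M} (h : x ∈ (chartAt E3 x₀).source) : TangentSpace (𝓡 3) x ≃ₗ[ℝ] E3 :=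
  LinearEquiv.ofLinearMap (coframe x₀ x).toLinearMap (frame x₀ x).toLinearMap
    (LinearMap.ext fun v => coframe_frame_self h v) (LinearMap.ext fun v => frame_coframe h v)

/-- The component of the volume form in the coordinates at `x₀`. -/
def volumeCoord (o : ManifoldOrientation M) (g : Metric M) (x₀ x : M) : ℝ :=
  volumeForm o g x fun i => frame x₀ x (stdBasis i)

theorem volumeForm_frame (o : ManifoldOrientation M) (g : Metric M) {x₀ x : M}
    (X Y Z : E3) :
    volumeForm o g x ![frame x₀ x X, frame x₀ x Y, frame x₀ x Z] =
      volumeCoord o g x₀ x * det3 X Y Z := by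
  have h1 := ((volumeForm o g x).compLinearMap (frame x₀ x).toLinearMap).eq_smul_basis_det stdBasis
  have h2 := DFunLike.congr_fun h1 ![X, Y, Z]
  rw [AlternatingMap.smul_apply, stdBasis_det] at h2
  refine Eq.trans ?_ h2
  rw [AlternatingMap.compLinearMap_apply]
  congr 1
  ext i : 1
  fin_cases i <;> rfl

/-- The component of the volume form is the square root of the Gram determinant, with the sign by
which the orientation of `M` differs from the standard one in the coordinates. -/
theorem volumeCoord_eq (o : ManifoldOrientation M) (g : Metric M) {x₀ x : M}
    (h : x ∈ (chartAt E3 x₀).source) :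
    volumeCoord o g x₀ x =
      (open Classical in if Orientation.map (Fin 3) (coframeEquiv h) (o.at_ x) =
        stdBasis.orientation then 1 else -1) *
      Real.sqrt (stdGram (metricCoord g x₀ (chartAt E3 x₀ x))).det := by
  set β := (orientedBasis o x).map (coframeEquiv h) with hβ
  set γ := (stdGram (metricCoord g x₀ (chartAt E3 x₀ x))).det with hγ
  set δ := det3 (β 0) (β 1) (β 2) with hδ
  have hO : Orientation.map (Fin 3) (coframeEquiv h) (o.at_ x) = β.orientation := by
    rw [hβ, Module.Basis.orientation_map, orientedBasis, Orientation.someBasis_orientation]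
  have hδ' : stdBasis.det β = δ := stdBasis_det _
  have hd : Matrix.det (Matrix.of fun i j =>
      g.inner x (orientedBasis o x i) (orientedBasis o x j)) = γ * δ ^ 2 := by
    have h1 := gram_det (metricCoord g x₀ (chartAt E3 x₀ x)) β β
    rw [pow_two, ← mul_assoc, ← h1]
    congr 1
    ext i j
    exact (metricCoord_coframe g h _ _).symm
  have ht : (orientedBasis o x).det (fun i => frame x₀ x (stdBasis i)) * δ = 1 := by
    have h1 : (orientedBasis o x).det (fun i => frame x₀ x (stdBasis i)) = β.det stdBasis := by
      rw [hβ, Module.Basis.det_map]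
      rfl
    have h2 := DFunLike.congr_fun (β.det.eq_smul_basis_det stdBasis) (fun i => β i)
    rw [Module.Basis.det_self, AlternatingMap.smul_apply, hδ'] at h2
    rw [h1]
    exact h2.symm
  have hδ0 : δ ≠ 0 := right_ne_zero_of_mul_eq_one ht
  have hv : volumeCoord o g x₀ x = Real.sqrt (γ * δ ^ 2) * δ⁻¹ := by
    rw [volumeCoord, volumeForm, AlternatingMap.smul_apply, hd, smul_eq_mul,
      eq_inv_of_mul_eq_one_left ht]
  rw [hv, Real.sqrt_mul' _ (sq_nonneg δ), Real.sqrt_sq_eq_abs, hO]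
  have hiff : β.orientation = stdBasis.orientation ↔ 0 < δ := by
    rw [eq_comm, Module.Basis.orientation_eq_iff_det_pos, hδ']
  rcases hδ0.lt_or_gt with hlt | hgt
  · rw [if_neg (fun h => hlt.not_gt (hiff.1 h)), abs_of_neg hlt]
    field_simp
  · rw [if_pos (hiff.2 hgt), abs_of_pos hgt]
    field_simp

theorem volumeCoord_sq (o : ManifoldOrientation M) (g : Metric M) {x₀ x : M}
    (h : x ∈ (chartAt E3 x₀).source) :
    volumeCoord o g x₀ x ^ 2 = (stdGram (metricCoord g x₀ (chartAt E3 x₀ x))).det := by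
  have hpos := stdGram_det_pos (metricCoord_symm g x₀ (chartAt E3 x₀ x))
    (fun v hv => metricCoord_pos g ((chartAt E3 x₀).map_source h) hv)
  rw [volumeCoord_eq o g h, mul_pow, Real.sq_sqrt hpos.le]
  split_ifs <;> simp

/-- The sign of the component of the volume form is constant near the centre of the coordinates. -/
theorem exists_sign_volumeCoord (o : ManifoldOrientation M) (g : Metric M) (x₀ : M) :
    ∃ s : ℝ, ∀ᶠ x in 𝓝 x₀, volumeCoord o g x₀ x =
      s * Real.sqrt (stdGram (metricCoord g x₀ (chartAt E3 x₀ x))).det := by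
  classical
  obtain ⟨o', ho'⟩ := o.locallyConstant x₀
  refine ⟨if o' = stdBasis.orientation then 1 else -1, ?_⟩
  filter_upwards [ho', (chartAt E3 x₀).open_source.mem_nhds (mem_chart_source E3 x₀)] with x hx h
  have h1 := hx (by simpa using h)
  have h2 : ((trivializationAt E3 (fun x : M => TangentSpace (𝓡 3) x) x₀).continuousLinearEquivAt
      ℝ x (by simpa using h)).toLinearEquiv = coframeEquiv h := LinearEquiv.ext fun v => rfl
  rw [h2] at h1
  rw [volumeCoord_eq o g h, h1]

/-- The form `(X, U) ↦ det(X, U, N)`. -/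
def crossForm (N : E3) : E3 →L[ℝ] E3 →L[ℝ] ℝ :=
  N 2 • ((EuclideanSpace.proj 0 : E3 →L[ℝ] ℝ).smulRight (EuclideanSpace.proj 1 : E3 →L[ℝ] ℝ) -
    (EuclideanSpace.proj 1 : E3 →L[ℝ] ℝ).smulRight (EuclideanSpace.proj 0 : E3 →L[ℝ] ℝ)) +
  N 1 • ((EuclideanSpace.proj 2 : E3 →L[ℝ] ℝ).smulRight (EuclideanSpace.proj 0 : E3 →L[ℝ] ℝ) -
    (EuclideanSpace.proj 0 : E3 →L[ℝ] ℝ).smulRight (EuclideanSpace.proj 2 : E3 →L[ℝ] ℝ)) +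
  N 0 • ((EuclideanSpace.proj 1 : E3 →L[ℝ] ℝ).smulRight (EuclideanSpace.proj 2 : E3 →L[ℝ] ℝ) -
    (EuclideanSpace.proj 2 : E3 →L[ℝ] ℝ).smulRight (EuclideanSpace.proj 1 : E3 →L[ℝ] ℝ))

theorem crossForm_apply (N X U : E3) : crossForm N X U = det3 X U N := by
  rw [det3_eq]
  simp [crossForm]
  ring

theorem contDiff_crossForm : ContDiff ℝ ∞ crossForm := by
  unfold crossForm
  have h : ∀ i : Fin 3, ContDiff ℝ ∞ (fun N : E3 => N i) := fun i =>
    (EuclideanSpace.proj i : E3 →L[ℝ] ℝ).contDiff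
  exact (((h 2).smul contDiff_const).add ((h 1).smul contDiff_const)).add
    ((h 0).smul contDiff_const)

/-- The normal of the plane `ker p` given by raising the index of the affine covector `p`. -/
def normalCoord (g : Metric M) (x₀ : M) (b : Module.Basis (Fin 3) ℝ E3) (z : E5) : E3 :=
  (metricCoord g x₀ z.1).inverse (affineCovector b z.2)

/-- The rotation `turnVector` in an affine chart. -/
def turnCoord (o : ManifoldOrientation M) (g : Metric M) (x₀ : M) (b : Module.Basis (Fin 3) ℝ E3)
    (z : E5) : E3 →L[ℝ] E3 :=
  (metricCoord g x₀ z.1).inverse.comp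
    (((Real.sqrt (affineCovector b z.2 (normalCoord g x₀ b z)))⁻¹ *
      volumeCoord o g x₀ ((chartAt E3 x₀).symm z.1)) • crossForm (normalCoord g x₀ b z))

theorem metricCoord_inverse (g : Metric M) {x₀ : M} {a : E3} (h : a ∈ (chartAt E3 x₀).target)
    (f : E3 →L[ℝ] ℝ) : metricCoord g x₀ a ((metricCoord g x₀ a).inverse f) = f := by
  obtain ⟨e, he⟩ := isInvertible_metricCoord g h
  rw [← he, ContinuousLinearMap.inverse_equiv]
  exact e.apply_symm_apply f

theorem metricCoord_normalCoord (g : Metric M) {x₀ : M} (b : Module.Basis (Fin 3) ℝ E3) {z : E5}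
    (h : z.1 ∈ (chartAt E3 x₀).target) (U : E3) :
    metricCoord g x₀ z.1 (normalCoord g x₀ b z) U = affineCovector b z.2 U := by
  rw [normalCoord, metricCoord_inverse g h]

theorem metricCoord_turnCoord (o : ManifoldOrientation M) (g : Metric M) {x₀ : M}
    (b : Module.Basis (Fin 3) ℝ E3) {z : E5} (h : z.1 ∈ (chartAt E3 x₀).target) (X U : E3) :
    metricCoord g x₀ z.1 (turnCoord o g x₀ b z X) U =
      (Real.sqrt (affineCovector b z.2 (normalCoord g x₀ b z)))⁻¹ *
        volumeCoord o g x₀ ((chartAt E3 x₀).symm z.1) * det3 X U (normalCoord g x₀ b z) := by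
  rw [turnCoord, ContinuousLinearMap.comp_apply, metricCoord_inverse g h, _root_.smul_apply,
    _root_.smul_apply, crossForm_apply, smul_eq_mul]

theorem normalCoord_ne_zero (g : Metric M) {x₀ : M} (b : Module.Basis (Fin 3) ℝ E3) {z : E5}
    (h : z.1 ∈ (chartAt E3 x₀).target) : normalCoord g x₀ b z ≠ 0 := fun h0 => by
  have h1 := metricCoord_normalCoord g b h (b 0)
  rw [h0, affineCovector_zero] at h1
  simp at h1

theorem affineCovector_normalCoord_pos (g : Metric M) {x₀ : M} (b : Module.Basis (Fin 3) ℝ E3)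
    {z : E5} (h : z.1 ∈ (chartAt E3 x₀).target) :
    0 < affineCovector b z.2 (normalCoord g x₀ b z) := by
  rw [← metricCoord_normalCoord g b h]
  exact metricCoord_pos g h (normalCoord_ne_zero g b h)

theorem isRotation_turnCoord (o : ManifoldOrientation M) (g : Metric M) {x₀ : M}
    (b : Module.Basis (Fin 3) ℝ E3) {z : E5} (h : z.1 ∈ (chartAt E3 x₀).target) :
    IsRotation (metricCoord g x₀ z.1) (affineCovector b z.2) (turnCoord o g x₀ b z) := by
  have hp := affineCovector_normalCoord_pos g b h
  refine isRotation_of_cross (metricCoord_symm g x₀ z.1) (fun v hv => metricCoord_pos g h hv)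
    (normalCoord_ne_zero g b h) (metricCoord_normalCoord g b h) ?_ (metricCoord_turnCoord o g b h)
  have h1 := volumeCoord_sq o g ((chartAt E3 x₀).map_target h)
  rw [(chartAt E3 x₀).right_inv h] at h1
  rw [mul_pow, h1, inv_pow, Real.sq_sqrt hp.le]
  field_simp

/-- The map `turnCoord` is the rotation `turnVector` in coordinates. -/
theorem coframe_turnVector (o : ManifoldOrientation M) (g : Metric M) {x₀ x : M}
    (b : Module.Basis (Fin 3) ℝ E3) (h : x ∈ (chartAt E3 x₀).source) {p : CotangentSpace x}
    {y : Fin 2 → ℝ} {t : ℝ} (ht : 0 < t)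
    (hp : ∀ v, p (frame x₀ x v) = t * affineCovector b y v) (X : TangentSpace (𝓡 3) x) :
    coframe x₀ x (turnVector o g p X) =
      turnCoord o g x₀ b (chartAt E3 x₀ x, y) (coframe x₀ x X) := by
  have hz := (chartAt E3 x₀).map_source h
  set q : CotangentSpace x := (affineCovector b y).comp (coframe x₀ x) with hq
  have hq' : p = t • q := ContinuousLinearMap.ext fun v => by
    rw [← frame_coframe h v, hp]
    change _ = t * affineCovector b y (coframe x₀ x (frame x₀ x _))
    rw [coframe_frame_self h]
  set N := normalCoord g x₀ b (chartAt E3 x₀ x, y) with hN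
  have hsharp : sharp g x q = frame x₀ x N := by
    refine eq_of_inner_eq g fun U => ?_
    rw [inner_sharp, ← metricCoord_coframe g h, coframe_frame_self h]
    exact (metricCoord_normalCoord g b (z := (chartAt E3 x₀ x, y)) hz _).symm
  have hqN : q (frame x₀ x N) = affineCovector b y N :=
    congrArg (affineCovector b y) (coframe_frame_self h N)
  rw [hq', turnVector_smul o g ht]
  obtain ⟨e, he⟩ := isInvertible_metricCoord g hz
  refine e.injective (ContinuousLinearMap.ext fun U => ?_)
  have h1 := metricCoord_turnCoord o g b (z := (chartAt E3 x₀ x, y)) hz (coframe x₀ x X) U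
  have h2 := inner_turnVector o g q X (frame x₀ x U)
  rw [← metricCoord_coframe g h, coframe_frame_self h, hsharp, hqN] at h2
  have h3 := volumeForm_frame o g (x₀ := x₀) (x := x) (coframe x₀ x X) U N
  rw [frame_coframe h] at h3
  rw [h3, ← mul_assoc] at h2
  simp only [(chartAt E3 x₀).left_inv h] at h1
  rw [← he] at h1 h2
  exact h2.trans h1.symm

theorem turnCoord_conformal (o : ManifoldOrientation M) {g g' : Metric M} {x₀ : M} {Ω : M → ℝ}
    (hΩ : ∀ x, 0 < Ω x) (h : ∀ x v w, g'.inner x v w = Ω x ^ 2 * g.inner x v w)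
    (b : Module.Basis (Fin 3) ℝ E3) {z : E5} (hz : z.1 ∈ (chartAt E3 x₀).target) :
    turnCoord o g' x₀ b z = turnCoord o g x₀ b z := by
  have hx := (chartAt E3 x₀).map_target hz
  set x := (chartAt E3 x₀).symm z.1 with hxz
  have ez : chartAt E3 x₀ x = z.1 := (chartAt E3 x₀).right_inv hz
  refine ContinuousLinearMap.ext fun X => ?_
  have key : ∀ g : Metric M, turnCoord o g x₀ b z X =
      coframe x₀ x (turnVector o g ((affineCovector b z.2).comp (coframe x₀ x)) (frame x₀ x X)) :=
    fun g => by
    rw [coframe_turnVector o g b hx (y := z.2) one_pos (fun v => ?_), coframe_frame_self hx, ez]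
    rw [one_mul]
    exact congrArg (affineCovector b z.2) (coframe_frame_self hx v)
  rw [key, key, turnVector_conformal o (hΩ x) (h x)]

theorem contDiff_affineCovector (b : Module.Basis (Fin 3) ℝ E3) :
    ContDiff ℝ ∞ (fun z : E5 => affineCovector b z.2) := by
  have h : (fun z : E5 => affineCovector b z.2) = fun z : E5 => affineCovector b 0 +
      fiberCovector b z.2 := funext fun z => affineCovector_eq b z.2
  rw [h]
  exact contDiff_const.add ((fiberCovector b).contDiff.comp contDiff_snd)

theorem contDiffAt_normalCoord (g : Metric M) {x₀ : M} (b : Module.Basis (Fin 3) ℝ E3) {z : E5}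
    (h : z.1 ∈ (chartAt E3 x₀).target) : ContDiffAt ℝ ∞ (normalCoord g x₀ b) z :=
  ((contDiffAt_inverse (contDiffAt_metricCoord g h) (isInvertible_metricCoord g h)).comp z
    contDiffAt_fst).clm_apply (contDiff_affineCovector b).contDiffAt

theorem contDiffAt_stdGram_det (g : Metric M) {x₀ : M} {a : E3}
    (h : a ∈ (chartAt E3 x₀).target) :
    ContDiffAt ℝ ∞ (fun a => (stdGram (metricCoord g x₀ a)).det) a := by
  have hG := contDiffAt_metricCoord g h
  have h1 : ∀ i j : Fin 3, ContDiffAt ℝ ∞ (fun a => stdGram (metricCoord g x₀ a) i j) a :=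
    fun i j => (hG.clm_apply contDiffAt_const).clm_apply contDiffAt_const
  simp only [Matrix.det_fin_three]
  fun_prop

/-- The rotation is smooth near the centre of the coordinates, where the orientation is constant. -/
theorem exists_contDiffAt_turnCoord (o : ManifoldOrientation M) (g : Metric M) (x₀ : M) :
    ∃ V : Set E3, IsOpen V ∧ chartAt E3 x₀ x₀ ∈ V ∧ V ⊆ (chartAt E3 x₀).target ∧
      ∀ (b : Module.Basis (Fin 3) ℝ E3) (z : E5), z.1 ∈ V →
        ContDiffAt ℝ ∞ (turnCoord o g x₀ b) z := by
  obtain ⟨s, hs⟩ := exists_sign_volumeCoord o g x₀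
  obtain ⟨W, hW, hWo, hxW⟩ := eventually_nhds_iff.1 hs
  refine ⟨(chartAt E3 x₀).target ∩ (chartAt E3 x₀).symm ⁻¹' W,
    (chartAt E3 x₀).isOpen_inter_preimage_symm hWo, ⟨mem_chart_target E3 x₀, ?_⟩,
    Set.inter_subset_left, fun b z hz => ?_⟩
  · simpa using hxW
  have hzt : z.1 ∈ (chartAt E3 x₀).target := hz.1
  have hO := (chartAt E3 x₀).isOpen_inter_preimage_symm hWo
  have hv : (fun z : E5 => volumeCoord o g x₀ ((chartAt E3 x₀).symm z.1)) =ᶠ[𝓝 z]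
      fun z => s * Real.sqrt (stdGram (metricCoord g x₀ z.1)).det := by
    filter_upwards [(hO.preimage continuous_fst).mem_nhds hz] with w hw
    rw [hW _ hw.2, (chartAt E3 x₀).right_inv hw.1]
  have hdet := (contDiffAt_stdGram_det g hzt).comp z contDiffAt_fst
  have hpos := stdGram_det_pos (metricCoord_symm g x₀ z.1) (fun v hv => metricCoord_pos g hzt hv)
  have h1 : ContDiffAt ℝ ∞ (fun z : E5 => volumeCoord o g x₀ ((chartAt E3 x₀).symm z.1)) z :=
    (contDiffAt_const.mul (hdet.sqrt hpos.ne')).congr_of_eventuallyEq hv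
  have hN := contDiffAt_normalCoord g b hzt
  have hp := affineCovector_normalCoord_pos g b hzt
  have h2 := (((contDiff_affineCovector b).contDiffAt (x := z)).clm_apply hN).sqrt hp.ne'
  have h3 := h2.inv (Real.sqrt_pos.2 hp).ne'
  have h4 := (contDiffAt_inverse (contDiffAt_metricCoord g hzt)
    (isInvertible_metricCoord g hzt)).comp z (contDiffAt_fst (F := Fin 2 → ℝ))
  exact h4.clm_comp ((h3.mul h1).smul (contDiff_crossForm.contDiffAt.comp z hN))

/-- A conformal structure has a local model in the affine charts centred at a point. -/
theorem exists_isLocalModel (o : ManifoldOrientation M) (g : Metric M) (x₀ : M)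
    (b : Module.Basis (Fin 3) ℝ E3) :
    ∃ V : Set E3, chartAt E3 x₀ x₀ ∈ V ∧ IsLocalModel b (metricCoord g x₀) (christoffelCoord g x₀)
      (turnCoord o g x₀ b) (V ×ˢ Set.univ) := by
  obtain ⟨V, hV, hx, hVt, h⟩ := exists_contDiffAt_turnCoord o g x₀
  refine ⟨V, hx, hV.prod isOpen_univ, fun z hz => contDiffAt_metricCoord g (hVt hz.1),
    fun z hz => contDiffAt_christoffelCoord g (hVt hz.1),
    fun z hz => (h b z hz.1).contDiffWithinAt,
    fun z hz => christoffelCoord_symm g (hVt hz.1),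
    fun z hz => christoffelCoord_compat g (hVt hz.1),
    fun z hz => isRotation_turnCoord o g b (hVt hz.1)⟩

end

/-! ### The cotangent bundle -/

section

variable {M : Type*} [TopologicalSpace M] [ChartedSpace E3 M] [IsManifold (𝓡 3) ∞ M]

theorem symmL_trivializationAt_eq_frame {x₀ x : M} (h : x ∈ (chartAt E3 x₀).source) (v : E3) :
    (trivializationAt E3 (fun x : M => TangentSpace (𝓡 3) x) x₀).symmL ℝ x v = frame x₀ x v := by
  have hb : x ∈ (trivializationAt E3 (fun x : M => TangentSpace (𝓡 3) x) x₀).baseSet := by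
    simpa using h
  refine ((trivializationAt E3 (fun x : M => TangentSpace (𝓡 3) x) x₀).continuousLinearEquivAt
      ℝ x hb).injective ?_
  have h1 := (trivializationAt E3
    (fun x : M => TangentSpace (𝓡 3) x) x₀).continuousLinearMapAt_symmL (R := ℝ) hb v
  have h2 : coframe x₀ x (frame x₀ x v) = v := coframe_frame_self h v
  refine Eq.trans ?_ h2.symm
  refine Eq.trans ?_ h1
  simp [Trivialization.coe_linearMapAt_of_mem _ hb]

theorem extChartAt_cotangent_fst (p q : CotangentBundle M) :
    (extChartAt IT p q).1 = chartAt E3 p.1 q.1 := rfl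

theorem extChartAt_cotangent_snd (p : CotangentBundle M) {q : CotangentBundle M}
    (h : q.1 ∈ (chartAt E3 p.1).source) (v : E3) :
    (extChartAt IT p q).2 v = q.2 (frame p.1 q.1 v) := by
  have h1 := hom_trivializationAt_apply (σ := RingHom.id ℝ) (F₁ := E3)
    (E₁ := fun x : M => TangentSpace (𝓡 3) x) (F₂ := ℝ) (E₂ := fun _ : M => ℝ) p.1 q
  have h2 : (extChartAt IT p q).2 =
      (trivializationAt (E3 →L[ℝ] ℝ) (fun x : M => CotangentSpace x) p.1 q).2 := by
    simp [mfld_simps, extChartAt, FiberBundle.chartedSpace_chartAt]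
  have h4 : (trivializationAt (E3 →L[ℝ] ℝ) (fun x : M => CotangentSpace x) p.1 q).2 v =
      (trivializationAt ℝ (fun _ : M => ℝ) p.1).continuousLinearMapAt ℝ q.1
        (q.2 ((trivializationAt E3 (fun x : M => TangentSpace (𝓡 3) x) p.1).symmL ℝ q.1 v)) :=
    congrArg (fun t : M × (E3 →L[ℝ] ℝ) => t.2 v) h1
  rw [h2, h4, symmL_trivializationAt_eq_frame h]
  simp

theorem mdifferentiableAt_cotangent_proj (p : CotangentBundle M) :
    MDifferentiableAt IT (𝓡 3) (fun q : CotangentBundle M => q.1) p :=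
  ((contMDiff_proj (n := ∞) (IB := 𝓡 3) (F := E3 →L[ℝ] ℝ)
    (fun x : M => CotangentSpace x)).contMDiffAt).mdifferentiableAt (by simp)

theorem eventually_cotangent_proj_mem (p : CotangentBundle M) {U : Set M} (hU : U ∈ 𝓝 p.1) :
    ∀ᶠ q : CotangentBundle M in 𝓝 p, q.1 ∈ U :=
  (mdifferentiableAt_cotangent_proj p).continuousAt hU

/-- The derivative at `p` of the preferred chart of `T^*M` at `p`. -/
def cotChartDeriv (p : CotangentBundle M) : TangentSpace IT p →L[ℝ] E3 × (E3 →L[ℝ] ℝ) :=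
  (mfderiv IT 𝓘(ℝ, E3 × (E3 →L[ℝ] ℝ)) (extChartAt IT p) p :
    E3 × (E3 →L[ℝ] ℝ) →L[ℝ] E3 × (E3 →L[ℝ] ℝ))

theorem hasMFDerivAt_cotChart (p : CotangentBundle M) :
    HasMFDerivAt IT 𝓘(ℝ, E3 × (E3 →L[ℝ] ℝ)) (extChartAt IT p) p (cotChartDeriv p) :=
  (mdifferentiableAt_extChartAt (mem_chart_source _ p)).hasMFDerivAt

theorem cotChartDeriv_surjective (p : CotangentBundle M) :
    Function.Surjective (cotChartDeriv p) := by
  have h : (mfderiv IT 𝓘(ℝ, E3 × (E3 →L[ℝ] ℝ)) (extChartAt IT p) p).IsInvertible :=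
    isInvertible_mfderiv_extChartAt (mem_extChartAt_source p)
  obtain ⟨e, he⟩ := h
  intro w
  exact ⟨e.symm w, (congrArg (fun f => f (e.symm w)) he).symm.trans (e.apply_symm_apply w)⟩

theorem cotChartDeriv_fst (p : CotangentBundle M) (ξ : TangentSpace IT p) :
    (cotChartDeriv p ξ).1 =
      coframe p.1 p.1 (mfderiv IT (𝓡 3) (fun q : CotangentBundle M => q.1) p ξ) := by
  have h1 : HasMFDerivAt IT 𝓘(ℝ, E3) (fun q : CotangentBundle M => (extChartAt IT p q).1) p
      ((ContinuousLinearMap.fst ℝ E3 (E3 →L[ℝ] ℝ)).comp (cotChartDeriv p)) :=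
    ((ContinuousLinearMap.fst ℝ E3 (E3 →L[ℝ] ℝ)).hasFDerivAt.hasMFDerivAt).comp p
      (hasMFDerivAt_cotChart p)
  have hx := mem_chart_source E3 p.1
  have h2 := (mdifferentiableAt_atlas (I := 𝓡 3) (chart_mem_atlas E3 p.1) hx).hasMFDerivAt.comp p
    (mdifferentiableAt_cotangent_proj p).hasMFDerivAt
  have h3 := DFunLike.congr_fun (hasMFDerivAt_unique h1 h2) ξ
  refine h3.trans ?_
  exact congrArg (fun f : E3 →L[ℝ] E3 =>
    f (mfderiv IT (𝓡 3) (fun q : CotangentBundle M => q.1) p ξ)) (mfderiv_chartAt hx)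

/-- The derivative of the evaluation on a vector field, in the preferred chart at `p`. -/
theorem hasMFDerivAt_evaluation (p : CotangentBundle M) {Y : ∀ y : M, TangentSpace (𝓡 3) y}
    (hY : FieldDifferentiableAt Y p.1) :
    ∃ f' : TangentSpace IT p →L[ℝ] ℝ,
      HasMFDerivAt IT 𝓘(ℝ, ℝ) (fun q : CotangentBundle M => q.2 (Y q.1)) p f' ∧
      ∀ ξ, f' ξ = (cotChartDeriv p ξ).2 (coframe p.1 p.1 (Y p.1)) + p.2 (frame p.1 p.1
        (fderiv ℝ (fieldCoord (E := E3) p.1 Y) (chartAt E3 p.1 p.1) (cotChartDeriv p ξ).1)) := by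
  have hx := mem_chart_source E3 p.1
  have hY' := ((mdifferentiableAt_field_iff hx Y).1 hY).hasFDerivAt
  have h1 : HasFDerivAt (fun w : E3 × (E3 →L[ℝ] ℝ) => w.2 (fieldCoord (E := E3) p.1 Y w.1)) _
      (extChartAt IT p p) :=
    (hasFDerivAt_snd (𝕜 := ℝ) (p := extChartAt IT p p)).clm_apply
      (HasFDerivAt.comp (extChartAt IT p p) (f := Prod.fst) hY' hasFDerivAt_fst)
  have h2 := (h1.hasMFDerivAt).comp p (hasMFDerivAt_cotChart p)
  refine ⟨_, h2.congr_of_eventuallyEq ?_, fun ξ => ?_⟩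
  · filter_upwards [eventually_cotangent_proj_mem p
      ((chartAt E3 p.1).open_source.mem_nhds hx)] with q hq
    rw [Function.comp_apply, extChartAt_cotangent_snd p hq, extChartAt_cotangent_fst,
      fieldCoord_chartAt hq]
    exact congrArg q.2 (frame_coframe hq (Y q.1)).symm
  · have e1 : ∀ v, (extChartAt IT p p).2 v = p.2 (frame p.1 p.1 v) := fun v =>
      extChartAt_cotangent_snd p hx v
    have e2 : fieldCoord (E := E3) p.1 Y (extChartAt IT p p).1 = coframe p.1 p.1 (Y p.1) :=
      fieldCoord_chartAt hx Y
    rw [← e1, ← e2, add_comm]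
    rfl

theorem mvfderiv_evaluation (p : CotangentBundle M) {Y : ∀ y : M, TangentSpace (𝓡 3) y}
    (hY : FieldDifferentiableAt Y p.1) (ξ : TangentSpace IT p) :
    mvfderiv IT (fun q : CotangentBundle M => q.2 (Y q.1)) p ξ =
      (cotChartDeriv p ξ).2 (coframe p.1 p.1 (Y p.1)) + p.2 (frame p.1 p.1
        (fderiv ℝ (fieldCoord (E := E3) p.1 Y) (chartAt E3 p.1 p.1) (cotChartDeriv p ξ).1)) := by
  obtain ⟨f', h1, h2⟩ := hasMFDerivAt_evaluation p hY
  rw [← h2]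
  exact DFunLike.congr_fun h1.mfderiv ξ

theorem mdifferentiableAt_evaluation (p : CotangentBundle M) {Y : ∀ y : M, TangentSpace (𝓡 3) y}
    (hY : FieldDifferentiableAt Y p.1) :
    MDifferentiableAt IT 𝓘(ℝ, ℝ) (fun q : CotangentBundle M => q.2 (Y q.1)) p := by
  obtain ⟨f', h1, -⟩ := hasMFDerivAt_evaluation p hY
  exact h1.mdifferentiableAt

/-- Every pair of components is realised by a tangent vector of `T^*M`. -/
theorem exists_hasComponents {g : Metric M} {D : Connection M} (hD : IsLeviCivita g D)
    (p : CotangentBundle M) (X : TangentSpace (𝓡 3) p.1) (η : CotangentSpace p.1) :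
    ∃ ξ : TangentSpace IT p, HasComponents D p ξ X η := by
  have hx := mem_chart_source E3 p.1
  set w : E3 →L[ℝ] ℝ := (η.comp (frame p.1 p.1) + p.2.comp ((frame p.1 p.1).comp
    (christoffelCoord g p.1 (chartAt E3 p.1 p.1) (coframe p.1 p.1 X)))) with hw
  obtain ⟨ξ, hξ⟩ := cotChartDeriv_surjective p (coframe p.1 p.1 X, w)
  refine ⟨ξ, coframe_injective hx ?_, fun Y hY => ?_⟩
  · rw [← cotChartDeriv_fst, hξ]
  · have h1 := hD.coframe_apply hx hY X
    have h2 : p.2 (D Y p.1 X) = p.2 (frame p.1 p.1 (coframe p.1 p.1 (D Y p.1 X))) := by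
      rw [frame_coframe hx]
    have h3 : w (coframe p.1 p.1 (Y p.1)) = η (Y p.1) + p.2 (frame p.1 p.1
        (christoffelCoord g p.1 (chartAt E3 p.1 p.1) (coframe p.1 p.1 X)
          (coframe p.1 p.1 (Y p.1)))) := by
      have : w (coframe p.1 p.1 (Y p.1)) = η (frame p.1 p.1 (coframe p.1 p.1 (Y p.1))) + _ := rfl
      rw [frame_coframe hx] at this
      exact this
    rw [mvfderiv_evaluation p hY, hξ, h2, h1, map_add, map_add, h3]
    ring

/-! ### The quotient map to the configuration space -/

/-- The basis of `ℝ³` by which the preferred chart at `y` is defined. -/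
def configBasis (y : ConfigurationSpace M) : Module.Basis (Fin 3) ℝ E3 :=
  (exists_configChart y).choose

theorem mem_config_chartAt_source {y c : ConfigurationSpace M} :
    c ∈ (chartAt E5 y).source ↔ c.proj ∈ (chartAt E3 y.proj).source ∧
      0 < covector c (frame y.proj c.proj (configBasis y 0)) := Iff.rfl

theorem config_chartAt_snd (y c : ConfigurationSpace M) (j : Fin 2) :
    (chartAt E5 y c).2 j = covector c (frame y.proj c.proj (configBasis y j.succ)) /
      covector c (frame y.proj c.proj (configBasis y 0)) := rfl

theorem mem_config_chartAt_target {y : ConfigurationSpace M} {z : E5} :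
    z ∈ (chartAt E5 y).target ↔ z.1 ∈ (chartAt E3 y.proj).target := by
  change z.1 ∈ (chartAt E3 y.proj).target ∧ True ↔ _
  simp

theorem toConfig_mem_source_iff {y : ConfigurationSpace M} {p : CotangentBundle M} (hp : p.2 ≠ 0) :
    toConfig p ∈ (chartAt E5 y).source ↔ p.1 ∈ (chartAt E3 y.proj).source ∧
      0 < p.2 (frame y.proj p.1 (configBasis y 0)) := by
  obtain ⟨t, ht, h⟩ := covector_toConfig hp
  refine mem_config_chartAt_source.trans (and_congr_right' ?_)
  change 0 < covector (toConfig ⟨p.1, p.2⟩) _ ↔ _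
  rw [h]
  exact mul_pos_iff_of_pos_left ht

theorem config_chartAt_toConfig_snd (y : ConfigurationSpace M) {p : CotangentBundle M}
    (hp : p.2 ≠ 0) (j : Fin 2) :
    (chartAt E5 y (toConfig p)).2 j = p.2 (frame y.proj p.1 (configBasis y j.succ)) /
      p.2 (frame y.proj p.1 (configBasis y 0)) := by
  obtain ⟨t, ht, h⟩ := covector_toConfig hp
  rw [config_chartAt_snd]
  change covector (toConfig ⟨p.1, p.2⟩) _ / covector (toConfig ⟨p.1, p.2⟩) _ = _
  rw [h]
  exact mul_div_mul_left _ _ ht.ne'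

/-- A covector is a multiple of the affine covector of its class. -/
theorem apply_frame_eq {y : ConfigurationSpace M} {p : CotangentBundle M} (hp : p.2 ≠ 0)
    (h : toConfig p ∈ (chartAt E5 y).source) (v : E3) :
    p.2 (frame y.proj p.1 v) = p.2 (frame y.proj p.1 (configBasis y 0)) *
      affineCovector (configBasis y) (chartAt E5 y (toConfig p)).2 v := by
  have h0 := ((toConfig_mem_source_iff hp).1 h).2
  have key : p.2.comp (frame y.proj p.1) = p.2 (frame y.proj p.1 (configBasis y 0)) •
      affineCovector (configBasis y) (chartAt E5 y (toConfig p)).2 := by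
    apply ContinuousLinearMap.coe_injective
    refine (configBasis y).ext fun i => ?_
    refine Fin.cases ?_ (fun j => ?_) i
    · change p.2 (frame y.proj p.1 (configBasis y 0)) = _ * affineCovector _ _ _
      rw [affineCovector_zero, mul_one]
    · change p.2 (frame y.proj p.1 (configBasis y j.succ)) = _ * affineCovector _ _ _
      rw [affineCovector_succ, config_chartAt_toConfig_snd y hp, mul_div_cancel₀ _ h0.ne']
  exact DFunLike.congr_fun key v

theorem fieldDifferentiableAt_const {x₀ x : M} (h : x ∈ (chartAt E3 x₀).source) (v : E3) :
    FieldDifferentiableAt (fun x : M => frame x₀ x v) x :=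
  fieldDifferentiableAt_coordField h (f := fun _ => v) (differentiableAt_const v)

theorem eventually_toConfig_mem_source {y : ConfigurationSpace M} {p : CotangentBundle M}
    (hp : p.2 ≠ 0) (h : toConfig p ∈ (chartAt E5 y).source) :
    ∀ᶠ q : CotangentBundle M in 𝓝 p, q.2 ≠ 0 ∧ toConfig q ∈ (chartAt E5 y).source := by
  obtain ⟨h1, h2⟩ := (toConfig_mem_source_iff hp).1 h
  have hc := (mdifferentiableAt_evaluation p
    (fieldDifferentiableAt_const h1 (configBasis y 0))).continuousAt
  filter_upwards [hc.preimage_mem_nhds (Ioi_mem_nhds h2), eventually_cotangent_proj_mem p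
    ((chartAt E3 y.proj).open_source.mem_nhds h1)] with q hq hq'
  change 0 < q.2 (frame y.proj q.1 (configBasis y 0)) at hq
  have hq0 : q.2 ≠ 0 := fun h0 => by
    rw [h0] at hq
    exact lt_irrefl _ hq
  exact ⟨hq0, (toConfig_mem_source_iff hq0).2 ⟨hq', hq⟩⟩

theorem mdifferentiableAt_chart_toConfig {y : ConfigurationSpace M} {p : CotangentBundle M}
    (hp : p.2 ≠ 0) (h : toConfig p ∈ (chartAt E5 y).source) :
    MDifferentiableAt IT 𝓘(ℝ, E5) (fun q => chartAt E5 y (toConfig q)) p := by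
  obtain ⟨h1, h2⟩ := (toConfig_mem_source_iff hp).1 h
  have hf := fun v => mdifferentiableAt_evaluation p (fieldDifferentiableAt_const h1 v)
  have hfst : MDifferentiableAt IT 𝓘(ℝ, E3)
      (fun q : CotangentBundle M => chartAt E3 y.proj q.1) p :=
    (mdifferentiableAt_atlas (I := 𝓡 3) (chart_mem_atlas E3 y.proj) h1).comp p
      (mdifferentiableAt_cotangent_proj p)
  have hsnd : ∀ j : Fin 2, MDifferentiableAt IT 𝓘(ℝ, ℝ) (fun q : CotangentBundle M =>
      q.2 (frame y.proj q.1 (configBasis y j.succ)) /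
        q.2 (frame y.proj q.1 (configBasis y 0))) p := fun j => by
    have hd : DifferentiableAt ℝ (fun w : ℝ × ℝ => w.1 / w.2)
        (p.2 (frame y.proj p.1 (configBasis y j.succ)),
          p.2 (frame y.proj p.1 (configBasis y 0))) :=
      (contDiffAt_fst.div contDiffAt_snd h2.ne' :
        ContDiffAt ℝ 1 (fun w : ℝ × ℝ => w.1 / w.2) _).differentiableAt one_ne_zero
    exact hd.mdifferentiableAt.comp p ((hf _).prodMk_space (hf _))
  have hpi : MDifferentiableAt IT 𝓘(ℝ, Fin 2 → ℝ) (fun (q : CotangentBundle M) (j : Fin 2) =>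
      q.2 (frame y.proj q.1 (configBasis y j.succ)) /
        q.2 (frame y.proj q.1 (configBasis y 0))) p := by
    have hd : Differentiable ℝ (fun (w : ℝ × ℝ) => (![w.1, w.2] : Fin 2 → ℝ)) :=
      differentiable_pi.2 fun j => by
        fin_cases j
        · exact differentiable_fst
        · exact differentiable_snd
    refine ((hd _).mdifferentiableAt.comp p ((hsnd 0).prodMk_space (hsnd 1))).congr_of_eventuallyEq
      (Filter.Eventually.of_forall fun q => funext fun j => ?_)
    fin_cases j <;> rfl
  refine (hfst.prodMk_space hpi).congr_of_eventuallyEq ?_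
  filter_upwards [eventually_toConfig_mem_source hp h] with q hq
  exact Prod.ext rfl (funext fun j => config_chartAt_toConfig_snd y hq.1 j)

theorem mdifferentiableAt_toConfig {p : CotangentBundle M} (hp : p.2 ≠ 0) :
    MDifferentiableAt IT IC toConfig p := by
  have h := mem_chart_source E5 (toConfig p)
  have h1 := (mdifferentiableAt_atlas_symm (I := IC) (chart_mem_atlas E5 (toConfig p))
    ((chartAt E5 (toConfig p)).map_source h)).comp p (mdifferentiableAt_chart_toConfig hp h)
  refine h1.congr_of_eventuallyEq ?_
  filter_upwards [eventually_toConfig_mem_source hp h] with q hq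
  exact ((chartAt E5 (toConfig p)).left_inv hq.2).symm

theorem chartDeriv_mfderiv_toConfig {y : ConfigurationSpace M} {p : CotangentBundle M}
    (hp : p.2 ≠ 0) (h : toConfig p ∈ (chartAt E5 y).source) (ξ : TangentSpace IT p) :
    chartDeriv (E := E5) y (toConfig p) (mfderiv IT IC toConfig p ξ) =
      mvfderiv IT (fun q => chartAt E5 y (toConfig q)) p ξ := by
  have h1 := mfderiv_comp_apply p (mdifferentiableAt_atlas (I := IC) (chart_mem_atlas E5 y) h)
    (mdifferentiableAt_toConfig hp) ξ
  rw [mfderiv_chartAt h] at h1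
  exact h1.symm

theorem chartDeriv_mfderiv_toConfig_fst {y : ConfigurationSpace M} {p : CotangentBundle M}
    (hp : p.2 ≠ 0) (h : toConfig p ∈ (chartAt E5 y).source) (ξ : TangentSpace IT p) :
    (chartDeriv (E := E5) y (toConfig p) (mfderiv IT IC toConfig p ξ)).1 =
      coframe y.proj p.1 (mfderiv IT (𝓡 3) (fun q : CotangentBundle M => q.1) p ξ) := by
  have h0 := ((toConfig_mem_source_iff hp).1 h).1
  have h1 : HasMFDerivAt IT 𝓘(ℝ, E3) (fun q : CotangentBundle M => (chartAt E5 y (toConfig q)).1) p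
      ((ContinuousLinearMap.fst ℝ E3 (Fin 2 → ℝ)).comp
        (mvfderiv IT (fun q => chartAt E5 y (toConfig q)) p)) :=
    ((ContinuousLinearMap.fst ℝ E3 (Fin 2 → ℝ)).hasFDerivAt.hasMFDerivAt).comp p
      (mdifferentiableAt_chart_toConfig hp h).hasMFDerivAt
  have h2 := (mdifferentiableAt_atlas (I := 𝓡 3) (chart_mem_atlas E3 y.proj) h0).hasMFDerivAt.comp p
    (mdifferentiableAt_cotangent_proj p).hasMFDerivAt
  have h3 := DFunLike.congr_fun (hasMFDerivAt_unique h1 h2) ξ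
  rw [chartDeriv_mfderiv_toConfig hp h]
  refine h3.trans ?_
  exact congrArg (fun f : E3 →L[ℝ] E3 =>
    f (mfderiv IT (𝓡 3) (fun q : CotangentBundle M => q.1) p ξ)) (mfderiv_chartAt h0)

/-- The derivative of the affine coordinate `yⱼ = p(bⱼ₊₁) / p(b₀)`, written as the Leibniz rule for
`p(bⱼ₊₁) = yⱼ p(b₀)`. -/
theorem chartDeriv_mfderiv_toConfig_snd {y : ConfigurationSpace M} {p : CotangentBundle M}
    (hp : p.2 ≠ 0) (h : toConfig p ∈ (chartAt E5 y).source) (ξ : TangentSpace IT p) (j : Fin 2) :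
    mvfderiv IT (fun q : CotangentBundle M => q.2 (frame y.proj q.1 (configBasis y j.succ))) p ξ =
      (chartAt E5 y (toConfig p)).2 j *
        mvfderiv IT (fun q : CotangentBundle M => q.2 (frame y.proj q.1 (configBasis y 0))) p ξ +
      p.2 (frame y.proj p.1 (configBasis y 0)) *
        (chartDeriv (E := E5) y (toConfig p) (mfderiv IT IC toConfig p ξ)).2 j := by
  obtain ⟨h0, -⟩ := (toConfig_mem_source_iff hp).1 h
  have h1 : HasMFDerivAt IT 𝓘(ℝ, ℝ)
      (fun q : CotangentBundle M => (chartAt E5 y (toConfig q)).2 j) p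
      (((ContinuousLinearMap.proj j : (Fin 2 → ℝ) →L[ℝ] ℝ).comp
        (ContinuousLinearMap.snd ℝ E3 (Fin 2 → ℝ))).comp
        (mvfderiv IT (fun q => chartAt E5 y (toConfig q)) p)) :=
    (((ContinuousLinearMap.proj j : (Fin 2 → ℝ) →L[ℝ] ℝ).comp
        (ContinuousLinearMap.snd ℝ E3 (Fin 2 → ℝ))).hasFDerivAt.hasMFDerivAt).comp p
      (mdifferentiableAt_chart_toConfig hp h).hasMFDerivAt
  have h2 := (mdifferentiableAt_evaluation p
    (fieldDifferentiableAt_const h0 (configBasis y 0))).hasMFDerivAt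
  have h3 := h1.mul h2
  have h4 : (fun q : CotangentBundle M => q.2 (frame y.proj q.1 (configBasis y j.succ))) =ᶠ[𝓝 p]
      (fun q : CotangentBundle M => (chartAt E5 y (toConfig q)).2 j) *
        fun q : CotangentBundle M => q.2 (frame y.proj q.1 (configBasis y 0)) := by
    filter_upwards [eventually_toConfig_mem_source hp h] with q hq
    rw [Pi.mul_apply, config_chartAt_toConfig_snd y hq.1,
      div_mul_cancel₀ _ ((toConfig_mem_source_iff hq.1).1 hq.2).2.ne']
  have h5 := DFunLike.congr_fun (h3.congr_of_eventuallyEq h4).mfderiv ξ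
  rw [chartDeriv_mfderiv_toConfig hp h]
  exact h5

end

/-! ### The complex structure in affine charts -/

section

variable {b : Module.Basis (Fin 3) ℝ E3} {G : E3 → E3 →L[ℝ] E3 →L[ℝ] ℝ}
  {Γ Γ' : E3 → E3 →L[ℝ] E3 →L[ℝ] E3} {R : E5 → E3 →L[ℝ] E3}

/-- A change of the Christoffel symbols which on the plane `ker p` is a multiple of the metric,
transversally to this plane, does not change the complex structure. -/
theorem JRel.congr_christoffel {B : E3 →L[ℝ] E3 →L[ℝ] ℝ} {z v w : E5} (h : JRel b Γ R z v w)
    (hR : IsRotation B (affineCovector b z.2) (R z)) (hv : affineCovector b z.2 v.1 = 0) {c : ℝ}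
    (hΓ : ∀ X U, affineCovector b z.2 X = 0 → affineCovector b z.2 U = 0 →
      affineCovector b z.2 (Γ' z.1 X U) = affineCovector b z.2 (Γ z.1 X U) - c * B X U) :
    JRel b Γ' R z v w := by
  refine ⟨h.1, fun U hU => ?_⟩
  have h1 := h.2 U hU
  have hw : affineCovector b z.2 w.1 = 0 := by rw [h.1, hR.comp]
  rw [connForm_apply, connForm_apply] at h1 ⊢
  rw [hΓ _ _ hw hU, hΓ _ _ hv (hR.comp U)]
  have h2 := hR.skew v.1 U
  rw [← h.1] at h2
  linear_combination h1 + c * h2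

/-- The Christoffel symbols of a conformally related metric. -/
theorem christoffel_conformal {G' : E3 → E3 →L[ℝ] E3 →L[ℝ] ℝ} {a : E3} {f : E3 → ℝ}
    (hf : DifferentiableAt ℝ f a) (hf0 : f a ≠ 0) (hG : DifferentiableAt ℝ G a)
    (hi : (G a).IsInvertible) (hi' : (G' a).IsInvertible)
    (hs : ∀ᶠ x in 𝓝 a, ∀ Y Z, G x Y Z = G x Z Y)
    (hG' : ∀ᶠ x in 𝓝 a, ∀ Y Z, G' x Y Z = f x ^ 2 * G x Y Z) :
    ∃ (υ : E3 →L[ℝ] ℝ) (N : E3), ∀ X Y, christoffel G' a X Y =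
      christoffel G a X Y + υ X • Y + υ Y • X - G a X Y • N := by
  -- `υ` is the logarithmic derivative of `f`, and `e.symm υ` is `υ` with its index raised.
  set υ : E3 →L[ℝ] ℝ := (f a)⁻¹ • fderiv ℝ f a with hυ
  obtain ⟨e, he⟩ := id hi
  have hN : ∀ U, G a (e.symm υ) U = υ U := fun U => by
    rw [← he]
    exact DFunLike.congr_fun (e.apply_symm_apply υ) U
  have hN' : ∀ U, G a U (e.symm υ) = υ U := fun U => by rw [hs.self_of_nhds, hN]
  have hfυ : ∀ X, fderiv ℝ f a X = f a * υ X := fun X => by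
    rw [hυ, _root_.smul_apply, smul_eq_mul, mul_inv_cancel_left₀ hf0]
  have hev : G' =ᶠ[𝓝 a] fun x => f x ^ 2 • G x := hG'.mono fun x hx =>
    ContinuousLinearMap.ext fun Y => ContinuousLinearMap.ext fun Z => hx Y Z
  have hD : ∀ X Y Z, fderiv ℝ G' a X Y Z =
      f a ^ 2 * (2 * υ X * G a Y Z + G a (christoffel G a X Y) Z +
        G a Y (christoffel G a X Z)) := fun X Y Z => by
    have h1 := ((hf.hasFDerivAt.pow 2).smul hG.hasFDerivAt).fderiv
    rw [hev.fderiv_eq]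
    refine (congrArg (fun F : E3 →L[ℝ] E3 →L[ℝ] E3 →L[ℝ] ℝ => F X Y Z) h1).trans ?_
    change f a ^ 2 * fderiv ℝ G a X Y Z + ((2 • f a ^ (2 - 1)) • fderiv ℝ f a) X * G a Y Z = _
    rw [christoffel_compat hG hi hs, _root_.smul_apply, hfυ]
    simp
    ring
  have hsa := hs.self_of_nhds
  have hG'a := hG'.self_of_nhds
  refine ⟨υ, e.symm υ, fun X Y => ?_⟩
  refine (eq_christoffel hi' (fun Y Z => by rw [hG'a, hG'a, hsa]) (X := X) (Y := Y)
    (e := christoffel G a X Y + υ X • Y + υ Y • X - G a X Y • e.symm υ)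
    (fun Z => christoffel G a X Z + υ X • Z + υ Z • X - G a X Z • e.symm υ)
    (fun Z => christoffel G a Y Z + υ Y • Z + υ Z • Y - G a Y Z • e.symm υ) ?_ ?_ ?_).symm
  · intro Z
    rw [hD, hG'a, hG'a]
    simp only [map_add, map_sub, map_smul, _root_.add_apply, _root_.sub_apply, _root_.smul_apply,
      smul_eq_mul, hN, hN']
    rw [hsa Y X]
    ring
  · intro Z
    rw [hD, hG'a, hG'a, christoffel_symm hG hi hs Y X]
    simp only [map_add, map_sub, map_smul, _root_.add_apply, _root_.sub_apply, _root_.smul_apply,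
      smul_eq_mul, hN, hN']
    ring
  · intro Z
    rw [hD, hG'a, hG'a, christoffel_symm hG hi hs Z X, christoffel_symm hG hi hs Z Y]
    simp only [map_add, map_sub, map_smul, _root_.add_apply, _root_.sub_apply, _root_.smul_apply,
      smul_eq_mul, hN, hN']
    rw [hsa Z Y]
    ring

end

section

variable {M : Type*} [TopologicalSpace M] [ChartedSpace E3 M] [IsManifold (𝓡 3) ∞ M]

/-- The complex structure defined by `g`, on tangent vectors at `c` written in the preferred chart
at `y`. -/
def localJAt (o : ManifoldOrientation M) (g : Metric M) (y c : ConfigurationSpace M) (v : E5) :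
    E5 :=
  localJ (configBasis y) (christoffelCoord g y.proj) (turnCoord o g y.proj (configBasis y))
    (chartAt E5 y c) v

/-- The covariant part of the image in `TC` of a tangent vector of `T^*M` with components `(X, η)`:
on the plane it is `η`, up to the factor by which `p` differs from the affine covector. -/
theorem connForm_chartDeriv_toConfig {g : Metric M} {D : Connection M} (hD : IsLeviCivita g D)
    {y : ConfigurationSpace M} {p : CotangentBundle M} (hp : p.2 ≠ 0)
    (h : toConfig p ∈ (chartAt E5 y).source) {ξ : TangentSpace IT p} {X : TangentSpace (𝓡 3) p.1}
    {η : CotangentSpace p.1} (hξ : HasComponents D p ξ X η) {U : E3}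
    (hU : affineCovector (configBasis y) (chartAt E5 y (toConfig p)).2 U = 0) :
    p.2 (frame y.proj p.1 (configBasis y 0)) *
      connForm (configBasis y) (christoffelCoord g y.proj) (chartAt E5 y (toConfig p))
        (chartDeriv (E := E5) y (toConfig p) (mfderiv IT IC toConfig p ξ)) U =
      η (frame y.proj p.1 U) := by
  set s := p.2 (frame y.proj p.1 (configBasis y 0)) with hs
  set z := chartAt E5 y (toConfig p) with hz
  set v := chartDeriv (E := E5) y (toConfig p) (mfderiv IT IC toConfig p ξ) with hv
  obtain ⟨h0, -⟩ := (toConfig_mem_source_iff hp).1 h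
  have hv1 : v.1 = coframe y.proj p.1 X := by
    rw [hv, chartDeriv_mfderiv_toConfig_fst hp h, hξ.1]
  have hd : ∀ u : E3, mvfderiv IT (fun q : CotangentBundle M => q.2 (frame y.proj q.1 u)) p ξ =
      η (frame y.proj p.1 u) + s * affineCovector (configBasis y) z.2
        (christoffelCoord g y.proj z.1 v.1 u) := fun u => by
    have hY := fieldDifferentiableAt_const h0 u
    have h1 := hξ.2 _ hY
    have h2 := hD.coframe_apply h0 hY X
    have h3 : fderiv ℝ (fieldCoord (E := E3) y.proj fun x : M => frame y.proj x u)
        (chartAt E3 y.proj p.1) = 0 := by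
      refine ((fieldCoord_coordField_eventuallyEq h0 fun _ => u).fderiv_eq).trans ?_
      rw [fderiv_fun_const]; rfl
    rw [h3, coframe_frame_self h0, _root_.zero_apply, zero_add] at h2
    have h4 := apply_frame_eq hp h (coframe y.proj p.1 (D (fun x : M => frame y.proj x u) p.1 X))
    rw [frame_coframe h0, h2] at h4
    rw [hv1, hs]
    refine (eq_add_of_sub_eq h1.symm).trans (congrArg _ h4)
  refine eq_of_eqOn_kernel (z := z) (f := s • connForm (configBasis y)
    (christoffelCoord g y.proj) z v) (f' := η.comp (frame y.proj p.1)) (fun j => ?_) hU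
  have h1 := chartDeriv_mfderiv_toConfig_snd hp h ξ j
  rw [hd, hd] at h1
  change s * connForm _ _ z v _ = η (frame y.proj p.1 _)
  rw [connForm_apply, fiberCovector_kernelVector, kernelVector]
  simp only [map_sub, map_smul, smul_eq_mul]
  change _ = η (frame y.proj p.1 _) - z.2 j * η (frame y.proj p.1 _)
  change _ = z.2 j * _ + s * v.2 j at h1
  linear_combination -h1

/-- The formula for the complex structure on `T^*M` agrees with the one in affine charts. -/
theorem chartDeriv_toConfig_of_hasComponents {o : ManifoldOrientation M} {g : Metric M}
    {D : Connection M} (hD : IsLeviCivita g D) {y : ConfigurationSpace M}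
    {p : CotangentBundle M} (hp : p.2 ≠ 0)
    (h : toConfig p ∈ (chartAt E5 y).source) {ξ ξ' : TangentSpace IT p}
    {X : TangentSpace (𝓡 3) p.1} {η : CotangentSpace p.1} (hξ : HasComponents D p ξ X η)
    (hξ' : HasComponents D p ξ' (turnVector o g p.2 X) (turn o g p.2 η)) :
    chartDeriv (E := E5) y (toConfig p) (mfderiv IT IC toConfig p ξ') =
      localJAt o g y (toConfig p)
        (chartDeriv (E := E5) y (toConfig p) (mfderiv IT IC toConfig p ξ)) := by
  obtain ⟨h0, hs⟩ := (toConfig_mem_source_iff hp).1 h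
  have hT := fun X => coframe_turnVector o g (configBasis y) h0 hs (apply_frame_eq hp h) X
  have hz := mem_config_chartAt_target.1 ((chartAt E5 y).map_source h)
  refine jRel_iff.1 ⟨?_, fun U hU => ?_⟩
  · rw [chartDeriv_mfderiv_toConfig_fst hp h, chartDeriv_mfderiv_toConfig_fst hp h, hξ.1, hξ'.1]
    exact hT X
  · refine mul_left_cancel₀ hs.ne' ?_
    rw [connForm_chartDeriv_toConfig hD hp h hξ' hU, mul_neg,
      connForm_chartDeriv_toConfig hD hp h hξ ((isRotation_turnCoord o g _ hz).comp U),
      turn_eq_neg_comp]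
    have h1 := hT (frame y.proj p.1 U)
    rw [coframe_frame_self h0] at h1
    have h2 : frame y.proj p.1 (turnCoord o g y.proj (configBasis y) (chartAt E5 y (toConfig p)) U)
        = turnVector o g p.2 (frame y.proj p.1 U) :=
      (congrArg (frame y.proj p.1) h1.symm).trans (frame_coframe h0 _)
    rw [h2]

/-! ### The contact distribution in affine charts -/

theorem mdifferentiableAt_config_proj (c : ConfigurationSpace M) :
    MDifferentiableAt IC (𝓡 3) ConfigurationSpace.proj c := by
  have h := mem_chart_source E5 c
  have h1 : MDifferentiableAt IC 𝓘(ℝ, E3) (fun c' => (chartAt E5 c c').1) c :=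
    (differentiableAt_fst (𝕜 := ℝ)).mdifferentiableAt.comp c
      (mdifferentiableAt_atlas (I := IC) (chart_mem_atlas E5 c) h)
  have h2 := (mdifferentiableAt_atlas_symm (I := 𝓡 3) (chart_mem_atlas E3 c.proj)
    ((chartAt E3 c.proj).map_source (mem_chart_source E3 c.proj))).comp c h1
  refine h2.congr_of_eventuallyEq ?_
  filter_upwards [(chartAt E5 c).open_source.mem_nhds h] with c' hc'
  exact ((chartAt E3 c.proj).left_inv (mem_config_chartAt_source.1 hc').1).symm

theorem coframe_mfderiv_proj {y c : ConfigurationSpace M} (h : c ∈ (chartAt E5 y).source)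
    (v : TangentSpace IC c) :
    coframe y.proj c.proj (mfderiv IC (𝓡 3) ConfigurationSpace.proj c v) =
      (chartDeriv (E := E5) y c v).1 := by
  have h0 := (mem_config_chartAt_source.1 h).1
  have h1 : HasMFDerivAt IC 𝓘(ℝ, E3) (fun c' => (chartAt E5 y c').1) c
      ((ContinuousLinearMap.fst ℝ E3 (Fin 2 → ℝ)).comp (mfderiv IC 𝓘(ℝ, E5) (chartAt E5 y) c)) :=
    ((ContinuousLinearMap.fst ℝ E3 (Fin 2 → ℝ)).hasFDerivAt.hasMFDerivAt).comp c
      (mdifferentiableAt_atlas (I := IC) (chart_mem_atlas E5 y) h).hasMFDerivAt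
  have h2 := (mdifferentiableAt_atlas (I := 𝓡 3) (chart_mem_atlas E3 y.proj) h0).hasMFDerivAt.comp c
    (mdifferentiableAt_config_proj c).hasMFDerivAt
  have h3 := DFunLike.congr_fun (hasMFDerivAt_unique h2 h1) v
  refine Eq.trans ?_ (h3.trans ?_)
  · exact congrArg (fun f : E3 →L[ℝ] E3 =>
      f (mfderiv IC (𝓡 3) ConfigurationSpace.proj c v)) (mfderiv_chartAt h0).symm
  · exact congrArg (fun f : E5 →L[ℝ] E5 => (f v).1) (mfderiv_chartAt h)

theorem covector_frame_eq {y c : ConfigurationSpace M} (h : c ∈ (chartAt E5 y).source) (v : E3) :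
    covector c (frame y.proj c.proj v) = covector c (frame y.proj c.proj (configBasis y 0)) *
      affineCovector (configBasis y) (chartAt E5 y c).2 v := by
  have h1 := apply_frame_eq (y := y) (p := ⟨c.proj, covector c⟩) (covector_ne_zero c)
    (by rwa [toConfig_covector]) v
  rwa [toConfig_covector] at h1

/-- The contact distribution is the kernel of the contact form `p ∘ dπ`. -/
theorem mem_contactDistribution_iff {y c : ConfigurationSpace M} (h : c ∈ (chartAt E5 y).source)
    (v : TangentSpace IC c) : v ∈ contactDistribution c ↔
      affineCovector (configBasis y) (chartAt E5 y c).2 (chartDeriv (E := E5) y c v).1 = 0 := by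
  obtain ⟨h0, hs⟩ := mem_config_chartAt_source.1 h
  change covector c (mfderiv IC (𝓡 3) ConfigurationSpace.proj c v) = 0 ↔ _
  have h1 := covector_frame_eq h (chartDeriv (E := E5) y c v).1
  rw [← coframe_mfderiv_proj h, frame_coframe h0] at h1
  rw [h1, mul_eq_zero, or_iff_right hs.ne', coframe_mfderiv_proj h]

theorem localJAt_mem (o : ManifoldOrientation M) (g : Metric M) {y c : ConfigurationSpace M}
    (h : c ∈ (chartAt E5 y).source) (v : E5) :
    affineCovector (configBasis y) (chartAt E5 y c).2 (localJAt o g y c v).1 = 0 :=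
  (isRotation_turnCoord o g _ (mem_config_chartAt_target.1 ((chartAt E5 y).map_source h))).comp v.1

/-- The complex structure defined by the metric `g`. -/
def complexStructure (o : ManifoldOrientation M) (g : Metric M) (c : ConfigurationSpace M) :
    contactDistribution c →ₗ[ℝ] contactDistribution c where
  toFun v := ⟨chartDerivInv (E := E5) c c (localJAt o g c c (chartDeriv (E := E5) c c v)), by
    have h := mem_chart_source E5 c
    rw [mem_contactDistribution_iff h, chartDeriv_chartDerivInv h]
    exact localJAt_mem o g h _⟩
  map_add' v w := by
    refine Subtype.ext ?_
    have h1 : localJAt o g c c (chartDeriv (E := E5) c c v + chartDeriv (E := E5) c c w) =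
      localJAt o g c c (chartDeriv (E := E5) c c v) +
        localJAt o g c c (chartDeriv (E := E5) c c w) :=
      (jRel_iff.1 ((jRel_localJ _ _).add (jRel_localJ _ _))).symm
    change chartDerivInv (E := E5) c c (localJAt o g c c (chartDeriv (E := E5) c c (v + w))) =
      chartDerivInv (E := E5) c c _ + chartDerivInv (E := E5) c c _
    rw [map_add, h1, map_add]
  map_smul' r v := by
    refine Subtype.ext ?_
    have h1 : localJAt o g c c (r • chartDeriv (E := E5) c c v) =
      r • localJAt o g c c (chartDeriv (E := E5) c c v) :=
      (jRel_iff.1 ((jRel_localJ _ _).smul r)).symm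
    change chartDerivInv (E := E5) c c (localJAt o g c c (chartDeriv (E := E5) c c (r • v))) =
      r • chartDerivInv (E := E5) c c _
    rw [map_smul, h1, map_smul]

theorem chartDeriv_complexStructure (o : ManifoldOrientation M) (g : Metric M)
    (c : ConfigurationSpace M) (v : contactDistribution c) :
    chartDeriv (E := E5) c c (complexStructure o g c v) =
      localJAt o g c c (chartDeriv (E := E5) c c v) :=
  chartDeriv_chartDerivInv (mem_chart_source E5 c) _

theorem chartDeriv_injective {y c : ConfigurationSpace M} (h : c ∈ (chartAt E5 y).source) :
    Function.Injective (chartDeriv (E := E5) y c) := fun v w hvw => by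
  rw [← chartDerivInv_chartDeriv h v, hvw, chartDerivInv_chartDeriv h]

/-- Every tangent vector of `C` is the image of a tangent vector of `T^*M`, with components which
can be read off in any affine chart. -/
theorem exists_mfderiv_toConfig_eq {g : Metric M} {D : Connection M} (hD : IsLeviCivita g D)
    {p : CotangentBundle M} (hp : p.2 ≠ 0) (v : TangentSpace IC (toConfig p)) :
    ∃ ξ X η, HasComponents D p ξ X η ∧ mfderiv IT IC toConfig p ξ = v := by
  obtain ⟨y, h⟩ : ∃ y, toConfig p ∈ (chartAt E5 y).source := ⟨_, mem_chart_source E5 _⟩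
  obtain ⟨h0, hs⟩ := (toConfig_mem_source_iff hp).1 h
  set u := chartDeriv (E := E5) y (toConfig p) v with hu
  set s := p.2 (frame y.proj p.1 (configBasis y 0))
  set η : CotangentSpace p.1 := (s • connForm (configBasis y) (christoffelCoord g y.proj)
    (chartAt E5 y (toConfig p)) u).comp (coframe y.proj p.1) with hη
  obtain ⟨ξ, hξ⟩ := exists_hasComponents hD p (frame y.proj p.1 u.1) η
  refine ⟨ξ, _, _, hξ, chartDeriv_injective h ?_⟩
  have h1 : (chartDeriv (E := E5) y (toConfig p) (mfderiv IT IC toConfig p ξ)).1 = u.1 := by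
    rw [chartDeriv_mfderiv_toConfig_fst hp h, hξ.1]
    exact coframe_frame_self h0 _
  refine Prod.ext h1 (funext fun j => ?_)
  have hk := affineCovector_kernelVector (configBasis y) (chartAt E5 y (toConfig p)).2 j
  have h2 := connForm_chartDeriv_toConfig hD hp h hξ hk
  have h3 : η (frame y.proj p.1 (kernelVector (configBasis y) (chartAt E5 y (toConfig p)).2 j)) =
      s * connForm (configBasis y) (christoffelCoord g y.proj) (chartAt E5 y (toConfig p)) u
        (kernelVector (configBasis y) (chartAt E5 y (toConfig p)).2 j) :=
    congrArg (fun t => s * connForm (configBasis y) (christoffelCoord g y.proj)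
      (chartAt E5 y (toConfig p)) u t) (coframe_frame_self h0 _)
  have h4 := mul_left_cancel₀ hs.ne' (h2.trans h3)
  rw [connForm_apply, connForm_apply, fiberCovector_kernelVector, fiberCovector_kernelVector,
    h1] at h4
  exact sub_left_injective h4

/-- The formula determines the complex structure in every affine chart. -/
theorem IsGivenBy.chartDeriv_apply {o : ManifoldOrientation M} {g : Metric M}
    {J : ∀ c : ConfigurationSpace M, contactDistribution c →ₗ[ℝ] contactDistribution c}
    (hJ : IsGivenBy o g J) {y c : ConfigurationSpace M} (h : c ∈ (chartAt E5 y).source)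
    (v : contactDistribution c) :
    chartDeriv (E := E5) y c (J c v) = localJAt o g y c (chartDeriv (E := E5) y c v) := by
  obtain ⟨p, hp, rfl⟩ : ∃ p : CotangentBundle M, p.2 ≠ 0 ∧ toConfig p = c :=
    ⟨⟨c.proj, covector c⟩, covector_ne_zero c, toConfig_covector c⟩
  obtain ⟨v, hv⟩ := v
  obtain ⟨ξ, X, η, hξ, rfl⟩ := exists_mfderiv_toConfig_eq (isLeviCivita_leviCivita g) hp v
  obtain ⟨ξ', hξ'⟩ := exists_hasComponents (isLeviCivita_leviCivita g) p
    (turnVector o g p.2 X) (turn o g p.2 η)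
  rw [hJ _ (isLeviCivita_leviCivita g) p hp ξ ξ' X η hξ hξ' hv]
  exact chartDeriv_toConfig_of_hasComponents (isLeviCivita_leviCivita g) hp h hξ hξ'

theorem isGivenBy_complexStructure (o : ManifoldOrientation M) (g : Metric M) :
    IsGivenBy o g (complexStructure o g) := by
  intro D hD p hp ξ ξ' X η hξ hξ' h
  have hs := mem_chart_source E5 (toConfig p)
  refine chartDeriv_injective hs ?_
  rw [chartDeriv_toConfig_of_hasComponents hD hp hs hξ hξ']
  exact chartDeriv_complexStructure o g (toConfig p) _

theorem isGivenBy_iff {o : ManifoldOrientation M} {g : Metric M}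
    {J : ∀ c : ConfigurationSpace M, contactDistribution c →ₗ[ℝ] contactDistribution c} :
    IsGivenBy o g J ↔ J = complexStructure o g := by
  refine ⟨fun hJ => funext fun c => LinearMap.ext fun v => Subtype.ext ?_, fun h => ?_⟩
  · refine chartDeriv_injective (mem_chart_source E5 c) ?_
    rw [hJ.chartDeriv_apply (mem_chart_source E5 c), chartDeriv_complexStructure]
  · rw [h]
    exact isGivenBy_complexStructure o g

/-- The complex structure depends on the conformal class of the metric only. -/
theorem complexStructure_conformal (o : ManifoldOrientation M) {g g' : Metric M}
    (h : ConformallyRelated g g') : complexStructure o g' = complexStructure o g := by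
  obtain ⟨Ω, hΩ, hpos, hgg'⟩ := h
  refine funext fun c => LinearMap.ext fun v => Subtype.ext ?_
  have hs := mem_chart_source E5 c
  have hz := mem_config_chartAt_target.1 ((chartAt E5 c).map_source hs)
  refine chartDeriv_injective hs ?_
  rw [chartDeriv_complexStructure, chartDeriv_complexStructure]
  have hv := (mem_contactDistribution_iff hs v.1).1 v.2
  set z := chartAt E5 c c with hzc
  have hf : DifferentiableAt ℝ (Ω ∘ (chartAt E3 c.proj).symm) z.1 := by
    have h1 := mdifferentiableAt_atlas_symm (I := 𝓡 3) (chart_mem_atlas E3 c.proj) hz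
    have h2 := ((hΩ.contMDiffAt (x := (chartAt E3 c.proj).symm z.1)).mdifferentiableAt
      (by simp)).comp z.1 h1
    exact mdifferentiableAt_iff_differentiableAt.1 h2
  obtain ⟨υ, N, hN⟩ := christoffel_conformal (G := metricCoord g c.proj)
    (G' := metricCoord g' c.proj) hf (hpos _).ne'
    ((contDiffAt_metricCoord g hz).differentiableAt (by simp)) (isInvertible_metricCoord g hz)
    (isInvertible_metricCoord g' hz) (eventually_metricCoord_symm g c.proj z.1)
    (Filter.Eventually.of_forall fun a Y Z => hgg' _ _ _)
  have h1 := jRel_localJ (b := configBasis c) (Γ := christoffelCoord g c.proj)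
    (R := turnCoord o g c.proj (configBasis c)) z (chartDeriv (E := E5) c c v)
  have h2 := h1.congr_christoffel (Γ' := christoffelCoord g' c.proj)
    (c := affineCovector (configBasis c) z.2 N) (isRotation_turnCoord o g _ hz) hv
    fun X U hX hU => by
      have h3 := congrArg (affineCovector (configBasis c) z.2) (hN X U)
      simp only [map_add, map_sub, map_smul, hX, hU, smul_eq_mul, mul_zero, add_zero] at h3
      rw [mul_comm]
      exact h3
  have h3 : JRel (configBasis c) (christoffelCoord g' c.proj)
      (turnCoord o g' c.proj (configBasis c)) z (chartDeriv (E := E5) c c v)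
      (localJAt o g c c (chartDeriv (E := E5) c c v)) := by
    have h4 := turnCoord_conformal o hpos hgg' (configBasis c) hz
    rw [JRel, h4]
    exact h2
  exact (jRel_iff.1 h3).symm

end

/-! ### The CR structure -/

section

variable {b : Module.Basis (Fin 3) ℝ E3} {Γ : E3 → E3 →L[ℝ] E3 →L[ℝ] E3} {R : E5 → E3 →L[ℝ] E3}

/-- A frame of the contact distribution in an affine chart: two horizontal directions followed by
the two directions of the fibre. -/
def contactFrame (b : Module.Basis (Fin 3) ℝ E3) (z : E5) : Fin 4 → E5 :=
  ![(kernelVector b z.2 0, 0), (kernelVector b z.2 1, 0), (0, Pi.single 0 1), (0, Pi.single 1 1)]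

theorem contDiff_kernelVector (j : Fin 2) : ContDiff ℝ ∞ fun z : E5 => kernelVector b z.2 j := by
  have h : ContDiff ℝ ∞ fun z : E5 => z.2 j := by fun_prop
  exact contDiff_const.sub (h.smul contDiff_const)

theorem contDiff_contactFrame (i : Fin 4) : ContDiff ℝ ∞ fun z => contactFrame b z i := by
  fin_cases i
  · exact (contDiff_kernelVector 0).prodMk contDiff_const
  · exact (contDiff_kernelVector 1).prodMk contDiff_const
  · exact contDiff_const
  · exact contDiff_const

theorem sum_contactFrame (z : E5) (a : Fin 4 → ℝ) : ∑ i, a i • contactFrame b z i =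
    (a 0 • kernelVector b z.2 0 + a 1 • kernelVector b z.2 1, ![a 2, a 3]) := by
  have e3 : contactFrame b z 3 = (0, Pi.single 1 1) := rfl
  have e2 : contactFrame b z 2 = (0, Pi.single 0 1) := rfl
  have e1 : contactFrame b z 1 = (kernelVector b z.2 1, 0) := rfl
  have e0 : contactFrame b z 0 = (kernelVector b z.2 0, 0) := rfl
  rw [Fin.sum_univ_four, e0, e1, e2, e3]
  refine Prod.ext (by simp) (funext fun j => ?_)
  fin_cases j <;> simp

theorem linearIndependent_contactFrame (z : E5) : LinearIndependent ℝ (contactFrame b z) := by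
  rw [Fintype.linearIndependent_iff]
  intro a ha
  rw [sum_contactFrame] at ha
  obtain ⟨h1, h2⟩ := Prod.ext_iff.1 ha
  have h3 := congrArg (b.coord 1) h1
  have h4 := congrArg (b.coord 2) h1
  have h5 := congrFun h2 0
  have h6 := congrFun h2 1
  simp [kernelVector] at h3 h4 h5 h6
  intro i
  fin_cases i
  · exact h3
  · exact h4
  · exact h5
  · exact h6

theorem mem_span_contactFrame {z v : E5} :
    v ∈ Submodule.span ℝ (Set.range (contactFrame b z)) ↔ affineCovector b z.2 v.1 = 0 := by
  rw [Submodule.mem_span_range_iff_exists_fun]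
  constructor
  · rintro ⟨a, rfl⟩
    rw [sum_contactFrame]
    simp [affineCovector_kernelVector]
  · intro hv
    refine ⟨![b.coord 1 v.1, b.coord 2 v.1, v.2 0, v.2 1], ?_⟩
    rw [sum_contactFrame]
    refine Prod.ext ?_ (funext fun j => ?_)
    · have h := eq_sum_kernelVector hv
      rw [Fin.sum_univ_two] at h
      exact h.symm
    · fin_cases j <;> rfl

theorem contDiffAt_localJ {z : E5} {f : E5 → E5} (hΓ : ContDiffAt ℝ ∞ Γ z.1)
    (hR : ContDiffAt ℝ ∞ R z) (hf : ContDiffAt ℝ ∞ f z) :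
    ContDiffAt ℝ ∞ (fun z => localJ b Γ R z (f z)) z := by
  have hΓ' : ContDiffAt ℝ ∞ (fun z : E5 => Γ z.1) z := hΓ.comp z contDiffAt_fst
  have hf1 : ContDiffAt ℝ ∞ (fun z => (f z).1) z := contDiffAt_fst.comp z hf
  have hf2 : ContDiffAt ℝ ∞ (fun z => (f z).2) z := contDiffAt_snd.comp z hf
  have hp : ContDiffAt ℝ ∞ (fun z : E5 => affineCovector b z.2) z :=
    (contDiff_affineCovector b).contDiffAt
  have hX := hR.clm_apply hf1
  have hk : ∀ j, ContDiffAt ℝ ∞ (fun z : E5 => kernelVector b z.2 j) z := fun j =>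
    (contDiff_kernelVector j).contDiffAt
  refine hX.prodMk (contDiffAt_pi.2 fun j => ?_)
  have h1 := hR.clm_apply (hk j)
  have h2 : ContDiffAt ℝ ∞ (fun z => fiberCovector b (f z).2) z :=
    (fiberCovector b).contDiff.contDiffAt.comp z hf2
  have h3 : ContDiffAt ℝ ∞ (fun z => connForm b Γ z (f z) (R z (kernelVector b z.2 j))) z :=
    (h2.clm_apply h1).sub (hp.clm_apply ((hΓ'.clm_apply hf1).clm_apply h1))
  exact h3.neg.add (hp.clm_apply ((hΓ'.clm_apply hX).clm_apply (hk j)))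

theorem dContact_add_left (v v' w : E5) :
    dContact b (v + v') w = dContact b v w + dContact b v' w := by
  simp [dContact]; ring

theorem dContact_smul_left (r : ℝ) (v w : E5) : dContact b (r • v) w = r * dContact b v w := by
  simp [dContact]; ring

theorem dContact_add_right (v w w' : E5) :
    dContact b v (w + w') = dContact b v w + dContact b v w' := by
  simp [dContact]; ring

theorem dContact_smul_right (r : ℝ) (v w : E5) : dContact b v (r • w) = r * dContact b v w := by
  simp [dContact]; ring

end

section

variable {M : Type*} [TopologicalSpace M] [ChartedSpace E3 M] [IsManifold (𝓡 3) ∞ M]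

theorem isSmoothSubbundle_contactDistribution :
    IsSmoothSubbundle (contactDistribution (M := M)) (2 * 2) := by
  intro y
  refine ⟨(chartAt E5 y).source, (chartAt E5 y).open_source, mem_chart_source E5 y,
    fun (i : Fin 4) => coordField (E := E5) y fun z => contactFrame (configBasis y) z i, ?_, ?_⟩
  · intro i c hc
    refine ((contMDiffAt_field_iff hc _).2 ?_).contMDiffWithinAt
    exact (contDiff_contactFrame i).contDiffAt.congr_of_eventuallyEq
      (fieldCoord_coordField_eventuallyEq hc _)
  · intro c hc
    set z := chartAt E5 y c with hz
    let e : E5 →ₗ[ℝ] TangentSpace IC c := (chartDerivInv (E := E5) y c).toLinearMap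
    have he : Function.Injective e := fun v w hvw => by
      rw [← chartDeriv_chartDerivInv (E := E5) hc v, ← chartDeriv_chartDerivInv (E := E5) hc w]
      exact congrArg (chartDeriv (E := E5) y c) hvw
    refine ⟨(linearIndependent_contactFrame z).map' e (LinearMap.ker_eq_bot.2 he), ?_⟩
    have h1 : Set.range (fun i : Fin 4 =>
        coordField (E := E5) y (fun z => contactFrame (configBasis y) z i) c) =
        e '' Set.range (contactFrame (configBasis y) z) := by
      rw [← Set.range_comp]; rfl
    refine (congrArg (Submodule.span ℝ) h1).trans ?_
    rw [Submodule.span_image]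
    ext v
    rw [mem_contactDistribution_iff hc, ← mem_span_contactFrame, Submodule.mem_map]
    constructor
    · rintro ⟨w, hw, rfl⟩
      have : chartDeriv (E := E5) y c (e w) = w := chartDeriv_chartDerivInv hc w
      rwa [this]
    · intro hv
      exact ⟨_, hv, chartDerivInv_chartDeriv hc v⟩

theorem chartDeriv_complexStructure_apply (o : ManifoldOrientation M) (g : Metric M)
    {y c : ConfigurationSpace M} (h : c ∈ (chartAt E5 y).source) (v : contactDistribution c) :
    chartDeriv (E := E5) y c (complexStructure o g c v) =
      localJAt o g y c (chartDeriv (E := E5) y c v) :=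
  (isGivenBy_complexStructure o g).chartDeriv_apply h v

theorem applyField_mem {J : ∀ c : ConfigurationSpace M,
    contactDistribution c →ₗ[ℝ] contactDistribution c} {ξ : ∀ c, TangentSpace IC c}
    {c : ConfigurationSpace M} (h : ξ c ∈ contactDistribution c) :
    applyField J ξ c = J c ⟨ξ c, h⟩ := dif_pos h

/-- A section of the contact distribution and its image under the complex structure, in the
preferred chart at a point. -/
theorem eventually_fieldCoord (o : ManifoldOrientation M) (g : Metric M)
    {U : Set (ConfigurationSpace M)} (hU : IsOpen U) {ξ : ∀ c, TangentSpace IC c}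
    (hξ : ∀ c ∈ U, ξ c ∈ contactDistribution c) {c : ConfigurationSpace M} (hc : c ∈ U) :
    ∀ᶠ z in 𝓝 (chartAt E5 c c),
      affineCovector (configBasis c) z.2 (fieldCoord (E := E5) c ξ z).1 = 0 ∧
      fieldCoord (E := E5) c (applyField (complexStructure o g) ξ) z =
        localJ (configBasis c) (christoffelCoord g c.proj)
          (turnCoord o g c.proj (configBasis c)) z (fieldCoord (E := E5) c ξ z) := by
  have hmem : (chartAt E5 c).target ∩ (chartAt E5 c).symm ⁻¹' U ∈ 𝓝 (chartAt E5 c c) :=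
    ((chartAt E5 c).isOpen_inter_preimage_symm hU).mem_nhds
      ⟨mem_chart_target E5 c, by simpa using hc⟩
  filter_upwards [hmem] with z hz
  have hs := (chartAt E5 c).map_target hz.1
  have hH := hξ _ hz.2
  have h1 := (mem_contactDistribution_iff hs _).1 hH
  have h2 := chartDeriv_complexStructure_apply o g hs ⟨_, hH⟩
  rw [localJAt, (chartAt E5 c).right_inv hz.1] at h2
  rw [(chartAt E5 c).right_inv hz.1] at h1
  refine ⟨h1, Eq.trans ?_ h2⟩
  rw [fieldCoord, applyField_mem hH]

theorem contDiffAt_fieldCoord {U : Set (ConfigurationSpace M)} (hU : IsOpen U)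
    {ξ : ∀ c, TangentSpace IC c} (hξ : IsSmoothField (I := IC) U ξ) {c : ConfigurationSpace M}
    (hc : c ∈ U) : ContDiffAt ℝ ∞ (fieldCoord (E := E5) c ξ) (chartAt E5 c c) :=
  (contMDiffAt_field_iff (mem_chart_source E5 c) ξ).1
    ((hξ c hc).contMDiffAt (hU.mem_nhds hc))

theorem isSmoothField_applyField (o : ManifoldOrientation M) (g : Metric M)
    {U : Set (ConfigurationSpace M)} (hU : IsOpen U) {ξ : ∀ c, TangentSpace IC c}
    (hξ : IsSection contactDistribution U ξ) :
    IsSmoothField (I := IC) U (applyField (complexStructure o g) ξ) := by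
  intro c hc
  refine ContMDiffAt.contMDiffWithinAt ?_
  refine (contMDiffAt_field_iff (mem_chart_source E5 c) _).2 ?_
  obtain ⟨V, hV, hmodel⟩ := exists_isLocalModel o g c.proj (configBasis c)
  have hz : chartAt E5 c c ∈ V ×ˢ (Set.univ : Set (Fin 2 → ℝ)) := ⟨hV, trivial⟩
  refine (contDiffAt_localJ (b := configBasis c) (hmodel.christoffel _ hz)
    (hmodel.rotation.contDiffAt (hmodel.isOpen.mem_nhds hz))
    (contDiffAt_fieldCoord hU hξ.1 hc)).congr_of_eventuallyEq ?_
  exact (eventually_fieldCoord o g hU hξ.2 hc).mono fun z hz => hz.2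

theorem complexStructure_sq (o : ManifoldOrientation M) (g : Metric M) (c : ConfigurationSpace M)
    (v : contactDistribution c) :
    complexStructure o g c (complexStructure o g c v) = -v := by
  have hs := mem_chart_source E5 c
  refine Subtype.ext (chartDeriv_injective hs ?_)
  rw [chartDeriv_complexStructure, chartDeriv_complexStructure]
  have hR := isRotation_turnCoord o g (configBasis c)
    (mem_config_chartAt_target.1 ((chartAt E5 c).map_source hs))
  have hv := (mem_contactDistribution_iff hs v.1).1 v.2
  have h1 := JRel.sq hR hv (jRel_localJ (Γ := christoffelCoord g c.proj) _ _)
  refine (jRel_iff.1 h1).symm.trans ?_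
  exact (map_neg (chartDeriv (E := E5) c c) _).symm

theorem isAlmostCR_complexStructure (o : ManifoldOrientation M) (g : Metric M) :
    IsAlmostCR contactDistribution (complexStructure o g) 2 where
  subbundle := isSmoothSubbundle_contactDistribution
  smooth _ hU _ hξ := isSmoothField_applyField o g hU hξ
  sq := complexStructure_sq o g

theorem isIntegrable_complexStructure (o : ManifoldOrientation M) (g : Metric M) :
    IsIntegrable (complexStructure o g) := by
  intro U hU ξ η hξ hη c hc
  have hs := mem_chart_source E5 c
  obtain ⟨V, hV, hmodel⟩ := exists_isLocalModel o g c.proj (configBasis c)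
  have hz : chartAt E5 c c ∈ V ×ˢ (Set.univ : Set (Fin 2 → ℝ)) := ⟨hV, trivial⟩
  have hξ' := isSmoothField_applyField o g hU hξ
  have hη' := isSmoothField_applyField o g hU hη
  have hd : ∀ {ζ : ∀ c, TangentSpace IC c}, IsSmoothField (I := IC) U ζ →
      DifferentiableAt ℝ (fieldCoord (E := E5) c ζ) (chartAt E5 c c) := fun h =>
    (contDiffAt_fieldCoord hU h hc).differentiableAt (by simp)
  have hbr : ∀ {ζ ζ' : ∀ c, TangentSpace IC c}, IsSmoothField (I := IC) U ζ →
      IsSmoothField (I := IC) U ζ' →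
      chartDeriv (E := E5) c c (VectorField.mlieBracket IC ζ ζ' c) = VectorField.lieBracket ℝ
        (fieldCoord (E := E5) c ζ) (fieldCoord (E := E5) c ζ') (chartAt E5 c c) := fun h h' =>
    chartDeriv_mlieBracket hs ((mdifferentiableAt_field_iff hs _).2 (hd h))
      ((mdifferentiableAt_field_iff hs _).2 (hd h'))
  have hJ : ∀ {ζ : ∀ c, TangentSpace IC c}, IsSection contactDistribution U ζ →
      ∀ᶠ z in 𝓝 (chartAt E5 c c),
        affineCovector (configBasis c) z.2 (fieldCoord (E := E5) c ζ z).1 = 0 ∧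
        JRel (configBasis c) (christoffelCoord g c.proj) (turnCoord o g c.proj (configBasis c)) z
          (fieldCoord (E := E5) c ζ z)
          (fieldCoord (E := E5) c (applyField (complexStructure o g) ζ) z) := fun h =>
    (eventually_fieldCoord o g hU h.2 hc).mono fun z hz => ⟨hz.1, jRel_iff.2 hz.2⟩
  obtain ⟨h1, h2⟩ := hmodel.nijenhuis hz (hd hξ.1) (hd hξ') (hd hη.1) (hd hη') (hJ hξ) (hJ hη)
  have hB : chartDeriv (E := E5) c c (VectorField.mlieBracket IC
      (applyField (complexStructure o g) ξ) η c +
      VectorField.mlieBracket IC ξ (applyField (complexStructure o g) η) c) = _ :=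
    (map_add (chartDeriv (E := E5) c c) _ _).trans (congrArg₂ (· + ·) (hbr hξ' hη.1) (hbr hξ.1 hη'))
  have hA : chartDeriv (E := E5) c c (VectorField.mlieBracket IC ξ η c -
      VectorField.mlieBracket IC (applyField (complexStructure o g) ξ)
        (applyField (complexStructure o g) η) c) = _ :=
    (map_sub (chartDeriv (E := E5) c c) _ _).trans (congrArg₂ (· - ·) (hbr hξ.1 hη.1) (hbr hξ' hη'))
  rw [← hB] at h1 h2
  rw [← hA] at h2
  have hH := (mem_contactDistribution_iff hs _).2 h1
  refine ⟨hH, chartDeriv_injective hs ?_⟩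
  have h3 := chartDeriv_complexStructure o g c ⟨_, hH⟩
  have h4 := jRel_iff.1 h2
  refine (map_add (chartDeriv (E := E5) c c) _ _).trans ?_
  refine (congrArg (_ + ·) (h3.trans h4.symm)).trans ?_
  exact (add_neg_cancel _).trans (map_zero (chartDeriv (E := E5) c c)).symm

/-- The contact form at a point, in the preferred chart. -/
def contactFunctional (c : ConfigurationSpace M) : TangentSpace IC c →ₗ[ℝ] ℝ :=
  (affineCovector (configBasis c) (chartAt E5 c c).2).toLinearMap ∘ₗ
    LinearMap.fst ℝ E3 (Fin 2 → ℝ) ∘ₗ (chartDeriv (E := E5) c c).toLinearMap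

theorem ker_contactFunctional (c : ConfigurationSpace M) :
    LinearMap.ker (contactFunctional c) = contactDistribution c :=
  Submodule.ext fun v => (mem_contactDistribution_iff (mem_chart_source E5 c) v).symm

theorem contactFunctional_surjective (c : ConfigurationSpace M) :
    Function.Surjective (contactFunctional c) := by
  intro t
  refine ⟨chartDerivInv (E := E5) c c (t • configBasis c 0, 0), ?_⟩
  change affineCovector _ _ (chartDeriv (E := E5) c c (chartDerivInv (E := E5) c c _)).1 = t
  rw [chartDeriv_chartDerivInv (mem_chart_source E5 c)]
  simp [affineCovector_zero]

/-- The identification of `TC/H` with the real line by the contact form. -/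
def quotientEquiv (c : ConfigurationSpace M) :
    (TangentSpace IC c ⧸ contactDistribution c) ≃ₗ[ℝ] ℝ :=
  (Submodule.quotEquivOfEq _ _ (ker_contactFunctional c).symm).trans
    ((contactFunctional c).quotKerEquivOfSurjective (contactFunctional_surjective c))

theorem quotientEquiv_mkQ (c : ConfigurationSpace M) (v : TangentSpace IC c) :
    quotientEquiv c ((contactDistribution c).mkQ v) = contactFunctional c v := rfl

/-- The Levi form, which is minus the exterior derivative of the contact form. -/
def leviForm (c : ConfigurationSpace M) : contactDistribution c →ₗ[ℝ] contactDistribution c →ₗ[ℝ]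
    (TangentSpace IC c ⧸ contactDistribution c) :=
  LinearMap.mk₂ ℝ (fun v w => (quotientEquiv c).symm (-dContact (configBasis c)
      (chartDeriv (E := E5) c c v) (chartDeriv (E := E5) c c w)))
    (fun v v' w => by
      rw [← map_add, Submodule.coe_add, map_add, dContact_add_left, neg_add])
    (fun r v w => by
      rw [← map_smul, Submodule.coe_smul, map_smul, dContact_smul_left, smul_eq_mul, mul_neg])
    (fun v w w' => by
      rw [← map_add, Submodule.coe_add, map_add, dContact_add_right, neg_add])
    (fun r v w => by
      rw [← map_smul, Submodule.coe_smul, map_smul, dContact_smul_right, smul_eq_mul, mul_neg])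

theorem leviForm_apply (c : ConfigurationSpace M) (v w : contactDistribution c) :
    leviForm c v w = (quotientEquiv c).symm (-dContact (configBasis c)
      (chartDeriv (E := E5) c c v) (chartDeriv (E := E5) c c w)) := rfl

theorem isLeviForm_leviForm (o : ManifoldOrientation M) (g : Metric M)
    (c : ConfigurationSpace M) : IsLeviForm contactDistribution c (leviForm c) := by
  intro U hU hc ξ η hξ hη h h'
  have hs := mem_chart_source E5 c
  have hd : ∀ {ζ : ∀ c, TangentSpace IC c}, IsSmoothField (I := IC) U ζ →
      DifferentiableAt ℝ (fieldCoord (E := E5) c ζ) (chartAt E5 c c) := fun h =>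
    (contDiffAt_fieldCoord hU h hc).differentiableAt (by simp)
  have h1 := chartDeriv_mlieBracket hs ((mdifferentiableAt_field_iff hs _).2 (hd hξ.1))
      ((mdifferentiableAt_field_iff hs _).2 (hd hη.1))
  have h2 := IsLocalModel.contactForm_lieBracket (b := configBasis c) (hd hξ.1) (hd hη.1)
    ((eventually_fieldCoord o g hU hξ.2 hc).mono fun z hz => hz.1)
    ((eventually_fieldCoord o g hU hη.2 hc).mono fun z hz => hz.1)
  refine (quotientEquiv c).injective ?_
  rw [quotientEquiv_mkQ, leviForm_apply, LinearEquiv.apply_symm_apply]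
  rw [fieldCoord_chartAt hs, fieldCoord_chartAt hs, ← h1] at h2
  exact h2.symm

/-- A vector in the kernel of the affine covector comes from the contact distribution. -/
theorem exists_chartDeriv_eq (c : ConfigurationSpace M) {w : E5}
    (hw : affineCovector (configBasis c) (chartAt E5 c c).2 w.1 = 0) :
    ∃ v : contactDistribution c, chartDeriv (E := E5) c c v = w := by
  have hs := mem_chart_source E5 c
  have h1 := chartDeriv_chartDerivInv (E := E5) hs w
  refine ⟨⟨chartDerivInv (E := E5) c c w, ?_⟩, h1⟩
  rw [mem_contactDistribution_iff hs, h1]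
  exact hw

theorem isLeviIndefinite_complexStructure (o : ManifoldOrientation M) (g : Metric M) :
    IsLeviIndefinite (complexStructure o g) := by
  intro c
  have hs := mem_chart_source E5 c
  have hz := mem_config_chartAt_target.1 ((chartAt E5 c).map_source hs)
  have hR := isRotation_turnCoord o g (configBasis c) hz
  have hΓ := christoffelCoord_symm g hz
  refine ⟨?_, leviForm c, isLeviForm_leviForm o g c, ?_, ?_, ?_⟩
  · rw [(quotientEquiv c).finrank_eq, Module.finrank_self]
  · intro v hv
    refine Subtype.ext (chartDeriv_injective hs ?_)
    refine (dContact_nondegenerate (b := configBasis c)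
      ((mem_contactDistribution_iff hs v.1).1 v.2) fun w hw => ?_).trans
      (map_zero (chartDeriv (E := E5) c c)).symm
    obtain ⟨w, rfl⟩ := exists_chartDeriv_eq c hw
    have h1 := hv w
    rw [leviForm_apply, LinearEquiv.map_eq_zero_iff, neg_eq_zero] at h1
    exact h1
  · intro v w
    rw [leviForm_apply, leviForm_apply, chartDeriv_complexStructure, chartDeriv_complexStructure]
    congr 2
    exact dContact_jRel hΓ hR ((mem_contactDistribution_iff hs v.1).1 v.2)
      ((mem_contactDistribution_iff hs w.1).1 w.2) (jRel_localJ _ _) (jRel_localJ _ _)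
  · intro α hα
    set a := α ((quotientEquiv c).symm 1) with ha
    have hα' : ∀ t, α ((quotientEquiv c).symm t) = t * a := fun t => by
      rw [ha, ← smul_eq_mul, ← map_smul, ← map_smul, smul_eq_mul, mul_one]
    have ha0 : a ≠ 0 := fun h0 => hα (LinearMap.ext fun q => by
      rw [← (quotientEquiv c).symm_apply_apply q, hα', h0, mul_zero]; rfl)
    have key : ∀ t : ℝ, ∃ v, α (leviForm c v (complexStructure o g c v)) = t * a := fun t => by
      obtain ⟨w, hw, hw'⟩ := exists_dContact_jRel_pos_neg (b := configBasis c) hΓ hR (-t)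
      obtain ⟨v, rfl⟩ := exists_chartDeriv_eq c hw
      refine ⟨v, ?_⟩
      rw [leviForm_apply, chartDeriv_complexStructure, hα', localJAt, hw', neg_neg]
    obtain ⟨v, hv⟩ := key a
    obtain ⟨w, hw⟩ := key (-a)
    refine ⟨⟨v, hv ▸ mul_self_pos.2 ha0⟩, w, ?_⟩
    rw [hw, neg_mul]
    exact neg_lt_zero.2 (mul_self_pos.2 ha0)

end

end Saucer

end

theorem mainTheorem5 {M : Type*} [TopologicalSpace M] [ChartedSpace Saucer.E3 M]
    [IsManifold (𝓡 3) ∞ M] (o : Saucer.ManifoldOrientation M)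
    (𝒢 : Set (Saucer.Metric M)) (h𝒢 : Saucer.IsConformalClass 𝒢) :
    ∃ J : ∀ c : Saucer.ConfigurationSpace M,
        Saucer.contactDistribution c →ₗ[ℝ] Saucer.contactDistribution c,
      (∀ g ∈ 𝒢, ∀ J' : ∀ c : Saucer.ConfigurationSpace M,
          Saucer.contactDistribution c →ₗ[ℝ] Saucer.contactDistribution c,
        Saucer.IsGivenBy o g J' ↔ J' = J) ∧
      Saucer.IsAlmostCR Saucer.contactDistribution J 2 ∧
      Saucer.IsIntegrable J ∧
      Saucer.IsLeviIndefinite J := by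
  obtain ⟨g₀, rfl⟩ := h𝒢
  refine ⟨Saucer.complexStructure o g₀, fun g hg J' => ?_, Saucer.isAlmostCR_complexStructure o g₀,
    Saucer.isIntegrable_complexStructure o g₀, Saucer.isLeviIndefinite_complexStructure o g₀⟩
  rw [Saucer.isGivenBy_iff, Saucer.complexStructure_conformal o hg]
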